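/- An algorithm is a (deterministic) random access machine program whose running time is measured by logarithmic cost. For a parameterized problem with parameter $k$, an $\mathcal{O}^*(f(k))$ time algorithm is one that runs in time at most $f(k)\cdot p(N)$ on every instance, for some fixed polynomial $p$, where $N$ is the size of the input. A connected vertex cover of a finite simple graph $G$ is a vertex cover $X$ of $G$ such that the induced subgraph $G[X]$ is connected (in particular, $X \neq \emptyset$). A set $S \subseteq V(G)$ is a split deletion set of $G$ if the vertex set of $G-S$ can be partitioned into a clique and an independent set (either may be empty), and a clique deletion set of $G$ if $G-S$ is a complete graph (possibly without vertices). The Set Cover Conjecture states that for no $\varepsilon>0$ is there an $\mathcal{O}^*((2-\varepsilon)^{|U|})$ time algorithm which, given a finite universe $U$, a family $\mathcal{F}$ of subsets of $U$ and a positive integer $\ell$, decides whether at most $\ell$ sets of $\mathcal{F}$ cover $U$. **Theorem.** (1) There is an algorithm that, given a finite simple graph $G$, a split deletion set $S$ of $G$ and a positive integer $\ell$, decides in $\mathcal{O}^*(3^{|S|})$ time whether $G$ has a connected vertex cover of size at most $\ell$. (2) If the Set Cover Conjecture holds, then for no $\varepsilon>0$ is there an $\mathcal{O}^*((2-\varepsilon)^{|S|})$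 time algorithm for the problem in (1). (3) There is an algorithm that, given a finite simple graph $G$, a clique deletion set $S$ of $G$ and a positive integer $\ell$, decides in $\mathcal{O}^*(2^{|S|})$ time whether $G$ has a connected vertex cover of size at most $\ell$. -/

import Mathlib

/-! ## Random access machines with logarithmic cost

Programs act on numbered registers and on an indirectly addressed memory, both holding natural
numbers. Control flow is structured (sequence, conditional, while loop). The time of an instruction
is the total bit length of the numbers it handles (operands, result, memory address). -/

/-- The arithmetic instructions; `sub` is truncated subtraction, `div` is integer division. -/
inductive RamOp where
  | add
  | sub
  | mul
  | div

def RamOp.eval : RamOp → ℕ → ℕ → ℕ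
  | .add, a, b => a + b
  | .sub, a, b => a - b
  | .mul, a, b => a * b
  | .div, a, b => a / b

/-- RAM programs. -/
inductive RamProg where
  /-- do nothing -/
  | skip : RamProg
  /-- `reg x := c` -/
  | const (x c : ℕ) : RamProg
  /-- `reg x := reg y ∘ reg z` -/
  | arith (o : RamOp) (x y z : ℕ) : RamProg
  /-- `reg x := mem (reg y)` -/
  | load (x y : ℕ) : RamProg
  /-- `mem (reg x) := reg y` -/
  | store (x y : ℕ) : RamProg
  /-- first `p`, then `q` -/
  | seq (p q : RamProg) : RamProg
  /-- if `reg x ≠ 0` then `p` else `q` -/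
  | cond (x : ℕ) (p q : RamProg) : RamProg
  /-- while `reg x ≠ 0` do `p` -/
  | loop (x : ℕ) (p : RamProg) : RamProg

/-- A memory state of the machine: the contents of the registers and of the memory cells. -/
structure RamState where
  reg : ℕ → ℕ
  mem : ℕ → ℕ

def RamState.setReg (s : RamState) (x v : ℕ) : RamState :=
  { s with reg := Function.update s.reg x v }

def RamState.setMem (s : RamState) (a v : ℕ) : RamState :=
  { s with mem := Function.update s.mem a v }

/-- Logarithmic cost of a number: the number of its binary digits, plus one. -/
def bitCost (v : ℕ) : ℕ := Nat.size v + 1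

/-- `RamExec p s t s'`: started in state `s`, the program `p` halts after time exactly `t`,
in state `s'`. -/
inductive RamExec : RamProg → RamState → ℕ → RamState → Prop where
  | skip (s : RamState) : RamExec .skip s 1 s
  | const (x c : ℕ) (s : RamState) : RamExec (.const x c) s (bitCost c) (s.setReg x c)
  | arith (o : RamOp) (x y z : ℕ) (s : RamState) :
      RamExec (.arith o x y z) s
        (bitCost (s.reg y) + bitCost (s.reg z) + bitCost (o.eval (s.reg y) (s.reg z)))
        (s.setReg x (o.eval (s.reg y) (s.reg z)))
  | load (x y : ℕ) (s : RamState) :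
      RamExec (.load x y) s (bitCost (s.reg y) + bitCost (s.mem (s.reg y)))
        (s.setReg x (s.mem (s.reg y)))
  | store (x y : ℕ) (s : RamState) :
      RamExec (.store x y) s (bitCost (s.reg x) + bitCost (s.reg y))
        (s.setMem (s.reg x) (s.reg y))
  | seq {p q : RamProg} {s s' s'' : RamState} {t t' : ℕ} :
      RamExec p s t s' → RamExec q s' t' s'' → RamExec (.seq p q) s (t + t') s''
  | cond_true {x : ℕ} {p q : RamProg} {s s' : RamState} {t : ℕ} :
      s.reg x ≠ 0 → RamExec p s t s' → RamExec (.cond x p q) s (bitCost (s.reg x) + t) s'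
  | cond_false {x : ℕ} {p q : RamProg} {s s' : RamState} {t : ℕ} :
      s.reg x = 0 → RamExec q s t s' → RamExec (.cond x p q) s (bitCost (s.reg x) + t) s'
  | loop_done {x : ℕ} {p : RamProg} {s : RamState} :
      s.reg x = 0 → RamExec (.loop x p) s (bitCost (s.reg x)) s
  | loop_step {x : ℕ} {p : RamProg} {s s' s'' : RamState} {t t' : ℕ} :
      s.reg x ≠ 0 → RamExec p s t s' → RamExec (.loop x p) s' t' s'' →
      RamExec (.loop x p) s (bitCost (s.reg x) + t + t') s''

/-- Initial state on input `w`: the entries of `w` are in memory cells `0, 1, …`; all registers and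
all other cells are zero. -/
def RamState.init (w : List ℕ) : RamState where
  reg := fun _ => 0
  mem := fun i => w.getD i 0

/-- The size of an input: the total bit length of its entries. -/
def inputSize (w : List ℕ) : ℕ := (w.map bitCost).sum

/-! ## Parameterized problems and `O*` running times -/

/-- A parameterized decision problem, given by its instances (those objects of type `Inst` that
satisfy `valid`), the yes-instances, the parameter, and the encoding of the instances. -/
structure ParamProblem where
  Inst : Type
  valid : Inst → Prop
  yes : Inst → Prop
  param : Inst → ℕ
  encode : Inst → List ℕ

/-- There is an algorithm that decides the problem `Q` in time `O*(f(k))`, `k` the parameter: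
one RAM program that on every instance halts within time `f(k)` times a polynomial in the input
size, with register `0` holding `1` on yes-instances and `0` on no-instances. -/
def ParamProblem.SolvableInOStar (Q : ParamProblem) (f : ℕ → ℝ) : Prop :=
  ∃ (P : RamProg) (p : Polynomial ℕ), ∀ I : Q.Inst, Q.valid I →
    ∃ (t : ℕ) (s : RamState), RamExec P (RamState.init (Q.encode I)) t s ∧
      (t : ℝ) ≤ f (Q.param I) * (p.eval (inputSize (Q.encode I)) : ℕ) ∧
      (Q.yes I → s.reg 0 = 1) ∧ (¬ Q.yes I → s.reg 0 = 0)

/-! ## Connected Vertex Cover with a modulator -/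

/-- A split graph: the vertex set can be partitioned into a clique and an independent set. -/
def SimpleGraph.IsSplitGraph {V : Type*} (G : SimpleGraph V) : Prop :=
  ∃ C : Set V, G.IsClique C ∧ G.IsIndepSet Cᶜ

/-- Deleting `S` results in a split graph. -/
def SimpleGraph.IsSplitDeletionSet {V : Type*} (G : SimpleGraph V) (S : Set V) : Prop :=
  (G.induce Sᶜ).IsSplitGraph

/-- Deleting `S` results in a complete graph. -/
def SimpleGraph.IsCliqueDeletionSet {V : Type*} (G : SimpleGraph V) (S : Set V) : Prop :=
  (G.induce Sᶜ).IsClique Set.univ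

/-- A vertex cover that induces a connected subgraph. -/
def SimpleGraph.IsConnectedVertexCover {V : Type*} (G : SimpleGraph V) (X : Set V) : Prop :=
  G.IsVertexCover X ∧ (G.induce X).Connected

/-- A finite graph `G`, a set `S` of its vertices and a number `ℓ`. -/
structure CVCInstance where
  n : ℕ
  G : SimpleGraph (Fin n)
  S : Finset (Fin n)
  ℓ : ℕ

open Classical in
/-- The numbers `n` and `ℓ`, the indicator vector of `S`, the adjacency matrix of `G` row by row. -/
noncomputable def CVCInstance.encode (I : CVCInstance) : List ℕ :=
  [I.n, I.ℓ] ++ List.ofFn (fun v : Fin I.n => if v ∈ I.S then 1 else 0) ++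
    (List.ofFn fun u : Fin I.n =>
      List.ofFn fun v : Fin I.n => if I.G.Adj u v then 1 else 0).flatten

/-- `G` has a connected vertex cover of size at most `ℓ`. -/
def CVCInstance.HasSmallCVC (I : CVCInstance) : Prop :=
  ∃ X : Finset (Fin I.n), I.G.IsConnectedVertexCover (X : Set (Fin I.n)) ∧ X.card ≤ I.ℓ

/-- Connected Vertex Cover with a given split deletion set `S`, parameterized by `|S|`. -/
noncomputable def cvcSplitDeletion : ParamProblem where
  Inst := CVCInstance
  valid I := I.G.IsSplitDeletionSet (I.S : Set (Fin I.n)) ∧ 0 < I.ℓ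
  yes := CVCInstance.HasSmallCVC
  param I := I.S.card
  encode := CVCInstance.encode

/-- Connected Vertex Cover with a given clique deletion set `S`, parameterized by `|S|`. -/
noncomputable def cvcCliqueDeletion : ParamProblem where
  Inst := CVCInstance
  valid I := I.G.IsCliqueDeletionSet (I.S : Set (Fin I.n)) ∧ 0 < I.ℓ
  yes := CVCInstance.HasSmallCVC
  param I := I.S.card
  encode := CVCInstance.encode

/-! ## Set Cover -/

/-- A universe of `n` elements, a family of `m` subsets of it, and a number `ℓ`. -/
structure SetCoverInstance where
  n : ℕ
  m : ℕ
  F : Fin m → Finset (Fin n)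
  ℓ : ℕ

/-- The numbers `n`, `m`, `ℓ`, and the incidence matrix of the family, set by set. -/
def SetCoverInstance.encode (I : SetCoverInstance) : List ℕ :=
  [I.n, I.m, I.ℓ] ++
    (List.ofFn fun j : Fin I.m =>
      List.ofFn fun u : Fin I.n => if u ∈ I.F j then 1 else 0).flatten

/-- Some at most `ℓ` sets of the family cover the universe. -/
def SetCoverInstance.HasSmallCover (I : SetCoverInstance) : Prop :=
  ∃ J : Finset (Fin I.m), J.card ≤ I.ℓ ∧ J.biUnion I.F = Finset.univ

/-- Set Cover, parameterized by the size of the universe. -/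
def setCover : ParamProblem where
  Inst := SetCoverInstance
  valid I := 0 < I.ℓ
  yes := SetCoverInstance.HasSmallCover
  param I := I.n
  encode := SetCoverInstance.encode

/-- The Set Cover Conjecture: no `O*((2 - ε)^|U|)` time algorithm for Set Cover, for any `ε > 0`. -/
def SetCoverConjecture : Prop :=
  ∀ ε : ℝ, 0 < ε → ¬ setCover.SolvableInOStar (fun k => (2 - ε) ^ k)

/-!
All three parts are about one search, `SearchData`, that comes in a binary and a ternary version.

For a connected vertex cover `X` of a graph `G` with split deletion set `S`, a few guesses
determine a large part of `X`. In the split graph `G - S`, at most one vertex `v` of the clique is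
missing from `X`. Guess `v` and `X ∩ S`: the *excluded* vertices, `v` and `S \ X`, force their
neighbours into `X`, and all other vertices of `S` and of the clique belong to `X`. This *core*
`Y ⊆ X` is already a vertex cover, and what `X` contains beyond `Y` are vertices `w` of the
independent side that make the core connected. All vertices of the clique in the core are
connected to each other, so that only the vertices of `Y ∩ S` need to be kept track of: each is
marked as soon as an added vertex `w` makes it connected to a fixed root. So a vertex of `S` is
outside the cover, or inside and unmarked, or inside and marked: three values of a digit. The
numbers with one such digit per vertex of `S`, and four more entries smaller than `n` (the number
of added vertices, the root, `v`, and the partition of `G - S`), are the states of the search.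
Adding a vertex raises a state, so that a single pass through all states in increasing order finds
those that can be reached. If `S` is a clique deletion set, there is no independent side, hence
nothing to add or to mark: two values per digit suffice.

The split partition is not given. It is guessed as a degree threshold: by
`SearchData.exists_threshold`, the vertices of a split graph whose degree reaches a suitable
number form a clique, and the others are independent. That a final state yields a connected vertex
cover is `SearchData.exists_cover_of_final`, and that such a cover yields a final state is
`SearchData.exists_final`, where the cover may be assumed to miss some vertex, the reason being
that a connected graph has a vertex that is not a cut vertex (`CVCInstance.exists_proper_cover`).

To run this on a random access machine within a polynomial bound for each state, `Evaluable`
describes the functions of a machine state that a program can compute in polynomial time without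
disturbing registers and memory. They are closed under arithmetic, memory access, and iterations,
sums, products and quantifiers of polynomial length, so that all predicates of the search are seen
to be decidable by spelling out their definitions. `exists_loop` turns an evaluable assignment to
a memory cell into a loop with an invariant, and `exists_search_program` is the search.

For the lower bound, an instance of Set Cover with universe `U` is turned into the incidence graph
with a root joined to all sets and a leaf attached to each element and to the root
(`SetCoverInstance.reduced`). The leaves force `U` and the root into each connected vertex cover,
and the sets in it then have to cover `U`, as they alone connect the elements to the root.
Deleting `U` leaves a star with isolated vertices, which is a split graph. The reduced instance is
computed in place by a program built with the same tools
(`SetCoverInstance.exists_reduction_program`).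
-/

/-! ### Polynomial bounds -/

theorem Polynomial.eval_le_eval_of_le_nat (p : Polynomial ℕ) {a b : ℕ} (h : a ≤ b) :
    p.eval a ≤ p.eval b := by
  rw [Polynomial.eval_eq_sum, Polynomial.eval_eq_sum]
  exact Finset.sum_le_sum fun i _ => Nat.mul_le_mul_left _ (Nat.pow_le_pow_left h _)

theorem bitCost_le {v B : ℕ} (h : v < 2 ^ B) : bitCost v ≤ B + 1 :=
  Nat.succ_le_succ (Nat.size_le.2 h)

theorem RamOp.eval_lt (o : RamOp) {x y a b : ℕ} (hx : x < 2 ^ a) (hy : y < 2 ^ b) :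
    o.eval x y < 2 ^ (a + b + 1) := by
  have h1 : (1 : ℕ) ≤ 2 ^ a := Nat.one_le_two_pow
  have h2 : (1 : ℕ) ≤ 2 ^ b := Nat.one_le_two_pow
  have h3 : 2 ^ (a + b + 1) = 2 * (2 ^ a * 2 ^ b) := by ring
  rw [h3]
  have h4 : 2 ^ a ≤ 2 ^ a * 2 ^ b := Nat.le_mul_of_pos_right _ h2
  have h5 : 2 ^ b ≤ 2 ^ a * 2 ^ b := Nat.le_mul_of_pos_left _ h1
  cases o with
  | add => simp only [RamOp.eval]; omega
  | sub => simp only [RamOp.eval]; omega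
  | mul =>
    simp only [RamOp.eval]
    have : x * y ≤ 2 ^ a * 2 ^ b := Nat.mul_le_mul hx.le hy.le
    omega
  | div =>
    simp only [RamOp.eval]
    have : x / y ≤ x := Nat.div_le_self _ _
    omega

/-! ### Expressions that a random access machine evaluates in polynomial time -/

/-- Registers `0, …, d` and all memory cells hold numbers of at most `B` bits; moreover register
`0`, which serves as the common bound of all inner loops, holds a number of value at most `B`. -/
structure RamState.Bounded (d B : ℕ) (s : RamState) : Prop where
  bound : s.reg 0 ≤ B
  reg : ∀ i ≤ d, s.reg i < 2 ^ B
  mem : ∀ a, s.mem a < 2 ^ B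

/-- The states have the same memory and the same registers `0, …, d`. -/
structure RamState.Agree (d : ℕ) (s s' : RamState) : Prop where
  reg : ∀ i ≤ d, s.reg i = s'.reg i
  mem : s.mem = s'.mem

theorem RamState.Agree.trans {d : ℕ} {s s' s'' : RamState} (h : s.Agree d s')
    (h' : s'.Agree d s'') : s.Agree d s'' :=
  ⟨fun i hi => (h.reg i hi).trans (h'.reg i hi), h.mem.trans h'.mem⟩

theorem RamState.Agree.mono {d d' : ℕ} {s s' : RamState} (h : s.Agree d' s') (hd : d ≤ d') :
    s.Agree d s' :=
  ⟨fun i hi => h.reg i (hi.trans hd), h.mem⟩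

theorem RamState.agree_setReg {d x : ℕ} (s : RamState) (v : ℕ) (h : d < x) :
    (s.setReg x v).Agree d s :=
  ⟨fun i hi => Function.update_of_ne (by omega) _ _, rfl⟩

@[simp]
theorem RamState.setReg_reg (s : RamState) (x v i : ℕ) :
    (s.setReg x v).reg i = if i = x then v else s.reg i := by
  simp [RamState.setReg, Function.update_apply]

@[simp]
theorem RamState.setReg_mem (s : RamState) (x v : ℕ) : (s.setReg x v).mem = s.mem := rfl

theorem RamState.Bounded.mono {d d' B B' : ℕ} {s : RamState} (h : s.Bounded d' B') (hd : d ≤ d')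
    (hB : B' ≤ B) : s.Bounded d B :=
  ⟨h.bound.trans hB, fun i hi => (h.reg i (hi.trans hd)).trans_le (Nat.pow_le_pow_right two_pos hB),
    fun a => (h.mem a).trans_le (Nat.pow_le_pow_right two_pos hB)⟩

theorem RamState.Bounded.of_agree {d B : ℕ} {s s' : RamState} (h : s.Bounded d B)
    (ha : s'.Agree d s) : s'.Bounded d B :=
  ⟨(ha.reg 0 (Nat.zero_le _)).trans_le h.bound, fun i hi => (ha.reg i hi).trans_lt (h.reg i hi),
    fun a => by rw [ha.mem]; exact h.mem a⟩

theorem RamState.Bounded.succ {d B : ℕ} {s : RamState} (h : s.Bounded d B)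
    (h' : s.reg (d + 1) < 2 ^ B) : s.Bounded (d + 1) B :=
  ⟨h.bound, fun i hi => (Nat.le_succ_iff.1 hi).elim (h.reg i) (fun e => e ▸ h'), h.mem⟩

/-- The function `f` of the registers `0, …, d` and the memory can be evaluated in polynomial time:
for every `d' ≥ d` some program puts the value in register `d' + 1`, where registers `0, …, d'`
and the memory are preserved, in time polynomial in a bound `B` on the state. -/
structure Evaluable (d : ℕ) (f : RamState → ℕ) : Prop where
  congr : ∀ s s' : RamState, s.Agree d s' → f s = f s'
  bound : ∃ p : Polynomial ℕ, ∀ s B, s.Bounded d B → f s < 2 ^ p.eval B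
  exec : ∀ d', d ≤ d' → ∃ (P : RamProg) (p : Polynomial ℕ), ∀ s B, s.Bounded d' B →
    ∃ t s', RamExec P s t s' ∧ t ≤ p.eval B ∧ s'.reg (d' + 1) = f s ∧ s'.Agree d' s

namespace Evaluable

theorem mono {d d' : ℕ} {f : RamState → ℕ} (hf : Evaluable d f) (h : d ≤ d') : Evaluable d' f where
  congr s s' hs := hf.congr s s' (hs.mono h)
  bound := hf.bound.imp fun _ hp s B hs => hp s B (hs.mono h le_rfl)
  exec d'' h' := hf.exec d'' (h.trans h')

theorem const (d c : ℕ) : Evaluable d fun _ => c where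
  congr _ _ _ := rfl
  bound := ⟨Polynomial.C c, fun s B _ => by simpa using Nat.lt_two_pow_self⟩
  exec d' _ := ⟨.const (d' + 1) c, Polynomial.C (bitCost c), fun s B _ =>
    ⟨_, _, .const _ _ _, by simp, by simp, s.agree_setReg _ (Nat.lt_succ_self _)⟩⟩

theorem reg {d i : ℕ} (hi : i ≤ d) : Evaluable d fun s => s.reg i where
  congr _ _ h := h.reg i hi
  bound := ⟨.X, fun s B h => by simpa using h.reg i hi⟩
  exec d' hd := by
    refine ⟨.seq (.const (d' + 1) 1) (.arith .div (d' + 1) i (d' + 1)),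
      Polynomial.C 10 + Polynomial.C 2 * .X, fun s B hs =>
      ⟨_, _, .seq (.const _ _ _) (.arith _ _ _ _ _), ?_, ?_, ?_⟩⟩
    · have h1 : i ≠ d' + 1 := by omega
      have := bitCost_le (hs.reg i (hi.trans hd))
      simp [RamOp.eval, h1, show bitCost 1 = 2 from rfl]
      omega
    · have h1 : i ≠ d' + 1 := by omega
      simp [RamOp.eval, h1]
    · exact (RamState.agree_setReg _ _ (Nat.lt_succ_self _)).trans
        (s.agree_setReg _ (Nat.lt_succ_self _))

theorem mem {d : ℕ} {f : RamState → ℕ} (hf : Evaluable d f) : Evaluable d fun s => s.mem (f s) where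
  congr s s' h := by rw [hf.congr s s' h, h.mem]
  bound := ⟨.X, fun s B h => by simpa using h.mem _⟩
  exec d' hd := by
    obtain ⟨P, p, hP⟩ := hf.exec d' hd
    obtain ⟨p', hp'⟩ := hf.bound
    refine ⟨.seq P (.load (d' + 1) (d' + 1)), p + (p' + Polynomial.C 1 + (.X + Polynomial.C 1)),
      fun s B hs => ?_⟩
    obtain ⟨t, s', he, ht, hv, ha⟩ := hP s B hs
    refine ⟨_, _, .seq he (.load _ _ _), ?_, ?_, ?_⟩
    · rw [hv, ha.mem]
      have h1 := bitCost_le (hp' s B (hs.mono hd le_rfl))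
      have h2 := bitCost_le (hs.mem (f s))
      simp
      omega
    · simp [hv, ha.mem]
    · exact (RamState.agree_setReg _ _ (Nat.lt_succ_self _)).trans ha

theorem arith (o : RamOp) {d : ℕ} {f g : RamState → ℕ} (hf : Evaluable d f) (hg : Evaluable d g) :
    Evaluable d fun s => o.eval (f s) (g s) where
  congr s s' h := by rw [hf.congr s s' h, hg.congr s s' h]
  bound := by
    obtain ⟨p, hp⟩ := hf.bound
    obtain ⟨q, hq⟩ := hg.bound
    exact ⟨p + q + Polynomial.C 1, fun s B h => by
      simpa using o.eval_lt (hp s B h) (hq s B h)⟩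
  exec d' hd := by
    obtain ⟨p, hp⟩ := hf.bound
    obtain ⟨q, hq⟩ := hg.bound
    obtain ⟨P, a, hP⟩ := hf.exec d' hd
    obtain ⟨Q, b, hQ⟩ := hg.exec (d' + 1) (by omega)
    refine ⟨.seq P (.seq Q (.arith o (d' + 1) (d' + 1) (d' + 2))),
      a + (b.comp (.X + p) + (p + q + (p + q) + Polynomial.C 4)), fun s B hs => ?_⟩
    obtain ⟨t, s', he, ht, hv, ha⟩ := hP s B hs
    have hfs := hp s B (hs.mono hd le_rfl)
    have hgs := hq s B (hs.mono hd le_rfl)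
    have hb : s'.Bounded (d' + 1) (B + p.eval B) := by
      refine ((hs.of_agree ha).mono le_rfl (Nat.le_add_right _ _)).succ ?_
      rw [hv]
      exact hfs.trans_le (Nat.pow_le_pow_right two_pos (Nat.le_add_left _ _))
    obtain ⟨t2, s2, he2, ht2, hv2, ha2⟩ := hQ s' _ hb
    have hv2' : s2.reg (d' + 2) = g s := hv2.trans (hg.congr _ _ (ha.mono hd))
    have hv1' : s2.reg (d' + 1) = f s := (ha2.reg _ le_rfl).trans hv
    refine ⟨_, _, .seq he (.seq he2 (.arith _ _ _ _ _)), ?_, ?_, ?_⟩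
    · rw [hv1', hv2']
      have h1 := bitCost_le hfs
      have h2 := bitCost_le hgs
      have h3 := bitCost_le (o.eval_lt hfs hgs)
      simp only [Polynomial.eval_add, Polynomial.eval_comp, Polynomial.eval_X, Polynomial.eval_C]
      omega
    · simp [hv1', hv2']
    · exact (RamState.agree_setReg _ _ (Nat.lt_succ_self _)).trans
        ((ha2.mono (Nat.le_succ _)).trans ha)

variable {d : ℕ} {f g : RamState → ℕ}

theorem add (hf : Evaluable d f) (hg : Evaluable d g) : Evaluable d fun s => f s + g s :=
  arith .add hf hg

theorem sub (hf : Evaluable d f) (hg : Evaluable d g) : Evaluable d fun s => f s - g s :=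
  arith .sub hf hg

theorem mul (hf : Evaluable d f) (hg : Evaluable d g) : Evaluable d fun s => f s * g s :=
  arith .mul hf hg

theorem div (hf : Evaluable d f) (hg : Evaluable d g) : Evaluable d fun s => f s / g s :=
  arith .div hf hg

theorem mod (hf : Evaluable d f) (hg : Evaluable d g) : Evaluable d fun s => f s % g s := by
  have := hf.sub (hg.mul (hf.div hg))
  refine (funext fun s => ?_ : _ = fun s => f s % g s) ▸ this
  have := Nat.div_add_mod (f s) (g s)
  omega

/-- The value after `i` rounds of the iteration `x ↦ g i x` started at `a`. -/
def iterate (a : ℕ) (g : ℕ → ℕ → ℕ) : ℕ → ℕ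
  | 0 => a
  | i + 1 => g i (iterate a g i)

/-- A function of the state and of a further number is evaluable if it yields an evaluable
expression whenever an evaluable expression is substituted for the number. -/
def Fun (d : ℕ) (f : RamState → ℕ → ℕ) : Prop :=
  ∀ d', d ≤ d' → ∀ u, Evaluable d' u → Evaluable d' fun s => f s (u s)

/-- A function of the state and two further numbers is evaluable. -/
def Fun₂ (d : ℕ) (f : RamState → ℕ → ℕ → ℕ) : Prop :=
  ∀ d', d ≤ d' → ∀ u v, Evaluable d' u → Evaluable d' v → Evaluable d' fun s => f s (u s) (v s)

/-- Iterating an evaluable step `reg 0` times is evaluable if the intermediate values have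
polynomially many bits. -/
theorem iter {g : RamState → ℕ → ℕ → ℕ} (hf : Evaluable d f) (hg : Fun₂ d g)
    (hb : ∃ p : Polynomial ℕ, ∀ s B, s.Bounded d B → ∀ i ≤ s.reg 0,
      iterate (f s) (g s) i < 2 ^ p.eval B) :
    Evaluable d fun s => iterate (f s) (g s) (s.reg 0) := by
  obtain ⟨p, hp⟩ := hb
  have hgc : ∀ s s' : RamState, s.Agree d s' → ∀ i a, g s i a = g s' i a := fun s s' h i a =>
    (hg d le_rfl _ _ (const d i) (const d a)).congr s s' h
  refine ⟨fun s s' h => ?_, ⟨p, fun s B h => hp s B h _ le_rfl⟩, fun d' hd => ?_⟩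
  · have : g s = g s' := funext₂ (hgc s s' h)
    rw [hf.congr s s' h, this, h.reg 0 (Nat.zero_le _)]
  obtain ⟨P, a, hP⟩ := hf.exec (d' + 1) (by omega)
  obtain ⟨Q, b, hQ⟩ := (hg (d' + 3) (by omega) _ _ (reg (i := d' + 1) (by omega))
    (reg (i := d' + 2) (by omega))).exec (d' + 3) le_rfl
  set body : RamProg := .seq Q (.seq (.const (d' + 5) 1) (.seq (.arith .div (d' + 2) (d' + 4) (d' + 5))
    (.seq (.arith .add (d' + 1) (d' + 1) (d' + 5)) (.arith .sub (d' + 3) (d' + 3) (d' + 5)))))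
    with hbody
  -- `r` bounds the number of bits of everything that the loop handles
  set r : Polynomial ℕ := .X + p + Polynomial.C 1 with hr
  set c : Polynomial ℕ := b.comp r + (Polynomial.C 30 + Polynomial.C 12 * r) with hc
  have loop : ∀ s₀ B, s₀.Bounded d' B → ∀ k i (s : RamState), i + k = s₀.reg 0 →
      s.reg (d' + 1) = i → s.reg (d' + 2) = iterate (f s₀) (g s₀) i → s.reg (d' + 3) = k →
      s.Agree d' s₀ → ∃ t s', RamExec (.loop (d' + 3) body) s t s' ∧ t ≤ (k + 1) * c.eval B ∧
        s'.reg (d' + 2) = iterate (f s₀) (g s₀) (s₀.reg 0) ∧ s'.Agree d' s₀ := by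
    intro s₀ B hB k
    have hB1 := hB.bound
    have hcB : c.eval B = b.eval (r.eval B) + (30 + 12 * r.eval B) := by simp [hc]
    have hrB : r.eval B = B + p.eval B + 1 := by simp [hr]
    have small : ∀ x, x ≤ B + 1 → x < 2 ^ r.eval B := fun x hx => by
      rw [hrB]
      exact hx.trans_lt ((Nat.lt_two_pow_self (n := B + 1)).trans_le
        (Nat.pow_le_pow_right two_pos (by omega)))
    have hacc : ∀ i ≤ s₀.reg 0, iterate (f s₀) (g s₀) i < 2 ^ r.eval B := fun i hi =>
      (hp s₀ B (hB.mono hd le_rfl) i hi).trans_le (Nat.pow_le_pow_right two_pos (by omega))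
    induction k with
    | zero =>
      intro i s hik h1 h2 h3 hs
      refine ⟨_, s, .loop_done h3, ?_, by rw [h2, ← hik]; simp, hs⟩
      rw [h3, hcB]
      have := bitCost_le (small 0 (by omega))
      omega
    | succ k ih =>
      intro i s hik h1 h2 h3 hs
      have hbd : s.Bounded (d' + 3) (r.eval B) := by
        refine (((((hB.of_agree hs).mono le_rfl (by omega)).succ ?_).succ ?_).succ ?_)
        · rw [h1]; exact small _ (by omega)
        · rw [h2]; exact hacc _ (by omega)
        · rw [h3]; exact small _ (by omega)
      obtain ⟨t, s1, he, ht, hv, ha⟩ := hQ s _ hbd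
      have hv' : s1.reg (d' + 4) = iterate (f s₀) (g s₀) (i + 1) := by
        rw [show d' + 4 = d' + 3 + 1 from rfl, hv, h1, h2]
        exact hgc _ _ (hs.mono hd) _ _
      have e1 : s1.reg (d' + 1) = i := (ha.reg _ (by omega)).trans h1
      have e3 : s1.reg (d' + 3) = k + 1 := (ha.reg _ (by omega)).trans h3
      obtain ⟨t', s', he', ht', hv'', ha'⟩ := ih (i + 1)
        (((((s1.setReg (d' + 5) 1).setReg (d' + 2) (s1.reg (d' + 4) / 1)).setReg (d' + 1)
          (i + 1))).setReg (d' + 3) (k + 1 - 1)) (by omega) (by simp) (by simp [hv']) (by simp)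
        (((((RamState.agree_setReg _ _ (by omega)).trans
          (RamState.agree_setReg _ _ (by omega))).trans (RamState.agree_setReg _ _ (by omega))).trans
          (RamState.agree_setReg _ _ (by omega))).trans ((ha.mono (by omega)).trans hs))
      have key : RamExec body s (t + (bitCost 1 + ((bitCost (s1.reg (d' + 4)) + bitCost 1 +
          bitCost (s1.reg (d' + 4) / 1)) + ((bitCost i + bitCost 1 + bitCost (i + 1)) +
          (bitCost (k + 1) + bitCost 1 + bitCost (k + 1 - 1))))))
          (((((s1.setReg (d' + 5) 1).setReg (d' + 2) (s1.reg (d' + 4) / 1)).setReg (d' + 1)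
          (i + 1))).setReg (d' + 3) (k + 1 - 1)) := by
        have x1 := RamExec.arith .div (d' + 2) (d' + 4) (d' + 5) (s1.setReg (d' + 5) 1)
        have x2 := RamExec.arith .add (d' + 1) (d' + 1) (d' + 5)
          ((s1.setReg (d' + 5) 1).setReg (d' + 2) (s1.reg (d' + 4) / 1))
        have x3 := RamExec.arith .sub (d' + 3) (d' + 3) (d' + 5)
          (((s1.setReg (d' + 5) 1).setReg (d' + 2) (s1.reg (d' + 4) / 1)).setReg (d' + 1) (i + 1))
        simp [RamOp.eval, e1, e3] at x1 x2 x3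
        simp only [Nat.div_one, Nat.add_sub_cancel] at x1 x2 x3 ⊢
        exact .seq he (.seq (.const _ _ _) (.seq x1 (.seq x2 x3)))
      refine ⟨_, s', .loop_step (by omega) key he', ?_, hv'', ha'⟩
      rw [h3, hv', Nat.div_one]
      have b1 := bitCost_le (small 1 (by omega))
      have b2 := bitCost_le (hacc (i + 1) (by omega))
      have b3 := bitCost_le (small i (by omega))
      have b4 := bitCost_le (small (i + 1) (by omega))
      have b5 := bitCost_le (small (k + 1) (by omega))
      have b6 := bitCost_le (small (k + 1 - 1) (by omega))
      have : (k + 1 + 1) * c.eval B = (k + 1) * c.eval B + c.eval B := by ring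
      omega
  refine ⟨.seq (.const (d' + 1) 0) (.seq P (.seq (.arith .add (d' + 3) 0 (d' + 1))
    (.seq (.loop (d' + 3) body) (.seq (.const (d' + 5) 1)
      (.arith .div (d' + 1) (d' + 2) (d' + 5)))))),
    Polynomial.C 1 + a + (Polynomial.C 2 * .X + Polynomial.C 3) + (.X + Polynomial.C 1) * c +
      (Polynomial.C 10 + Polynomial.C 2 * p), fun s B hs => ?_⟩
  have hB1 := hs.bound
  have hBB : B < 2 ^ B := Nat.lt_two_pow_self
  obtain ⟨t, s1, he, ht, hv, ha⟩ := hP (s.setReg (d' + 1) 0) B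
    ((hs.of_agree (RamState.agree_setReg _ _ (by omega))).succ (by simp))
  have ha0 : s1.Agree d' s := (ha.mono (by omega)).trans (RamState.agree_setReg _ _ (by omega))
  have e0 : s1.reg 0 = s.reg 0 := ha0.reg 0 (by omega)
  have e1 : s1.reg (d' + 1) = 0 := by simpa using ha.reg (d' + 1) le_rfl
  have e2 : s1.reg (d' + 2) = f s := hv.trans
    (hf.congr _ _ ((RamState.agree_setReg _ _ (by omega))))
  obtain ⟨t', s2, he', ht', hv', ha'⟩ := loop s B hs (s.reg 0) 0 (s1.setReg (d' + 3) (s.reg 0))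
    (by omega) (by simpa using e1) (by simpa [iterate] using e2) (by simp)
    ((RamState.agree_setReg _ _ (by omega)).trans ha0)
  have hx := RamExec.arith .add (d' + 3) 0 (d' + 1) s1
  rw [e0, e1, show RamOp.add.eval (s.reg 0) 0 = s.reg 0 from rfl] at hx
  refine ⟨_, _, .seq (.const _ _ _) (.seq he (.seq hx (.seq he' (.seq (.const _ _ _)
    (.arith _ _ _ _ _))))), ?_, ?_, ?_⟩
  · have b1 := bitCost_le (hB1.trans_lt hBB)
    have b2 := bitCost_le (hp s B (hs.mono hd le_rfl) _ le_rfl)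
    have h1 : (s.reg 0 + 1) * c.eval B ≤ (B + 1) * c.eval B := by gcongr
    simp [RamOp.eval, hv', show bitCost 1 = 2 from rfl, show bitCost 0 = 1 from rfl]
    omega
  · simp [RamOp.eval, hv']
  · exact (RamState.agree_setReg _ _ (by omega)).trans
      ((RamState.agree_setReg _ _ (by omega)).trans ha')

theorem Fun.congr {f : RamState → ℕ → ℕ} (hf : Fun d f) {s s' : RamState} (h : s.Agree d s')
    (i : ℕ) : f s i = f s' i :=
  (hf d le_rfl _ (const d i)).congr s s' h

theorem Fun.bound {f : RamState → ℕ → ℕ} (hf : Fun d f) :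
    ∃ p : Polynomial ℕ, ∀ s B, s.Bounded d B → ∀ i < 2 ^ B, f s i < 2 ^ p.eval B := by
  obtain ⟨p, hp⟩ := (hf (d + 1) (Nat.le_succ d) _ (reg (i := d + 1) le_rfl)).bound
  refine ⟨p, fun s B hs i hi => ?_⟩
  have h := RamState.agree_setReg s i (Nat.lt_succ_self d)
  have := hp (s.setReg (d + 1) i) B ((hs.of_agree h).succ (by simpa using hi))
  simpa [hf.congr h] using this

theorem sum {f : RamState → ℕ → ℕ} (hf : Fun d f) :
    Evaluable d fun s => ∑ i ∈ Finset.range (s.reg 0), f s i := by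
  have key : ∀ s k, iterate 0 (fun i a => a + f s i) k = ∑ i ∈ Finset.range k, f s i := by
    intro s k
    induction k with
    | zero => rfl
    | succ k ih => rw [iterate, ih, Finset.sum_range_succ]
  have h := iter (const d 0) (g := fun s i a => a + f s i)
    (fun d' hd u v hu hv => hv.add (hf d' hd u hu)) (by
      obtain ⟨p, hp⟩ := hf.bound
      refine ⟨.X + p, fun s B hs i hi => ?_⟩
      have hB := hs.bound
      rw [key]
      calc ∑ j ∈ Finset.range i, f s j ≤ ∑ j ∈ Finset.range i, 2 ^ p.eval B :=
            Finset.sum_le_sum fun j hj => (hp s B hs j (by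
              have := Finset.mem_range.1 hj
              exact lt_of_le_of_lt (by omega) (Nat.lt_two_pow_self (n := B)))).le
        _ = i * 2 ^ p.eval B := by simp
        _ < 2 ^ B * 2 ^ p.eval B := by
            refine Nat.mul_lt_mul_of_pos_right ?_ (by positivity)
            exact lt_of_le_of_lt (by omega) (Nat.lt_two_pow_self (n := B))
        _ = _ := by simp [pow_add])
  simpa only [key] using h

theorem prod {f : RamState → ℕ → ℕ} (hf : Fun d f) :
    Evaluable d fun s => ∏ i ∈ Finset.range (s.reg 0), f s i := by
  have key : ∀ s k, iterate 1 (fun i a => a * f s i) k = ∏ i ∈ Finset.range k, f s i := by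
    intro s k
    induction k with
    | zero => rfl
    | succ k ih => rw [iterate, ih, Finset.prod_range_succ]
  have h := iter (const d 1) (g := fun s i a => a * f s i)
    (fun d' hd u v hu hv => hv.mul (hf d' hd u hu)) (by
      obtain ⟨p, hp⟩ := hf.bound
      refine ⟨p * .X + Polynomial.C 1, fun s B hs i hi => ?_⟩
      have hB := hs.bound
      rw [key]
      calc ∏ j ∈ Finset.range i, f s j ≤ ∏ j ∈ Finset.range i, 2 ^ p.eval B :=
            Finset.prod_le_prod' fun j hj => (hp s B hs j (by
              have := Finset.mem_range.1 hj
              exact lt_of_le_of_lt (by omega) (Nat.lt_two_pow_self (n := B)))).le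
        _ = 2 ^ (p.eval B * i) := by simp [pow_mul]
        _ ≤ 2 ^ (p.eval B * B) := Nat.pow_le_pow_right two_pos (Nat.mul_le_mul_left _ (hi.trans hB))
        _ < _ := Nat.pow_lt_pow_right one_lt_two (by simp))
  simpa only [key] using h

end Evaluable

open Classical in
/-- The truth value of a proposition as a number, `1` for true and `0` for false. -/
noncomputable def truth (p : Prop) : ℕ := if p then 1 else 0

theorem truth_le_one (p : Prop) : truth p ≤ 1 := by unfold truth; split_ifs <;> simp

@[simp] theorem truth_eq_one {p : Prop} : truth p = 1 ↔ p := by simp [truth]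

@[simp] theorem truth_eq_zero {p : Prop} : truth p = 0 ↔ ¬p := by simp [truth]

/-- The predicate `p` of the registers `0, …, d` and the memory is decidable in polynomial time. -/
def Checkable (d : ℕ) (p : RamState → Prop) : Prop := Evaluable d fun s => truth (p s)

namespace Checkable

variable {d : ℕ} {p q : RamState → Prop} {f g : RamState → ℕ}

theorem not (hp : Checkable d p) : Checkable d fun s => ¬p s := by
  have : (fun s => truth (¬p s)) = fun s => 1 - truth (p s) := funext fun s => by
    by_cases h : p s <;> simp [truth, h]
  unfold Checkable
  rw [this]
  exact (Evaluable.const d 1).sub hp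

theorem and (hp : Checkable d p) (hq : Checkable d q) : Checkable d fun s => p s ∧ q s := by
  have : (fun s => truth (p s ∧ q s)) = fun s => truth (p s) * truth (q s) := funext fun s => by
    by_cases h : p s <;> by_cases h' : q s <;> simp [truth, h, h']
  unfold Checkable
  rw [this]
  exact Evaluable.mul hp hq

theorem or (hp : Checkable d p) (hq : Checkable d q) : Checkable d fun s => p s ∨ q s := by
  simpa only [not_and_or, not_not] using (hp.not.and hq.not).not

theorem imp (hp : Checkable d p) (hq : Checkable d q) : Checkable d fun s => p s → q s := by
  simpa only [imp_iff_not_or] using hp.not.or hq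

theorem le (hf : Evaluable d f) (hg : Evaluable d g) : Checkable d fun s => f s ≤ g s := by
  have : (fun s => truth (f s ≤ g s)) = fun s => 1 - (f s - g s) := funext fun s => by
    by_cases h : f s ≤ g s
    · simp [truth, h]
    · simp only [truth, h, if_false]
      omega
  unfold Checkable
  rw [this]
  exact (Evaluable.const d 1).sub (hf.sub hg)

theorem lt (hf : Evaluable d f) (hg : Evaluable d g) : Checkable d fun s => f s < g s := by
  simpa only [not_le] using (le hg hf).not

theorem eq (hf : Evaluable d f) (hg : Evaluable d g) : Checkable d fun s => f s = g s := by
  simpa only [le_antisymm_iff] using (le hf hg).and (le hg hf)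

theorem ex {p : RamState → ℕ → Prop}
    (hp : ∀ d', d ≤ d' → ∀ u, Evaluable d' u → Checkable d' fun s => p s (u s)) :
    Checkable d fun s => ∃ x < s.reg 0, p s x := by
  have h : Evaluable d fun s => ∑ i ∈ Finset.range (s.reg 0), truth (p s i) := Evaluable.sum hp
  have := (Checkable.eq h (Evaluable.const d 0)).not
  simpa [Finset.sum_eq_zero_iff] using this

theorem all {p : RamState → ℕ → Prop}
    (hp : ∀ d', d ≤ d' → ∀ u, Evaluable d' u → Checkable d' fun s => p s (u s)) :
    Checkable d fun s => ∀ x < s.reg 0, p s x := by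
  simpa using (Checkable.ex (p := fun s x => ¬p s x) fun d' h u hu => (hp d' h u hu).not).not

theorem ite [∀ s, Decidable (p s)] (hp : Checkable d p) (hf : Evaluable d f)
    (hg : Evaluable d g) : Evaluable d fun s => if p s then f s else g s := by
  have : (fun s => if p s then f s else g s) =
      fun s => truth (p s) * f s + (1 - truth (p s)) * g s := funext fun s => by
    by_cases h : p s <;> simp [truth, h]
  rw [this]
  exact (Evaluable.mul hp hf).add (((Evaluable.const d 1).sub hp).mul hg)

end Checkable

/-! ### Loops that fill the memory -/

@[simp]
theorem RamState.setMem_reg (s : RamState) (a v : ℕ) : (s.setMem a v).reg = s.reg := rfl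

@[simp]
theorem RamState.setMem_mem (s : RamState) (a v : ℕ) :
    (s.setMem a v).mem = Function.update s.mem a v := rfl

/-- A counting loop whose body performs, for the loop variable `z` in register `1`, the simultaneous
assignment `mem (addr) := val`, `reg 2 := ans`. It is specified by an invariant relating `z`,
register `2` and the memory; the number of rounds is initially in register `3`. -/
theorem exists_loop {addr val ans : RamState → ℕ} (haddr : Evaluable 3 addr)
    (hval : Evaluable 3 val) (hans : Evaluable 3 ans) :
    ∃ (P : RamProg) (p : Polynomial ℕ), ∀ (Inv : ℕ → ℕ → (ℕ → ℕ) → Prop) (n M B : ℕ)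
      (s : RamState), s.reg 0 = n → s.reg 1 = 0 → s.reg 3 = M → Inv 0 (s.reg 2) s.mem →
      n ≤ B → M < 2 ^ B →
      (∀ z a m, z ≤ M → Inv z a m → a < 2 ^ B ∧ ∀ x, m x < 2 ^ B) →
      (∀ s : RamState, s.reg 0 = n → s.reg 1 < M → Inv (s.reg 1) (s.reg 2) s.mem →
        Inv (s.reg 1 + 1) (ans s) (Function.update s.mem (addr s) (val s))) →
      ∃ t s', RamExec P s t s' ∧ t ≤ (M + 1) * p.eval B ∧ s'.reg 0 = n ∧ s'.reg 1 = M ∧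
        Inv M (s'.reg 2) s'.mem := by
  obtain ⟨a, ha⟩ := haddr.bound
  obtain ⟨b, hb⟩ := hval.bound
  obtain ⟨c, hc⟩ := hans.bound
  obtain ⟨P1, p1, hP1⟩ := haddr.exec 3 le_rfl
  obtain ⟨P2, p2, hP2⟩ := hval.exec 4 (by omega)
  obtain ⟨P3, p3, hP3⟩ := hans.exec 5 (by omega)
  set body : RamProg := .seq P1 (.seq P2 (.seq P3 (.seq (.store 4 5) (.seq (.const 7 1)
    (.seq (.arith .div 2 6 7) (.seq (.arith .add 1 1 7) (.arith .sub 3 3 7))))))) with hbody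
  set r : Polynomial ℕ := .X + a + b + c + Polynomial.C 1 with hr
  set T : Polynomial ℕ := p1.comp r + p2.comp r + p3.comp r +
    (Polynomial.C 40 + Polynomial.C 20 * r) with hT
  refine ⟨.loop 3 body, T, fun Inv n M B s h0 h1 h3 hI hn hM hbd hstep => ?_⟩
  have hrB : r.eval B = B + a.eval B + b.eval B + c.eval B + 1 := by simp [hr]
  have hTB : T.eval B = p1.eval (r.eval B) + p2.eval (r.eval B) + p3.eval (r.eval B) +
      (40 + 20 * r.eval B) := by simp [hT]
  have lift : ∀ {x e : ℕ}, x < 2 ^ e → e ≤ r.eval B → x < 2 ^ r.eval B := fun h h' =>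
    h.trans_le (Nat.pow_le_pow_right two_pos h')
  have loop : ∀ k (s : RamState), s.reg 0 = n → s.reg 1 + k = M → s.reg 3 = k →
      Inv (s.reg 1) (s.reg 2) s.mem → ∃ t s', RamExec (.loop 3 body) s t s' ∧
        t ≤ (k + 1) * T.eval B ∧ s'.reg 0 = n ∧ s'.reg 1 = M ∧ Inv M (s'.reg 2) s'.mem := by
    intro k
    induction k with
    | zero =>
      intro s h0 h1 h3 hI
      have h1' : s.reg 1 = M := by simpa using h1
      refine ⟨_, s, .loop_done h3, ?_, h0, h1', h1' ▸ hI⟩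
      rw [h3, hTB, show bitCost 0 = 1 from rfl]
      omega
    | succ k ih =>
      intro s h0 h1 h3 hI
      obtain ⟨hb2, hbm⟩ := hbd _ _ _ (by omega) hI
      have hs : s.Bounded 3 B := by
        refine ⟨by omega, fun i hi => ?_, hbm⟩
        have : B < 2 ^ B := Nat.lt_two_pow_self
        interval_cases i <;> omega
      have hsr : s.Bounded 3 (r.eval B) := hs.mono le_rfl (by omega)
      have va := lift (ha s B hs) (by omega)
      have vb := lift (hb s B hs) (by omega)
      have vc := lift (hc s B hs) (by omega)
      obtain ⟨t1, s1, e1, c1, v1, g1⟩ := hP1 s _ hsr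
      obtain ⟨t2, s2, e2, c2, v2, g2⟩ := hP2 s1 _ ((hsr.of_agree g1).succ (by rw [v1]; exact va))
      have v2' := v2.trans (hval.congr _ _ g1)
      have g2' : s2.Agree 3 s := (g2.mono (by omega)).trans g1
      obtain ⟨t3, s3, e3, c3, v3, g3⟩ := hP3 s2 _
        ((((hsr.of_agree g1).succ (by rw [v1]; exact va)).of_agree g2).succ
          (by rw [v2']; exact vb))
      have g3' : s3.Agree 3 s := (g3.mono (by omega)).trans g2'
      have w6 : s3.reg 6 = ans s := v3.trans (hans.congr _ _ g2')
      have w5 : s3.reg 5 = val s := (g3.reg 5 le_rfl).trans v2'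
      have w4 : s3.reg 4 = addr s := ((g3.reg 4 (by omega)).trans (g2.reg 4 le_rfl)).trans v1
      have w3 : s3.reg 3 = k + 1 := (g3'.reg 3 le_rfl).trans h3
      have w1 : s3.reg 1 = s.reg 1 := g3'.reg 1 (by omega)
      have x0 := RamExec.store 4 5 s3
      rw [w4, w5] at x0
      have x1 := RamExec.const 7 1 (s3.setMem (addr s) (val s))
      have x2 := RamExec.arith .div 2 6 7 ((s3.setMem (addr s) (val s)).setReg 7 1)
      have x3 := RamExec.arith .add 1 1 7
        (((s3.setMem (addr s) (val s)).setReg 7 1).setReg 2 (ans s))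
      have x4 := RamExec.arith .sub 3 3 7
        ((((s3.setMem (addr s) (val s)).setReg 7 1).setReg 2 (ans s)).setReg 1 (s.reg 1 + 1))
      simp [RamOp.eval, w6, w3, w1] at x2 x3 x4
      obtain ⟨t', s', e', c', r0, r1, rI⟩ := ih
        (((((s3.setMem (addr s) (val s)).setReg 7 1).setReg 2 (ans s)).setReg 1
          (s.reg 1 + 1)).setReg 3 k)
        (by simpa using (g3'.reg 0 (by omega)).trans h0) (by simp; omega) (by simp)
        (by
          have := hstep s h0 (by omega) hI
          rw [← g3'.mem] at this
          simpa using this)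
      refine ⟨_, s', .loop_step (by omega)
        (.seq e1 (.seq e2 (.seq e3 (.seq x0 (.seq x1 (.seq x2 (.seq x3 x4))))))) e', ?_, r0, r1, rI⟩
      have hBB : B < 2 ^ B := Nat.lt_two_pow_self
      have b1 := bitCost_le va
      have b2 := bitCost_le vb
      have b3 := bitCost_le vc
      have b4 := bitCost_le (hsr.reg 1 (by omega))
      have b5 := bitCost_le (lift (e := B) (x := s.reg 1 + 1) (by omega) (by omega))
      have b6 := bitCost_le (hsr.reg 3 (by omega))
      have b7 := bitCost_le (lift (e := B) (x := k) (by omega) (by omega))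
      rw [h3] at b6 ⊢
      have : (k + 1 + 1) * T.eval B = (k + 1) * T.eval B + T.eval B := by ring
      rw [show bitCost 1 = 2 from rfl]
      omega
  have := loop M s h0 (by omega) h3 (h1 ▸ hI)
  exact this

/-- A program leaves all but finitely many registers untouched. -/
theorem RamExec.exists_reg_eq (P : RamProg) :
    ∃ K, ∀ s t s', RamExec P s t s' → ∀ i ≥ K, s'.reg i = s.reg i := by
  induction P with
  | skip => exact ⟨0, fun s t s' h i _ => by cases h; rfl⟩
  | const x c => exact ⟨x + 1, fun s t s' h i hi => by cases h; simp; omega⟩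
  | arith o x y z => exact ⟨x + 1, fun s t s' h i hi => by cases h; simp; omega⟩
  | load x y => exact ⟨x + 1, fun s t s' h i hi => by cases h; simp; omega⟩
  | store x y => exact ⟨0, fun s t s' h i _ => by cases h; rfl⟩
  | seq p q hp hq =>
    obtain ⟨K, hK⟩ := hp
    obtain ⟨L, hL⟩ := hq
    refine ⟨max K L, fun s t s' h i hi => ?_⟩
    cases h with
    | seq h1 h2 => exact (hL _ _ _ h2 i (by omega)).trans (hK _ _ _ h1 i (by omega))
  | cond x p q hp hq =>
    obtain ⟨K, hK⟩ := hp
    obtain ⟨L, hL⟩ := hq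
    refine ⟨max K L, fun s t s' h i hi => ?_⟩
    cases h with
    | cond_true _ h => exact hK _ _ _ h i (by omega)
    | cond_false _ h => exact hL _ _ _ h i (by omega)
  | loop x p hp =>
    obtain ⟨K, hK⟩ := hp
    refine ⟨K, fun s t s' h i hi => ?_⟩
    generalize hQ : RamProg.loop x p = Q at h
    induction h with
    | loop_done _ => rfl
    | loop_step _ h1 h2 _ ih2 =>
      cases hQ
      exact (ih2 rfl).trans (hK _ _ _ h1 i hi)
    | _ => cases hQ

/-- Registers `0, …, K - 1` can be cleared in constant time. -/
theorem exists_clear (K : ℕ) : ∃ (P : RamProg) (c : ℕ), ∀ s, ∃ t s', RamExec P s t s' ∧ t ≤ c ∧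
    s'.mem = s.mem ∧ ∀ i, s'.reg i = if i < K then 0 else s.reg i := by
  induction K with
  | zero => exact ⟨.skip, 1, fun s => ⟨_, _, .skip s, le_rfl, rfl, by simp⟩⟩
  | succ K ih =>
    obtain ⟨P, c, h⟩ := ih
    refine ⟨.seq P (.const K 0), c + 1, fun s => ?_⟩
    obtain ⟨t, s', he, ht, hm, hr⟩ := h s
    refine ⟨_, _, .seq he (.const K 0 _), Nat.add_le_add_right ht _, hm, fun i => ?_⟩
    rw [RamState.setReg_reg, hr]
    split_ifs <;> first | rfl | omega

theorem RamExec.time_pos {P : RamProg} {s s' : RamState} {t : ℕ} (h : RamExec P s t s') :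
    0 < t := by
  induction h <;> (try simp only [bitCost]) <;> omega

/-! ### Digits in mixed radix -/

/-- If no digit overflows, a sum is formed digit by digit. -/
theorem digit_add_sum {n : ℕ} {β e : ℕ → ℕ} {X : ℕ}
    (h : ∀ u < n, X / (∏ x ∈ Finset.range u, β x) % β u + e u < β u) {u : ℕ} (hu : u < n) :
    (X + ∑ x ∈ Finset.range n, e x * ∏ y ∈ Finset.range x, β y) / (∏ x ∈ Finset.range u, β x) % β u =
      X / (∏ x ∈ Finset.range u, β x) % β u + e u := by
  induction n generalizing β e X u with
  | zero => omega
  | succ n ih =>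
    have h0 := h 0 (Nat.succ_pos n)
    simp only [Finset.range_zero, Finset.prod_empty, Nat.div_one] at h0
    have hβ : 0 < β 0 := by omega
    have hsum : ∑ x ∈ Finset.range (n + 1), e x * ∏ y ∈ Finset.range x, β y =
        e 0 + β 0 * ∑ x ∈ Finset.range n, e (x + 1) * ∏ y ∈ Finset.range x, β (y + 1) := by
      rw [Finset.sum_range_succ', Finset.mul_sum, add_comm]
      congr 1
      · simp
      · exact Finset.sum_congr rfl fun x _ => by rw [Finset.prod_range_succ']; ring
    have hX : X = X % β 0 + β 0 * (X / β 0) := (Nat.mod_add_div _ _).symm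
    rw [hsum]
    set Y := ∑ x ∈ Finset.range n, e (x + 1) * ∏ y ∈ Finset.range x, β (y + 1) with hY
    have hsplit : X + (e 0 + β 0 * Y) = (X % β 0 + e 0) + β 0 * (X / β 0 + Y) := by
      conv_lhs => rw [hX]
      ring
    cases u with
    | zero =>
      simp only [Finset.range_zero, Finset.prod_empty, Nat.div_one]
      rw [hsplit, Nat.add_mul_mod_self_left, Nat.mod_eq_of_lt h0]
    | succ u =>
      have hdiv : ∀ v Z, Z / (∏ x ∈ Finset.range (v + 1), β x) =
          Z / β 0 / ∏ x ∈ Finset.range v, β (x + 1) := fun v Z => by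
        rw [Finset.prod_range_succ', mul_comm, Nat.div_div_eq_div_mul]
      rw [hdiv, hdiv, hsplit, Nat.add_mul_div_left _ _ hβ, Nat.div_eq_of_lt h0, zero_add]
      refine ih (β := fun x => β (x + 1)) (e := fun x => e (x + 1)) (fun v hv => ?_) (by omega)
      have := h (v + 1) (by omega)
      rwa [hdiv] at this

theorem sum_digits_lt {n : ℕ} {β e : ℕ → ℕ} (h : ∀ u < n, e u < β u) :
    ∑ x ∈ Finset.range n, e x * ∏ y ∈ Finset.range x, β y < ∏ x ∈ Finset.range n, β x := by
  induction n with
  | zero => simp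
  | succ n ih =>
    rw [Finset.sum_range_succ, Finset.prod_range_succ]
    have h1 := ih fun u hu => h u (by omega)
    have h2 : (e n + 1) * ∏ x ∈ Finset.range n, β x ≤ β n * ∏ x ∈ Finset.range n, β x :=
      Nat.mul_le_mul_right _ (h n (by omega))
    rw [add_mul, one_mul] at h2
    rw [mul_comm _ (β n)]
    omega

/-! ### The search for a connected vertex cover -/

/-- An increasing chain of subsets of `{0, …, n - 1}` that stays constant once it stagnates
is constant from index `n` on. -/
theorem chain_stable {n : ℕ} {R : ℕ → Finset ℕ} (hR : ∀ i, R i ⊆ R (i + 1))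
    (hst : ∀ i, R i = R (i + 1) → R (i + 1) = R (i + 2)) (hn : ∀ i, R i ⊆ Finset.range n) :
    R n = R (n + 1) := by
  by_contra hne
  have h1 : ∀ i ≤ n, R i ≠ R (i + 1) := fun i hi h => by
    have : ∀ k, R (i + k) = R (i + k + 1) := fun k => by
      induction k with
      | zero => exact h
      | succ k ih => exact hst _ ih
    have := this (n - i)
    rw [Nat.add_sub_cancel' hi] at this
    exact hne this
  have h2 : ∀ i ≤ n + 1, i ≤ (R i).card := fun i => by
    induction i with
    | zero => simp
    | succ i ih =>
      intro hi
      have := Finset.card_lt_card ((hR i).ssubset_of_ne (h1 i (by omega)))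
      have := ih (by omega)
      omega
  have h3 := h2 (n + 1) le_rfl
  have h4 := Finset.card_le_card (hn (n + 1))
  simp at h4
  omega

/-- The data of the search: a graph with vertices `0, …, n - 1` and adjacency `A`, a vertex set `S`,
the size bound `l`, and the number `b` of values of a digit that belongs to a vertex of `S`.

A state of the search is a number `q`. Its four lowest digits, in base `n`, are a number of
additional vertices, a root, a vertex presumed outside the cover, and a degree threshold; the
remaining digits, in base `b`, belong to the vertices of `S`: `0` for a vertex presumed
outside the cover, `1` or `2` for one inside, where `2` marks vertices known to be connected
to the root. -/
structure SearchData where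
  n : ℕ
  b : ℕ
  l : ℕ
  S : ℕ → Prop
  A : ℕ → ℕ → Prop

namespace SearchData

variable (D : SearchData)

open Classical in
/-- The number of values of the digit of vertex `u`; vertices outside `S` have the dummy digit
`0`. -/
noncomputable def radix (u : ℕ) : ℕ := if D.S u then D.b else 1

/-- The positional weight of the digit of vertex `u`. -/
noncomputable def weight (u : ℕ) : ℕ := ∏ x ∈ Finset.range u, D.radix x

/-- The digit of vertex `u` in the state `q`. -/
noncomputable def digit (q u : ℕ) : ℕ := q / (D.n * D.n * D.n * D.n) / D.weight u % D.radix u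

/-- The root of the state `q`. -/
def root (q : ℕ) : ℕ := q / D.n % D.n

/-- The vertices presumed outside the cover. -/
def Excluded (q u : ℕ) : Prop := (D.S u ∧ D.digit q u = 0) ∨ u = q / D.n / D.n % D.n

/-- The degree of `u` into the complement of `S`. -/
noncomputable def deg (u : ℕ) : ℕ := ∑ x ∈ Finset.range D.n, truth (¬D.S x ∧ D.A u x)

/-- The vertices forced into the cover: the neighbours of excluded vertices, and the non-excluded
vertices that lie in `S` or reach the degree threshold. -/
def Core (q u : ℕ) : Prop :=
  (∃ x < D.n, D.Excluded q x ∧ D.A x u) ∨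
    ((D.S u ∨ q / D.n / D.n / D.n % D.n ≤ D.deg u) ∧ ¬D.Excluded q u)

/-- The core vertices that are the root or are marked as connected to it. -/
def Seed (q u : ℕ) : Prop := D.Core q u ∧ (u = D.root q ∨ D.digit q u = 2)

/-- The core vertices at distance at most `i` from the seed within the core. -/
def Reached (q : ℕ) : ℕ → ℕ → Prop
  | 0, u => u < D.n ∧ D.Seed q u
  | i + 1, u => u < D.n ∧ D.Core q u ∧ (Reached q i u ∨ ∃ x < D.n, Reached q i x ∧ D.A x u)

/-- The core is a vertex cover and is connected up to the additional vertices that led to the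
marks, and the size bound is respected. -/
def Final (q : ℕ) : Prop :=
  (∀ u < D.n, D.Core q u → D.Reached q D.n u) ∧
    (∀ u < D.n, ∀ w < D.n, D.A u w → D.Core q u ∨ D.Core q w) ∧
    ∑ u ∈ Finset.range D.n, truth (D.Core q u) + q % D.n ≤ D.l

/-- The states without additional vertices and without marks. -/
def Init (q : ℕ) : Prop := q % D.n = 0 ∧ ∀ u < D.n, D.digit q u ≠ 2

/-- The vertex `w` may be added to the cover in the state `q`. -/
def Step (q w : ℕ) : Prop :=
  ¬D.Core q w ∧ (∃ x < D.n, D.Reached q D.n x ∧ D.A x w) ∧ q % D.n + 1 < D.n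

/-- The state after adding the vertex `w`: its neighbours of digit `1` are marked. (For `b = 2`
there are no marks, and the digits remain as they are.) -/
noncomputable def next (q w : ℕ) : ℕ :=
  q + 1 + D.n * D.n * D.n * D.n * ∑ u ∈ Finset.range D.n,
    truth (D.S u ∧ D.digit q u = 1 ∧ D.A w u) * (D.b - 2) * D.weight u

/-- The states that the search visits. -/
inductive Reach : ℕ → Prop
  | init {q : ℕ} : D.Init q → Reach q
  | step {q w : ℕ} : Reach q → w < D.n → D.Step q w → Reach (D.next q w)

/-- A vertex cover of the graph that is nonempty and connected. -/
structure IsCover (X : Finset ℕ) : Prop where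
  lt : ∀ u ∈ X, u < D.n
  cover : ∀ u w, D.A u w → u ∈ X ∨ w ∈ X
  connected : ∃ r ∈ X, ∀ u ∈ X, Relation.ReflTransGen (fun x y => D.A x y ∧ y ∈ X) r u

/-- The adjacency is that of a simple graph on `0, …, n - 1`, and the digits are binary or
ternary. -/
structure Valid : Prop where
  symm : ∀ u w, D.A u w → D.A w u
  irrefl : ∀ u, ¬D.A u u
  lt : ∀ u w, D.A u w → u < D.n
  b : D.b = 2 ∨ D.b = 3

variable {D}

theorem digit_lt (h : D.Valid) (q u : ℕ) : D.digit q u < D.radix u :=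
  Nat.mod_lt _ (by unfold radix; rcases h.b with h | h <;> split_ifs <;> omega)

theorem next_decomp (q w : ℕ) : ∃ δ,
    D.next q w = q % D.n + 1 + D.n * (q / D.n + D.n * D.n * D.n * δ) ∧
    δ = ∑ u ∈ Finset.range D.n,
      truth (D.S u ∧ D.digit q u = 1 ∧ D.A w u) * (D.b - 2) * D.weight u := by
  refine ⟨_, ?_, rfl⟩
  have := Nat.mod_add_div q D.n
  rw [next]
  generalize ∑ u ∈ Finset.range D.n, truth _ * _ * _ = δ
  conv_lhs => rw [← this]
  ring

section next

variable {q w : ℕ}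

theorem lt_next : q < D.next q w := by unfold next; omega

theorem next_mod (hj : q % D.n + 1 < D.n) : D.next q w % D.n = q % D.n + 1 := by
  obtain ⟨δ, h, -⟩ := D.next_decomp q w
  rw [h, Nat.add_mul_mod_self_left, Nat.mod_eq_of_lt hj]

theorem next_div (hj : q % D.n + 1 < D.n) :
    D.next q w / D.n = q / D.n + D.n * D.n * D.n * ∑ u ∈ Finset.range D.n,
      truth (D.S u ∧ D.digit q u = 1 ∧ D.A w u) * (D.b - 2) * D.weight u := by
  obtain ⟨δ, h, hδ⟩ := D.next_decomp q w
  rw [h, ← hδ, Nat.add_mul_div_left _ _ (by omega), Nat.div_eq_of_lt hj, zero_add]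

theorem next_root (hj : q % D.n + 1 < D.n) : D.root (D.next q w) = D.root q := by
  rw [root, next_div hj, mul_assoc, mul_assoc, Nat.add_mul_mod_self_left, root]

theorem next_div_div (hj : q % D.n + 1 < D.n) :
    D.next q w / D.n / D.n = q / D.n / D.n + D.n * (D.n * ∑ u ∈ Finset.range D.n,
      truth (D.S u ∧ D.digit q u = 1 ∧ D.A w u) * (D.b - 2) * D.weight u) := by
  rw [next_div hj, mul_assoc, mul_assoc, Nat.add_mul_div_left _ _ (by omega)]

theorem next_div_div_div (hj : q % D.n + 1 < D.n) :
    D.next q w / D.n / D.n / D.n = q / D.n / D.n / D.n + D.n * ∑ u ∈ Finset.range D.n,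
      truth (D.S u ∧ D.digit q u = 1 ∧ D.A w u) * (D.b - 2) * D.weight u := by
  rw [next_div_div hj, Nat.add_mul_div_left _ _ (by omega)]

open Classical in
theorem next_digit (hD : D.Valid) (hj : q % D.n + 1 < D.n) {u : ℕ} (hu : u < D.n) :
    D.digit (D.next q w) u =
      if D.S u ∧ D.digit q u = 1 ∧ D.A w u then D.b - 1 else D.digit q u := by
  have h4 : ∀ q, q / (D.n * D.n * D.n * D.n) = q / D.n / D.n / D.n / D.n := fun q => by
    simp only [Nat.div_div_eq_div_mul, mul_assoc]
  have hdig : ∀ v, D.digit q v + truth (D.S v ∧ D.digit q v = 1 ∧ D.A w v) * (D.b - 2) =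
      if D.S v ∧ D.digit q v = 1 ∧ D.A w v then D.b - 1 else D.digit q v := fun v => by
    have := hD.b
    split_ifs with h
    · rw [truth_eq_one.2 h, h.2.1]; omega
    · rw [truth_eq_zero.2 h]; omega
  have key := digit_add_sum (n := D.n) (β := D.radix) (X := q / (D.n * D.n * D.n * D.n))
    (e := fun v => truth (D.S v ∧ D.digit q v = 1 ∧ D.A w v) * (D.b - 2)) (fun v _ => by
      change D.digit q v + truth (D.S v ∧ D.digit q v = 1 ∧ D.A w v) * (D.b - 2) < _
      rw [hdig]
      split_ifs with h
      · rw [radix, if_pos h.1]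
        have := hD.b
        omega
      · exact digit_lt hD q v) hu
  rw [← hdig]
  refine Eq.trans ?_ key
  rw [digit, h4 (D.next q w), next_div_div_div hj, Nat.add_mul_div_left _ _ (by omega), ← h4]
  rfl

theorem next_excluded (hD : D.Valid) (hj : q % D.n + 1 < D.n) {u : ℕ} (hu : u < D.n) :
    D.Excluded (D.next q w) u ↔ D.Excluded q u := by
  rw [Excluded, Excluded, next_digit hD hj hu, next_div_div hj, Nat.add_mul_mod_self_left]
  have := hD.b
  split_ifs with h
  · have h1 := h.2.1
    have : D.b - 1 ≠ 0 := by omega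
    simp [h1, this]
  · rfl

theorem next_core (hD : D.Valid) (hj : q % D.n + 1 < D.n) {u : ℕ} (hu : u < D.n) :
    D.Core (D.next q w) u ↔ D.Core q u := by
  rw [Core, Core, next_excluded hD hj hu, next_div_div_div hj, Nat.add_mul_mod_self_left]
  have : (∃ x < D.n, D.Excluded (D.next q w) x ∧ D.A x u) ↔
      ∃ x < D.n, D.Excluded q x ∧ D.A x u :=
    exists_congr fun x => and_congr_right fun hx => by rw [next_excluded hD hj hx]
  rw [this]

end next

theorem Reached.lt {q i u : ℕ} (h : D.Reached q i u) : u < D.n := by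
  cases i <;> exact h.1

theorem Reached.core {q i u : ℕ} (h : D.Reached q i u) : D.Core q u := by
  cases i with
  | zero => exact h.2.1
  | succ i => exact h.2.1

theorem Reached.succ {q i u : ℕ} (h : D.Reached q i u) : D.Reached q (i + 1) u :=
  ⟨h.lt, h.core, .inl h⟩

theorem Reached.le {q i j u : ℕ} (h : D.Reached q i u) (hij : i ≤ j) : D.Reached q j u := by
  induction j, hij using Nat.le_induction with
  | base => exact h
  | succ j _ ih => exact ih.succ

/-- The set of vertices reached within `n` rounds is closed under adjacency in the core. -/
theorem reached_closed {q x u : ℕ} (hx : D.Reached q D.n x) (hA : D.A x u) (hu : u < D.n)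
    (hc : D.Core q u) : D.Reached q D.n u := by
  classical
  have := chain_stable (n := D.n) (R := fun i => (Finset.range D.n).filter (D.Reached q i))
    (fun i y hy => by
      simp only [Finset.mem_filter] at hy ⊢
      exact ⟨hy.1, hy.2.succ⟩)
    (fun i h => by
      have h' : ∀ y, D.Reached q i y ↔ D.Reached q (i + 1) y := fun y => by
        have := congrArg (y ∈ ·) h
        simp only [Finset.mem_filter, Finset.mem_range, eq_iff_iff] at this
        exact ⟨fun h => (this.1 ⟨h.lt, h⟩).2, fun h => (this.2 ⟨h.lt, h⟩).2⟩
      refine Finset.filter_congr fun y _ => ?_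
      show D.Reached q (i + 1) y ↔ D.Reached q (i + 1 + 1) y
      rw [Reached, Reached]
      simp only [h'])
    (fun i => Finset.filter_subset _ _)
  have hm : u ∈ (Finset.range D.n).filter (D.Reached q (D.n + 1)) := by
    simp only [Finset.mem_filter, Finset.mem_range]
    exact ⟨hu, hu, hc, .inr ⟨x, hx.lt, hx, hA⟩⟩
  rw [← this, Finset.mem_filter] at hm
  exact hm.2

/-- Invariant of the search: the marks are justified by as many additional vertices as the state
records. -/
def Justified (D : SearchData) (q : ℕ) (W : Finset ℕ) : Prop :=
  W.card ≤ q % D.n ∧ (∀ w ∈ W, w < D.n) ∧ ∀ u, (u ∈ W ∨ u < D.n ∧ D.Seed q u) →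
    D.Core q (D.root q) ∧ Relation.ReflTransGen (fun x y => D.A x y ∧ y < D.n ∧
      (D.Core q y ∨ y ∈ W)) (D.root q) u

theorem Justified.reached {q : ℕ} {W : Finset ℕ} (h : D.Justified q W) {i u : ℕ}
    (hu : D.Reached q i u) : D.Core q (D.root q) ∧
      Relation.ReflTransGen (fun x y => D.A x y ∧ y < D.n ∧ (D.Core q y ∨ y ∈ W)) (D.root q) u := by
  induction i generalizing u with
  | zero => exact h.2.2 u (.inr hu)
  | succ i ih =>
    obtain ⟨h1, h2, h3 | ⟨x, hx, h3, hA⟩⟩ := hu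
    · exact ih h3
    · exact ⟨(ih h3).1, (ih h3).2.tail ⟨hA, h1, .inl h2⟩⟩

theorem Reach.justified (hD : D.Valid) {q : ℕ} (h : D.Reach q) : ∃ W, D.Justified q W := by
  induction h with
  | @init q h =>
    refine ⟨∅, by simp, by simp, fun u hu => ?_⟩
    rcases hu with hu | ⟨hu, hc, rfl | h2⟩
    · simp at hu
    · exact ⟨hc, .refl⟩
    · exact absurd h2 (h.2 u hu)
  | @step q w _ hw hs ih =>
    obtain ⟨W, hW⟩ := ih
    obtain ⟨-, ⟨x, hx, hr, hA⟩, hj⟩ := hs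
    have hroot : D.root q < D.n := Nat.mod_lt _ (by omega)
    obtain ⟨hcr, hpath⟩ := hW.reached hr
    have mono : ∀ {u}, Relation.ReflTransGen (fun x y => D.A x y ∧ y < D.n ∧
        (D.Core q y ∨ y ∈ W)) (D.root q) u →
        Relation.ReflTransGen (fun x y => D.A x y ∧ y < D.n ∧
          (D.Core (D.next q w) y ∨ y ∈ insert w W)) (D.root q) u := fun h =>
      Relation.ReflTransGen.mono (fun a c ⟨h1, h2, h3⟩ => ⟨h1, h2, by
        rw [next_core hD hj h2]
        exact h3.imp_right (Finset.mem_insert_of_mem)⟩) _ _ h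
    have hpw := (mono hpath).tail ⟨hA, hw, .inr (Finset.mem_insert_self w W)⟩
    refine ⟨insert w W, ?_, fun v hv => ?_, fun u hu => ?_⟩
    · rw [next_mod hj]
      exact (Finset.card_insert_le _ _).trans (Nat.succ_le_succ hW.1)
    · rcases Finset.mem_insert.1 hv with rfl | hv
      · exact hw
      · exact hW.2.1 v hv
    · rw [next_root hj, next_core hD hj hroot]
      refine ⟨hcr, ?_⟩
      rcases hu with hu | ⟨hu, hc, hs⟩
      · rcases Finset.mem_insert.1 hu with rfl | hu
        · exact hpw
        · exact mono (hW.2.2 u (.inl hu)).2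
      · rw [next_core hD hj hu] at hc
        rw [next_root hj, next_digit hD hj hu] at hs
        rcases hs with rfl | hs
        · exact .refl
        · split_ifs at hs with h
          · exact hpw.tail ⟨h.2.2, hu, .inl ((next_core hD hj hu).2 hc)⟩
          · exact mono (hW.2.2 u (.inr ⟨hu, hc, .inr hs⟩)).2

/-- Soundness of the search. -/
theorem exists_cover_of_final (hD : D.Valid) (hn : 0 < D.n) (hl : 0 < D.l) {q : ℕ}
    (h : D.Reach q) (hf : D.Final q) : ∃ X, D.IsCover X ∧ X.card ≤ D.l := by
  classical
  obtain ⟨W, hW⟩ := h.justified hD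
  obtain ⟨h1, h2, h3⟩ := hf
  have hlt : ∀ u w, D.A u w → u < D.n ∧ w < D.n := fun u w h =>
    ⟨hD.lt u w h, hD.lt w u (hD.symm u w h)⟩
  have hroot : D.root q < D.n := Nat.mod_lt _ hn
  by_cases hr : D.Core q (D.root q)
  · have hmem : ∀ u, u ∈ (Finset.range D.n).filter (D.Core q) ∪ W ↔
        u < D.n ∧ (D.Core q u ∨ u ∈ W) := fun u => by
      simp only [Finset.mem_union, Finset.mem_filter, Finset.mem_range]
      have := hW.2.1 u
      tauto
    refine ⟨(Finset.range D.n).filter (D.Core q) ∪ W, ⟨fun u hu => ((hmem u).1 hu).1,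
      fun u w huw => ?_, D.root q, (hmem _).2 ⟨hroot, .inl hr⟩, fun u hu => ?_⟩, ?_⟩
    · obtain ⟨hu, hw⟩ := hlt u w huw
      rw [hmem, hmem]
      exact (h2 u hu w hw huw).imp (fun h => ⟨hu, .inl h⟩) fun h => ⟨hw, .inl h⟩
    · simp only [hmem]
      rw [hmem] at hu
      rcases hu with ⟨hu, hc | hc⟩
      · exact (hW.reached (h1 u hu hc)).2
      · exact (hW.2.2 u (.inl hc)).2
    · have : ((Finset.range D.n).filter (D.Core q)).card =
          ∑ u ∈ Finset.range D.n, truth (D.Core q u) := by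
        rw [Finset.card_filter]
        exact Finset.sum_congr rfl fun u _ => by simp only [truth]
      have := Finset.card_union_le ((Finset.range D.n).filter (D.Core q)) W
      have := hW.1
      omega
  · -- the core is empty, hence the graph has no edges
    have hc : ∀ u < D.n, ¬D.Core q u := fun u hu h => hr (hW.reached (h1 u hu h)).1
    refine ⟨{0}, ⟨by simpa using hn, fun u w huw => ?_, 0, by simp, ?_⟩,
      by rw [Finset.card_singleton]; exact hl⟩
    · obtain ⟨hu, hw⟩ := hlt u w huw
      exact ((h2 u hu w hw huw).elim (hc u hu) (hc w hw)).elim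
    · intro u hu
      rw [Finset.mem_singleton.1 hu]

end SearchData

/-! ### Degree thresholds in split graphs -/

namespace SearchData

variable {D : SearchData}

open Classical in
theorem deg_eq_card (u : ℕ) :
    D.deg u = (((Finset.range D.n).filter fun x => ¬D.S x).filter (D.A u)).card := by
  rw [deg, Finset.filter_filter, Finset.card_filter]
  exact Finset.sum_congr rfl fun x _ => by unfold truth; congr

/-- In a split graph, the vertices whose degree reaches a suitable threshold form a clique, and the
others are independent. With `C` a maximum clique of a split partition, the threshold is
`|C| - 1`, or `|C|` if some vertex outside `C` has degree `|C| - 1`. -/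
theorem exists_threshold (hD : D.Valid) (hn : 0 < D.n) {P : ℕ → Prop}
    (hC : ∀ u < D.n, ∀ w < D.n, ¬D.S u → ¬D.S w → P u → P w → u ≠ w → D.A u w)
    (hI : ∀ u < D.n, ∀ w < D.n, ¬D.S u → ¬D.S w → ¬P u → ¬P w → ¬D.A u w) :
    ∃ θ < D.n, (∀ u < D.n, ∀ w < D.n, ¬D.S u → ¬D.S w → θ ≤ D.deg u → θ ≤ D.deg w → u ≠ w →
      D.A u w) ∧
      ∀ u < D.n, ∀ w < D.n, ¬D.S u → ¬D.S w → D.deg u < θ → D.deg w < θ → ¬D.A u w := by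
  classical
  set V := (Finset.range D.n).filter fun x => ¬D.S x with hV
  have mV : ∀ u, u ∈ V ↔ u < D.n ∧ ¬D.S u := fun u => by simp [hV]
  let Good : Finset ℕ → Prop := fun C => (∀ u ∈ C, ∀ w ∈ C, u ≠ w → D.A u w) ∧
    ∀ u ∈ V, ∀ w ∈ V, u ∉ C → w ∉ C → ¬D.A u w
  obtain ⟨C, hCV, hmax⟩ := Finset.exists_max_image (V.powerset.filter Good) Finset.card
    ⟨V.filter P, by
      simp only [Finset.mem_filter, Finset.mem_powerset, Finset.filter_subset, true_and]
      refine ⟨fun u hu w hw h => ?_, fun u hu w hw h h' => ?_⟩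
      · rw [Finset.mem_filter, mV] at hu hw
        exact hC u hu.1.1 w hw.1.1 hu.1.2 hw.1.2 hu.2 hw.2 h
      · have h1 := (mV u).1 hu
        have h2 := (mV w).1 hw
        rw [Finset.mem_filter] at h h'
        exact hI u h1.1 w h2.1 h1.2 h2.2 (fun hp => h ⟨hu, hp⟩) (fun hp => h' ⟨hw, hp⟩)⟩
  rw [Finset.mem_filter, Finset.mem_powerset] at hCV
  obtain ⟨hCV, hCl, hInd⟩ := hCV
  have hdeg : ∀ u, D.deg u = (V.filter (D.A u)).card := deg_eq_card
  have hsub : ∀ u ∈ C, C.erase u ⊆ V.filter (D.A u) := fun u hu x hx => by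
    rw [Finset.mem_erase] at hx
    exact Finset.mem_filter.2 ⟨hCV hx.2, hCl u hu x hx.2 hx.1.symm⟩
  have F1 : ∀ u ∈ C, C.card - 1 ≤ D.deg u := fun u hu => by
    rw [hdeg, ← Finset.card_erase_of_mem hu]
    exact Finset.card_le_card (hsub u hu)
  have hsub' : ∀ w ∈ V, w ∉ C → V.filter (D.A w) ⊆ C := fun w hw hwC x hx => by
    rw [Finset.mem_filter] at hx
    by_contra hxC
    exact hInd w hw x hx.1 hwC hxC hx.2
  have F2 : ∀ w ∈ V, w ∉ C → D.deg w < C.card := fun w hw hwC => by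
    rw [hdeg]
    refine Finset.card_lt_card ((hsub' w hw hwC).ssubset_of_ne fun he => ?_)
    have hall : ∀ x ∈ C, D.A w x := fun x hx => (Finset.mem_filter.1 (he ▸ hx)).2
    have := hmax (insert w C) (by
      rw [Finset.mem_filter, Finset.mem_powerset, Finset.insert_subset_iff]
      refine ⟨⟨hw, hCV⟩, fun u hu x hx hne => ?_, fun u hu x hx h h' => ?_⟩
      · rw [Finset.mem_insert] at hu hx
        rcases hu with rfl | hu <;> rcases hx with rfl | hx
        · exact absurd rfl hne
        · exact hall x hx
        · exact hD.symm _ _ (hall u hu)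
        · exact hCl u hu x hx hne
      · rw [Finset.mem_insert, not_or] at h h'
        exact hInd u hu x hx h.2 h'.2)
    rw [Finset.card_insert_of_notMem hwC] at this
    omega
  by_cases h : ∀ w ∈ V, w ∉ C → D.deg w + 1 < C.card
  · have hcn : C.card ≤ D.n := by
      have := Finset.card_le_card (hCV.trans (Finset.filter_subset _ _))
      simpa using this
    refine ⟨C.card - 1, by omega, fun u hu w hw hu' hw' h1 h2 hne => ?_,
      fun u hu w hw hu' hw' h1 h2 => ?_⟩
    · have key : ∀ x ∈ V, C.card - 1 ≤ D.deg x → x ∈ C := fun x hx h' => by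
        by_contra hxC
        have := h x hx hxC
        omega
      exact hCl u (key u ((mV u).2 ⟨hu, hu'⟩) h1) w (key w ((mV w).2 ⟨hw, hw'⟩) h2) hne
    · have key : ∀ x, D.deg x < C.card - 1 → x ∉ C := fun x h' hxC => by
        have := F1 x hxC
        omega
      exact hInd u ((mV u).2 ⟨hu, hu'⟩) w ((mV w).2 ⟨hw, hw'⟩) (key u h1) (key w h2)
  · push Not at h
    obtain ⟨w₀, hw₀, hw₀C, hd⟩ := h
    have hd' := F2 w₀ hw₀ hw₀C
    have hcn : C.card < D.n := by
      have := Finset.card_le_card ((Finset.insert_subset hw₀ hCV).trans (Finset.filter_subset _ _))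
      rw [Finset.card_insert_of_notMem hw₀C] at this
      simpa using this
    refine ⟨C.card, hcn, fun u hu w hw hu' hw' h1 h2 hne => ?_,
      fun u hu w hw hu' hw' h1 h2 hA => ?_⟩
    · have key : ∀ x ∈ V, C.card ≤ D.deg x → x ∈ C := fun x hx h' => by
        by_contra hxC
        have := F2 x hx hxC
        omega
      exact hCl u (key u ((mV u).2 ⟨hu, hu'⟩) h1) w (key w ((mV w).2 ⟨hw, hw'⟩) h2) hne
    · -- a vertex of `C` of degree `|C| - 1` has no neighbours outside `C`
      have nb : ∀ x ∈ C, D.deg x < C.card → V.filter (D.A x) = C.erase x := fun x hx h' => by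
        refine (Finset.eq_of_subset_of_card_le (hsub x hx) ?_).symm
        rw [← hdeg, Finset.card_erase_of_mem hx]
        omega
      have huV := (mV u).2 ⟨hu, hu'⟩
      have hwV := (mV w).2 ⟨hw, hw'⟩
      have move : ∀ x ∈ C, D.deg x < C.card → ∀ y ∈ V, D.A x y → y ∈ C := fun x hx h' y hy hxy =>
        Finset.mem_of_mem_erase (nb x hx h' ▸ Finset.mem_filter.2 ⟨hy, hxy⟩)
      have huC : u ∈ C := by
        by_contra huC
        by_cases hwC : w ∈ C
        · exact huC (move w hwC h2 u huV (hD.symm _ _ hA))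
        · exact hInd u huV w hwV huC hwC hA
      have hwC := move u huC h1 w hwV hA
      have hne : w ≠ u := fun h => hD.irrefl u (h ▸ hA)
      have : V.filter (D.A w₀) ⊆ (C.erase u).erase w := fun x hx => by
        have hx' := Finset.mem_filter.1 hx
        refine Finset.mem_erase.2 ⟨?_, Finset.mem_erase.2 ⟨?_, hsub' w₀ hw₀ hw₀C hx⟩⟩
        · rintro rfl
          exact hw₀C (move x hwC h2 w₀ hw₀ (hD.symm _ _ hx'.2))
        · rintro rfl
          exact hw₀C (move x huC h1 w₀ hw₀ (hD.symm _ _ hx'.2))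
      have := Finset.card_le_card this
      have hpos := Finset.card_pos.2 ⟨u, huC⟩
      rw [← hdeg, Finset.card_erase_of_mem (Finset.mem_erase.2 ⟨hne, hwC⟩),
        Finset.card_erase_of_mem huC] at this
      have h2 : 2 ≤ C.card := Finset.one_lt_card.2 ⟨w, hwC, u, huC, hne⟩
      omega

/-! ### Completeness of the search -/

/-- The number of states of the search. -/
noncomputable def stateCount (D : SearchData) : ℕ :=
  D.n * D.n * D.n * D.n * ∏ x ∈ Finset.range D.n, D.radix x

/-- The state with the given entries. -/
noncomputable def code (D : SearchData) (j r v θ : ℕ) (δ : ℕ → ℕ) : ℕ :=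
  j + D.n * (r + D.n * (v + D.n * (θ + D.n * ∑ u ∈ Finset.range D.n, δ u * D.weight u)))

section code

variable {j r v θ : ℕ} {δ : ℕ → ℕ}

theorem code_mod (hj : j < D.n) : D.code j r v θ δ % D.n = j := by
  rw [code, Nat.add_mul_mod_self_left, Nat.mod_eq_of_lt hj]

theorem code_div (hj : j < D.n) : D.code j r v θ δ / D.n =
    r + D.n * (v + D.n * (θ + D.n * ∑ u ∈ Finset.range D.n, δ u * D.weight u)) := by
  rw [code, Nat.add_mul_div_left _ _ (by omega), Nat.div_eq_of_lt hj, zero_add]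

theorem code_root (hj : j < D.n) (hr : r < D.n) : D.root (D.code j r v θ δ) = r := by
  rw [root, code_div hj, Nat.add_mul_mod_self_left, Nat.mod_eq_of_lt hr]

theorem code_div_div (hj : j < D.n) (hr : r < D.n) : D.code j r v θ δ / D.n / D.n =
    v + D.n * (θ + D.n * ∑ u ∈ Finset.range D.n, δ u * D.weight u) := by
  rw [code_div hj, Nat.add_mul_div_left _ _ (by omega), Nat.div_eq_of_lt hr, zero_add]

theorem code_div_div_div (hj : j < D.n) (hr : r < D.n) (hv : v < D.n) :
    D.code j r v θ δ / D.n / D.n / D.n =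
    θ + D.n * ∑ u ∈ Finset.range D.n, δ u * D.weight u := by
  rw [code_div_div hj hr, Nat.add_mul_div_left _ _ (by omega), Nat.div_eq_of_lt hv, zero_add]

theorem code_digit (hj : j < D.n) (hr : r < D.n) (hv : v < D.n) (hθ : θ < D.n)
    (hδ : ∀ u < D.n, δ u < D.radix u) {u : ℕ} (hu : u < D.n) :
    D.digit (D.code j r v θ δ) u = δ u := by
  have h4 : ∀ q, q / (D.n * D.n * D.n * D.n) = q / D.n / D.n / D.n / D.n := fun q => by
    simp only [Nat.div_div_eq_div_mul, mul_assoc]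
  rw [digit, h4, code_div_div_div hj hr hv, Nat.add_mul_div_left _ _ (by omega),
    Nat.div_eq_of_lt hθ]
  have := digit_add_sum (n := D.n) (β := D.radix) (X := 0) (e := δ)
    (by simpa using hδ) hu
  rw [Nat.zero_div, Nat.zero_mod, zero_add, zero_add] at this
  rw [zero_add]
  exact this

theorem code_lt (hj : j < D.n) (hr : r < D.n) (hv : v < D.n) (hθ : θ < D.n)
    (hδ : ∀ u < D.n, δ u < D.radix u) : D.code j r v θ δ < D.stateCount := by
  have h := sum_digits_lt hδ
  have step : ∀ a Q K, a < D.n → Q < K → a + D.n * Q < D.n * K := fun a Q K ha hQ => by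
    have := Nat.mul_le_mul_left D.n (Nat.succ_le_of_lt hQ)
    rw [Nat.succ_eq_add_one, mul_add] at this
    omega
  rw [stateCount]
  simp only [mul_assoc]
  exact step _ _ _ hj (step _ _ _ hr (step _ _ _ hv (step _ _ _ hθ h)))

end code

/-- A path that starts inside a set and ends outside leaves the set along some edge. -/
theorem exists_leaving {α : Type*} {R : α → α → Prop} {P : α → Prop} {a c : α}
    (h : Relation.ReflTransGen R a c) (ha : P a) (hc : ¬P c) :
    ∃ x y, Relation.ReflTransGen R a x ∧ R x y ∧ P x ∧ ¬P y := by
  induction h with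
  | refl => exact absurd ha hc
  | @tail x y hx hxy ih =>
    by_cases h : P x
    · exact ⟨x, y, hx, hxy, h, hc⟩
    · exact ih h

open Classical in
/-- A family of states, indexed by the sets `W` of additional vertices and following the steps of
the search, contains a final state: as long as the state for `W` is not final, the connectivity of the
cover `X` supplies a further vertex that may be added. Here `Y` is the common core of the states. -/
theorem exists_final_of_family (hD : D.Valid) {X : Finset ℕ} (hX : D.IsCover X)
    (hXl : X.card ≤ D.l) {Y : ℕ → Prop} {r : ℕ} {Q : Finset ℕ → ℕ} (hr : r < D.n)
    (hYX : ∀ u < D.n, Y u → u ∈ X) (hYcov : ∀ u w, D.A u w → Y u ∨ Y w)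
    (hrY : (∃ c < D.n, Y c) → Y r) (hcard : (X.filter fun u => ¬Y u).card < D.n)
    (hlt : ∀ W ⊆ X.filter (fun u => ¬Y u), Q W < D.stateCount)
    (hmod : ∀ W ⊆ X.filter (fun u => ¬Y u), Q W % D.n = W.card)
    (hroot : ∀ W ⊆ X.filter (fun u => ¬Y u), D.root (Q W) = r)
    (hcore : ∀ W ⊆ X.filter (fun u => ¬Y u), ∀ u < D.n, D.Core (Q W) u ↔ Y u)
    (hmark : ∀ W ⊆ X.filter (fun u => ¬Y u), D.Reached (Q W) D.n r → ∀ a ∈ W, ∀ c ∈ X, Y c →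
      D.A a c → D.Reached (Q W) D.n c)
    (hnext : ∀ W ⊆ X.filter (fun u => ¬Y u), ∀ c ∈ X, ¬Y c → c ∉ W →
      D.next (Q W) c = Q (insert c W))
    (h₀ : D.Reach (Q ∅)) : ∃ q < D.stateCount, D.Reach q ∧ D.Final q := by
  have step : ∀ W ⊆ X.filter (fun u => ¬Y u), ¬D.Final (Q W) →
      ∃ c ∈ X, ¬Y c ∧ c ∉ W ∧ ∃ a, D.Reached (Q W) D.n a ∧ D.A a c := by
    intro W hW hf
    -- some core vertex is not reached yet
    obtain ⟨y, hy, hyY, hyR⟩ : ∃ y < D.n, Y y ∧ ¬D.Reached (Q W) D.n y := by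
      by_contra hcon
      push Not at hcon
      refine hf ⟨fun u hu h => hcon u hu ((hcore W hW u hu).1 h), fun u hu w hw hA => ?_, ?_⟩
      · rw [hcore W hW u hu, hcore W hW w hw]
        exact hYcov u w hA
      · have h1 : ∑ u ∈ Finset.range D.n, truth (D.Core (Q W) u) =
            ((Finset.range D.n).filter Y).card := by
          rw [Finset.card_filter]
          refine Finset.sum_congr rfl fun u hu => ?_
          simp only [truth, hcore W hW u (Finset.mem_range.1 hu)]
        have h2 : Disjoint ((Finset.range D.n).filter Y) W :=
          Finset.disjoint_left.2 fun u hu hu' =>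
            (Finset.mem_filter.1 (hW hu')).2 (Finset.mem_filter.1 hu).2
        have h3 : (Finset.range D.n).filter Y ∪ W ⊆ X := Finset.union_subset
          (fun u hu => hYX u (Finset.mem_range.1 (Finset.mem_filter.1 hu).1)
            (Finset.mem_filter.1 hu).2) (hW.trans (Finset.filter_subset _ _))
        have h4 := Finset.card_le_card h3
        rw [Finset.card_union_of_disjoint h2] at h4
        rw [h1, hmod W hW]
        omega
    have hrr : D.Reached (Q W) D.n r := Reached.le (i := 0) ⟨hr, (hcore W hW r hr).2
      (hrY ⟨y, hy, hyY⟩), .inl (hroot W hW).symm⟩ (Nat.zero_le _)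
    have hreachX : ∀ u, D.Reached (Q W) D.n u → u ∈ X := fun u h =>
      hYX u h.lt ((hcore W hW u h.lt).1 h.core)
    -- as the cover is connected, some edge leads from the connected part to the rest
    obtain ⟨a, c, haT, hcT, hcX, hA⟩ : ∃ a c, (D.Reached (Q W) D.n a ∨ a ∈ W) ∧
        ¬(D.Reached (Q W) D.n c ∨ c ∈ W) ∧ c ∈ X ∧ D.A a c := by
      obtain ⟨r₀, hr₀, hcon⟩ := hX.connected
      have hyT : ¬(D.Reached (Q W) D.n y ∨ y ∈ W) := fun h =>
        h.elim hyR fun h => (Finset.mem_filter.1 (hW h)).2 hyY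
      by_cases h0 : D.Reached (Q W) D.n r₀ ∨ r₀ ∈ W
      · obtain ⟨a, c, -, ⟨hA, hc⟩, h1, h2⟩ := exists_leaving
          (P := fun x => D.Reached (Q W) D.n x ∨ x ∈ W) (hcon y (hYX y hy hyY)) h0 hyT
        exact ⟨a, c, h1, h2, hc, hA⟩
      · obtain ⟨c, a, hp, ⟨hA, -⟩, h1, h2⟩ := exists_leaving
          (P := fun x => ¬(D.Reached (Q W) D.n x ∨ x ∈ W)) (hcon r (hreachX r hrr)) h0
          (not_not.2 (.inl hrr))
        refine ⟨a, c, not_not.1 h2, h1, ?_, hD.symm _ _ hA⟩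
        rcases Relation.ReflTransGen.cases_tail hp with rfl | ⟨_, _, h⟩
        · exact hr₀
        · exact h.2
    rw [not_or] at hcT
    have hcn := hX.lt c hcX
    have hcY : ¬Y c := fun hcY => hcT.1 <| haT.elim
      (fun ha => reached_closed ha hA hcn ((hcore W hW c hcn).2 hcY))
      fun ha => hmark W hW hrr a ha c hcX hcY hA
    exact ⟨c, hcX, hcY, hcT.2, a, haT.resolve_right fun ha =>
      (hYcov a c hA).elim (Finset.mem_filter.1 (hW ha)).2 hcY, hA⟩
  have main : ∀ k, ∀ W ⊆ X.filter (fun u => ¬Y u), W.card + k = (X.filter fun u => ¬Y u).card →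
      D.Reach (Q W) → ∃ q < D.stateCount, D.Reach q ∧ D.Final q := by
    intro k
    induction k with
    | zero =>
      intro W hW hk hreach
      by_cases hf : D.Final (Q W)
      · exact ⟨_, hlt W hW, hreach, hf⟩
      obtain ⟨c, hcX, hcY, hcW, -⟩ := step W hW hf
      have := Finset.card_le_card (Finset.insert_subset (Finset.mem_filter.2 ⟨hcX, hcY⟩) hW)
      rw [Finset.card_insert_of_notMem hcW] at this
      omega
    | succ k ih =>
      intro W hW hk hreach
      by_cases hf : D.Final (Q W)
      · exact ⟨_, hlt W hW, hreach, hf⟩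
      obtain ⟨c, hcX, hcY, hcW, a, haR, hA⟩ := step W hW hf
      have hcn := hX.lt c hcX
      have hcc := Finset.card_insert_of_notMem hcW
      have hstep : D.Step (Q W) c := ⟨fun h => hcY ((hcore W hW c hcn).1 h),
        ⟨a, haR.lt, haR, hA⟩, by rw [hmod W hW]; omega⟩
      exact ih (insert c W) (Finset.insert_subset (Finset.mem_filter.2 ⟨hcX, hcY⟩) hW) (by omega)
        (hnext W hW c hcX hcY hcW ▸ hreach.step hcn hstep)
  exact main _ ∅ (Finset.empty_subset _) (by rw [Finset.card_empty, zero_add]) h₀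

/-- Completeness of the search, given a threshold for the split partition; if digits are binary, all
vertices outside `S` have to reach the threshold. -/
theorem exists_final (hD : D.Valid) {θ : ℕ} (hθ : θ < D.n)
    (hC : ∀ u < D.n, ∀ w < D.n, ¬D.S u → ¬D.S w → θ ≤ D.deg u → θ ≤ D.deg w → u ≠ w → D.A u w)
    (hI : ∀ u < D.n, ∀ w < D.n, ¬D.S u → ¬D.S w → D.deg u < θ → D.deg w < θ → ¬D.A u w)
    (hb : D.b = 3 ∨ ∀ u < D.n, ¬D.S u → θ ≤ D.deg u)
    {X : Finset ℕ} (hX : D.IsCover X) (hXl : X.card ≤ D.l) (hne : ∃ v < D.n, v ∉ X) :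
    ∃ q < D.stateCount, D.Reach q ∧ D.Final q := by
  classical
  -- the excluded vertex of the clique side, if there is one
  obtain ⟨v, hv, hvX, hvu⟩ : ∃ v < D.n, v ∉ X ∧
      ∀ u < D.n, ¬D.S u → θ ≤ D.deg u → u ∉ X → u = v := by
    by_cases h : ∃ v < D.n, ¬D.S v ∧ θ ≤ D.deg v ∧ v ∉ X
    · obtain ⟨v, hv, hS, hd, hvX⟩ := h
      refine ⟨v, hv, hvX, fun u hu hS' hd' huX => ?_⟩
      by_contra hne
      exact (hX.cover u v (hC u hu v hv hS' hS hd' hd hne)).elim huX hvX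
    · push Not at h
      obtain ⟨v, hv, hvX⟩ := hne
      exact ⟨v, hv, hvX, fun u hu hS hd huX => absurd (h u hu hS hd) huX⟩
  obtain ⟨E, hE⟩ : ∃ E : ℕ → Prop, ∀ u, E u ↔ (D.S u ∧ u ∉ X) ∨ u = v := ⟨_, fun _ => Iff.rfl⟩
  obtain ⟨Y, hY⟩ : ∃ Y : ℕ → Prop, ∀ u, Y u ↔ (∃ x < D.n, E x ∧ D.A x u) ∨
    ((D.S u ∨ θ ≤ D.deg u) ∧ ¬E u) := ⟨_, fun _ => Iff.rfl⟩
  have hEX : ∀ u, E u → u ∉ X := fun u h => ((hE u).1 h).elim (fun h => h.2) fun h => h ▸ hvX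
  have hYX : ∀ u < D.n, Y u → u ∈ X := fun u hu h => by
    by_contra huX
    rcases (hY u).1 h with ⟨x, -, hx, hA⟩ | ⟨hS, hnE⟩
    · exact huX ((hX.cover x u hA).resolve_left (hEX x hx))
    · rw [hE] at hnE
      by_cases hS' : D.S u
      · exact hnE (.inl ⟨hS', huX⟩)
      · exact hnE (.inr (hvu u hu hS' (hS.resolve_left hS') huX))
  have hlt : ∀ u w, D.A u w → u < D.n ∧ w < D.n := fun u w h =>
    ⟨hD.lt u w h, hD.lt w u (hD.symm u w h)⟩
  have hout : ∀ w, ¬Y w → ¬E w → ¬D.S w ∧ D.deg w < θ := fun w h h' => by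
    rw [hY, not_or] at h
    have : ¬(D.S w ∨ θ ≤ D.deg w) := fun hs => h.2 ⟨hs, h'⟩
    rwa [not_or, not_le] at this
  have hYcov : ∀ u w, D.A u w → Y u ∨ Y w := fun u w hA => by
    obtain ⟨hu, hw⟩ := hlt u w hA
    by_contra hcon
    rw [not_or] at hcon
    obtain ⟨a1, a2⟩ := hout u hcon.1 fun h => hcon.2 ((hY w).2 (.inl ⟨u, hu, h, hA⟩))
    obtain ⟨b1, b2⟩ := hout w hcon.2 fun h => hcon.1 ((hY u).2 (.inl ⟨w, hw, h, hD.symm _ _ hA⟩))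
    exact hI u hu w hw a1 b1 a2 b2 hA
  -- the root, on the clique side if possible
  obtain ⟨r, hr, hrY, hrC⟩ : ∃ r < D.n, ((∃ c < D.n, Y c) → Y r) ∧
      ∀ c < D.n, Y c → ¬D.S c → θ ≤ D.deg c → c = r ∨ D.A r c := by
    by_cases h : ∃ c < D.n, Y c ∧ ¬D.S c ∧ θ ≤ D.deg c
    · obtain ⟨r, hr, hrY, hS, hd⟩ := h
      refine ⟨r, hr, fun _ => hrY, fun c hc _ hS' hd' => ?_⟩
      by_cases he : c = r
      · exact .inl he
      · exact .inr (hC r hr c hc hS hS' hd hd' (Ne.symm he))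
    · have h' : ∀ c < D.n, Y c → ¬D.S c → ¬θ ≤ D.deg c := fun c hc hY hS hd =>
        h ⟨c, hc, hY, hS, hd⟩
      by_cases h'' : ∃ c < D.n, Y c
      · obtain ⟨r, hr, hrY⟩ := h''
        exact ⟨r, hr, fun _ => hrY, fun c hc hY hS hd => absurd hd (h' c hc hY hS)⟩
      · exact ⟨v, hv, fun h => absurd h h'', fun c hc hY hS hd => absurd hd (h' c hc hY hS)⟩
  -- the digits after adding the vertices of `W`
  obtain ⟨δ, hδ⟩ : ∃ δ : Finset ℕ → ℕ → ℕ, ∀ W u, δ W u = if D.S u ∧ u ∈ X then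
    (if D.b = 3 ∧ ∃ w ∈ W, D.A w u then 2 else 1) else 0 := ⟨_, fun _ _ => rfl⟩
  have hδr : ∀ W u, δ W u < D.radix u := fun W u => by
    have := hD.b
    rw [hδ, radix]
    by_cases h1 : D.S u
    · rw [if_pos h1]
      split_ifs <;> omega
    · rw [if_neg h1, if_neg fun h => h1 h.1]
      exact one_pos
  have hcard : (X.filter fun u => ¬Y u).card < D.n := by
    have h1 : (X.filter fun u => ¬Y u).card ≤ X.card :=
      Finset.card_le_card (Finset.filter_subset _ _)
    have h2 : X.card < (Finset.range D.n).card := Finset.card_lt_card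
      ⟨fun u hu => Finset.mem_range.2 (hX.lt u hu), fun h => hvX (h (Finset.mem_range.2 hv))⟩
    rw [Finset.card_range] at h2
    omega
  have hj : ∀ W ⊆ X.filter (fun u => ¬Y u), W.card < D.n := fun W hW =>
    (Finset.card_le_card hW).trans_lt hcard
  have hd : ∀ W ⊆ X.filter (fun u => ¬Y u), ∀ u < D.n,
      D.digit (D.code W.card r v θ (δ W)) u = δ W u := fun W hW u hu =>
    code_digit (hj W hW) hr hv hθ (fun u _ => hδr W u) hu
  have hex : ∀ W ⊆ X.filter (fun u => ¬Y u), ∀ u < D.n,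
      (D.Excluded (D.code W.card r v θ (δ W)) u ↔ E u) := fun W hW u hu => by
    rw [Excluded, hd W hW u hu, code_div_div (hj W hW) hr, Nat.add_mul_mod_self_left,
      Nat.mod_eq_of_lt hv, hE, hδ]
    refine or_congr_left (and_congr_right fun hS => ?_)
    by_cases huX : u ∈ X
    · rw [if_pos ⟨hS, huX⟩]
      split_ifs <;> simp [huX]
    · simp [huX]
  have hcore : ∀ W ⊆ X.filter (fun u => ¬Y u), ∀ u < D.n,
      (D.Core (D.code W.card r v θ (δ W)) u ↔ Y u) := fun W hW u hu => by
    have h1 : (∃ x < D.n, D.Excluded (D.code W.card r v θ (δ W)) x ∧ D.A x u) ↔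
        ∃ x < D.n, E x ∧ D.A x u :=
      exists_congr fun x => and_congr_right fun hx => by rw [hex W hW x hx]
    rw [Core, h1, hex W hW u hu, code_div_div_div (hj W hW) hr hv, Nat.add_mul_mod_self_left,
      Nat.mod_eq_of_lt hθ, hY]
  refine exists_final_of_family hD hX hXl (Q := fun W => D.code W.card r v θ (δ W)) hr hYX hYcov
    hrY hcard (fun W hW => code_lt (hj W hW) hr hv hθ fun u _ => hδr W u)
    (fun W hW => code_mod (hj W hW)) (fun W hW => code_root (hj W hW) hr) hcore
    (fun W hW hrr a ha c hcX hcY hA => ?_) (fun W hW c hcX hcY hcW => ?_) (.init ⟨?_, ?_⟩)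
  · have hcn := hX.lt c hcX
    obtain ⟨haX, haY⟩ := Finset.mem_filter.1 (hW ha)
    have han := hX.lt a haX
    obtain ⟨haS, had⟩ := hout a haY fun h => hEX a h haX
    have hb3 : D.b = 3 := hb.resolve_right fun h => absurd (h a han haS) (by omega)
    by_cases hcS : D.S c
    · refine Reached.le (i := 0) ⟨hcn, (hcore W hW c hcn).2 hcY, .inr ?_⟩ (Nat.zero_le _)
      rw [hd W hW c hcn, hδ, if_pos ⟨hcS, hcX⟩, if_pos ⟨hb3, a, ha, hA⟩]
    · have hcd : θ ≤ D.deg c := by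
        by_contra hcd
        exact hI a han c hcn haS hcS had (by omega) hA
      rcases hrC c hcn hcY hcS hcd with rfl | h
      · exact hrr
      · exact reached_closed hrr h hcn ((hcore W hW c hcn).2 hcY)
  · have hterm : ∀ u < D.n, δ W u + truth (D.S u ∧ D.digit (D.code W.card r v θ (δ W)) u = 1 ∧
        D.A c u) * (D.b - 2) = δ (insert c W) u := by
      intro u hu
      rw [hd W hW u hu, hδ, hδ]
      simp only [Finset.mem_insert, exists_eq_or_imp]
      by_cases h1 : D.S u ∧ u ∈ X
      · rcases hD.b with h2 | h2
        · simp [h1, h2]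
        · by_cases h3 : ∃ w ∈ W, D.A w u <;> by_cases h4 : D.A c u <;>
            simp [h1, h2, h3, h4, truth]
      · simp [h1, truth]
    have hsum : ∑ u ∈ Finset.range D.n, δ (insert c W) u * D.weight u =
        ∑ u ∈ Finset.range D.n, δ W u * D.weight u + ∑ u ∈ Finset.range D.n,
          truth (D.S u ∧ D.digit (D.code W.card r v θ (δ W)) u = 1 ∧ D.A c u) * (D.b - 2) *
            D.weight u := by
      rw [← Finset.sum_add_distrib]
      refine Finset.sum_congr rfl fun u hu => ?_
      rw [← hterm u (Finset.mem_range.1 hu), add_mul]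
    rw [Finset.card_insert_of_notMem hcW, next]
    conv_rhs => rw [code, hsum]
    generalize ∑ u ∈ Finset.range D.n, truth _ * _ * _ = Δ
    rw [code]
    ring
  · exact code_mod (hj ∅ (Finset.empty_subset _))
  · intro u hu
    rw [hd ∅ (Finset.empty_subset _) u hu, hδ]
    simp only [Finset.notMem_empty, false_and, exists_false, and_false, if_false]
    split_ifs <;> omega

end SearchData

/-! ### Instances and their encodings -/

theorem length_le_inputSize (w : List ℕ) : w.length ≤ inputSize w := by
  induction w with
  | nil => simp
  | cons a w ih =>
    simp only [inputSize, List.map_cons, List.sum_cons, List.length_cons, bitCost] at *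
    omega

theorem getD_lt_two_pow (w : List ℕ) (a : ℕ) : w.getD a 0 < 2 ^ inputSize w := by
  induction w generalizing a with
  | nil => simp [inputSize]
  | cons b w ih =>
    have h : inputSize (b :: w) = b.size + 1 + inputSize w := by simp [inputSize, bitCost]
    rw [h]
    cases a with
    | zero =>
      exact (Nat.lt_size_self b).trans_le (Nat.pow_le_pow_right two_pos (by omega))
    | succ a =>
      exact (ih a).trans_le (Nat.pow_le_pow_right two_pos (by omega))

theorem List.getD_ofFn_nat {n : ℕ} (f : Fin n → ℕ) (a : ℕ) :
    (List.ofFn f).getD a 0 = if h : a < n then f ⟨a, h⟩ else 0 := by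
  split_ifs with h
  · rw [List.getD_eq_getElem _ _ (by simpa using h), List.getElem_ofFn]
  · rw [List.getD_eq_default _ _ (by simpa using h)]

theorem List.getD_flatten_ofFn {m n : ℕ} (f : Fin m → Fin n → ℕ) (a : ℕ) :
    ((List.ofFn fun i => List.ofFn fun j => f i j).flatten).getD a 0 =
      if h : a / n < m ∧ 0 < n then f ⟨a / n, h.1⟩ ⟨a % n, Nat.mod_lt _ h.2⟩ else 0 := by
  rcases Nat.eq_zero_or_pos n with rfl | hn
  · simp
  have key := List.ofFn_mul (m := m) (n := n)
    (fun t => f ⟨t.1 / n, (Nat.div_lt_iff_lt_mul hn).2 t.2⟩ ⟨t.1 % n, Nat.mod_lt _ hn⟩)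
  have h2 : (List.ofFn fun i => List.ofFn fun j => f i j) = List.ofFn fun i : Fin m =>
      List.ofFn fun j : Fin n => f ⟨(i.1 * n + j.1) / n, by
        rw [Nat.add_comm, Nat.add_mul_div_right _ _ hn, Nat.div_eq_of_lt j.2, zero_add]
        exact i.2⟩ ⟨(i.1 * n + j.1) % n, Nat.mod_lt _ hn⟩ := by
    congr 1
    funext i
    congr 1
    funext j
    congr 1
    · ext
      simp [Nat.add_comm, Nat.add_mul_div_right _ _ hn, Nat.div_eq_of_lt j.2]
    · ext
      simp [Nat.add_comm, Nat.add_mul_mod_self_right, Nat.mod_eq_of_lt j.2]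
  rw [h2, ← key, List.getD_ofFn_nat]
  have h3 : a < m * n ↔ a / n < m ∧ 0 < n := by
    rw [← Nat.div_lt_iff_lt_mul hn]
    simp [hn]
  split_ifs with h h' h' <;> first | rfl | exact absurd (h3.1 h) h' | exact absurd (h3.2 h') h

namespace CVCInstance

variable (I : CVCInstance)

/-- The vertex with number `u` exists and belongs to `S`. -/
def InS (u : ℕ) : Prop := ∃ h : u < I.n, (⟨u, h⟩ : Fin I.n) ∈ I.S

/-- The vertices with numbers `u` and `w` exist and are adjacent. -/
def Edge (u w : ℕ) : Prop :=
  ∃ (hu : u < I.n) (hw : w < I.n), I.G.Adj ⟨u, hu⟩ ⟨w, hw⟩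

theorem encode_getD (a : ℕ) : I.encode.getD a 0 =
    if a = 0 then I.n else if a = 1 then I.ℓ else if a < 2 + I.n then truth (I.InS (a - 2)) else
      if a < 2 + I.n + I.n * I.n then truth (I.Edge ((a - 2 - I.n) / I.n) ((a - 2 - I.n) % I.n))
      else 0 := by
  rw [encode, List.append_assoc]
  rcases a with _ | _ | a
  · simp
  · simp
  · have h0 : ∀ l : List ℕ, ([I.n, I.ℓ] ++ l).getD (a + 2) 0 = l.getD a 0 := fun l => by
      simp [List.getD]
    rw [if_neg (by omega), if_neg (by omega), h0]
    by_cases h : a < I.n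
    · rw [if_pos (by omega), List.getD_append _ _ _ _ (by simpa using h), List.getD_ofFn_nat,
        dif_pos h]
      simp [truth, InS, h]
    · rw [if_neg (by omega), List.getD_append_right _ _ _ _ (by simpa using h),
        List.getD_flatten_ofFn, List.length_ofFn]
      rw [show a + 1 + 1 - 2 - I.n = a - I.n by omega]
      by_cases h' : a < I.n + I.n * I.n
      · have hn : 0 < I.n := by
          by_contra hn
          rw [Nat.eq_zero_of_not_pos hn] at h'
          omega
        have hd : (a - I.n) / I.n < I.n := (Nat.div_lt_iff_lt_mul hn).2 (by omega)
        rw [if_pos (by omega), dif_pos ⟨hd, hn⟩]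
        have he : I.Edge ((a - I.n) / I.n) ((a - I.n) % I.n) ↔
            I.G.Adj ⟨(a - I.n) / I.n, hd⟩ ⟨(a - I.n) % I.n, Nat.mod_lt _ hn⟩ :=
          ⟨fun ⟨_, _, h⟩ => h, fun h => ⟨_, _, h⟩⟩
        by_cases hA : I.Edge ((a - I.n) / I.n) ((a - I.n) % I.n)
        · rw [truth_eq_one.2 hA, if_pos (he.1 hA)]
        · rw [truth_eq_zero.2 hA, if_neg fun h => hA (he.2 h)]
      · rw [if_neg (by omega), dif_neg]
        rintro ⟨h1, h2⟩
        have := (Nat.div_lt_iff_lt_mul h2).1 h1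
        omega

theorem length_encode : I.encode.length = 2 + I.n + I.n * I.n := by
  simp [encode, List.length_flatten, List.map_ofFn, Function.comp_def]
  omega

/-- The data for the search for a connected vertex cover of the instance. -/
def search (b : ℕ) : SearchData := ⟨I.n, b, I.ℓ, I.InS, I.Edge⟩

variable {I} {b : ℕ}

theorem search_valid (hb : b = 2 ∨ b = 3) : (I.search b).Valid where
  symm := fun _ _ ⟨hu, hw, h⟩ => ⟨hw, hu, h.symm⟩
  irrefl := fun _ ⟨_, _, h⟩ => I.G.irrefl h
  lt := fun _ _ ⟨hu, _, _⟩ => hu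
  b := hb

theorem isCover_iff (X : Finset (Fin I.n)) :
    (I.search b).IsCover (X.map Fin.valEmbedding) ↔
      I.G.IsConnectedVertexCover (X : Set (Fin I.n)) := by
  have mem : ∀ (u : ℕ), u ∈ X.map Fin.valEmbedding ↔ ∃ h : u < I.n, (⟨u, h⟩ : Fin I.n) ∈ X := by
    intro u
    simp only [Finset.mem_map, Fin.valEmbedding_apply]
    exact ⟨fun ⟨x, hx, h⟩ => h ▸ ⟨x.2, hx⟩, fun ⟨h, hx⟩ => ⟨_, hx, rfl⟩⟩
  constructor
  · intro h
    refine ⟨fun u w huw => ?_, ?_⟩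
    · have := h.cover u w ⟨u.2, w.2, huw⟩
      rw [mem, mem] at this
      exact this.imp (fun h => h.2) fun h => h.2
    · obtain ⟨r, hr, hcon⟩ := h.connected
      obtain ⟨hrn, hrX⟩ := (mem r).1 hr
      rw [SimpleGraph.connected_iff_exists_forall_reachable]
      refine ⟨⟨⟨r, hrn⟩, hrX⟩, fun ⟨⟨u, hu⟩, huX⟩ => ?_⟩
      have key : ∀ u, Relation.ReflTransGen (fun x y => (I.search b).A x y ∧
          y ∈ X.map Fin.valEmbedding) r u → ∃ (hu : u < I.n) (hX : (⟨u, hu⟩ : Fin I.n) ∈ X),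
          (I.G.induce (X : Set (Fin I.n))).Reachable ⟨⟨r, hrn⟩, hrX⟩ ⟨⟨u, hu⟩, hX⟩ := by
        intro u hu
        induction hu with
        | refl => exact ⟨hrn, hrX, .refl _⟩
        | @tail x y _ hxy ih =>
          obtain ⟨hx, hxX, hreach⟩ := ih
          obtain ⟨⟨_, hyn, hA⟩, hy⟩ := hxy
          obtain ⟨_, hyX⟩ := (mem y).1 hy
          refine ⟨hyn, hyX, hreach.trans (SimpleGraph.Adj.reachable ?_)⟩
          exact hA
      exact (key u (hcon u ((mem u).2 ⟨hu, huX⟩))).2.2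
  · rintro ⟨hcov, hcon⟩
    refine ⟨fun u hu => ((mem u).1 hu).1, fun u w ⟨hu, hw, hA⟩ => ?_, ?_⟩
    · rw [mem, mem]
      exact (hcov hA).imp (fun h => ⟨hu, h⟩) fun h => ⟨hw, h⟩
    · obtain ⟨⟨r, hrX⟩, hr⟩ := SimpleGraph.connected_iff_exists_forall_reachable _ |>.1 hcon
      refine ⟨r, (mem r).2 ⟨r.2, hrX⟩, fun u hu => ?_⟩
      obtain ⟨hun, huX⟩ := (mem u).1 hu
      have := (SimpleGraph.reachable_iff_reflTransGen _ _).1 (hr ⟨⟨u, hun⟩, huX⟩)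
      exact Relation.ReflTransGen.lift
        (p := fun x y => (I.search b).A x y ∧ y ∈ X.map Fin.valEmbedding)
        (fun x : (X : Set (Fin I.n)) => (x.1 : ℕ))
        (fun x y hxy => ⟨⟨x.1.2, y.1.2, hxy⟩, (mem _).2 ⟨y.1.2, y.2⟩⟩) _ _ this

theorem hasSmallCVC_iff (b : ℕ) :
    I.HasSmallCVC ↔ ∃ X, (I.search b).IsCover X ∧ X.card ≤ I.ℓ := by
  constructor
  · rintro ⟨X, hX, hc⟩
    exact ⟨_, (isCover_iff X).2 hX, (Finset.card_map _).trans_le hc⟩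
  · rintro ⟨X, hX, hc⟩
    have hmap : (Finset.univ.filter fun u : Fin I.n => (u : ℕ) ∈ X).map Fin.valEmbedding = X := by
      ext u
      simp only [Finset.mem_map, Finset.mem_filter, Finset.mem_univ, true_and,
        Fin.valEmbedding_apply]
      exact ⟨fun ⟨x, hx, h⟩ => h ▸ hx, fun h => ⟨⟨u, hX.lt u h⟩, h, rfl⟩⟩
    rw [← hmap] at hX hc
    rw [Finset.card_map] at hc
    exact ⟨_, (isCover_iff _).1 hX, hc⟩

/-- A graph with at least two vertices that has a connected vertex cover of some size has one of at
most this size that misses a vertex: the complement of a non-cut vertex, if necessary. -/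
theorem exists_proper_cover (hn : 2 ≤ I.n) {X : Finset (Fin I.n)}
    (hX : I.G.IsConnectedVertexCover (X : Set (Fin I.n))) :
    ∃ X' : Finset (Fin I.n), I.G.IsConnectedVertexCover (X' : Set (Fin I.n)) ∧
      X'.card ≤ X.card ∧ ∃ v, v ∉ X' := by
  by_cases h : ∃ v, v ∉ X
  · exact ⟨X, hX, le_rfl, h⟩
  push Not at h
  have hXu : X = Finset.univ := Finset.eq_univ_iff_forall.2 h
  subst hXu
  have : Nontrivial (Fin I.n) := Fin.nontrivial_iff_two_le.2 hn
  have hcon : I.G.Connected := by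
    have := hX.2
    rw [Finset.coe_univ] at this
    exact (SimpleGraph.Iso.connected_iff (SimpleGraph.induceUnivIso I.G)).1 this
  obtain ⟨v, hv⟩ := hcon.exists_connected_induce_compl_singleton_of_finite_nontrivial
  refine ⟨Finset.univ.erase v, ⟨fun u w huw => ?_, ?_⟩,
    Finset.card_le_card (Finset.erase_subset _ _), v, Finset.notMem_erase _ _⟩
  · by_contra hcon
    simp only [Finset.coe_erase, Finset.coe_univ, Set.mem_sdiff, Set.mem_univ, true_and,
      Set.mem_singleton_iff, not_or, not_not] at hcon
    exact huw.ne (hcon.1.trans hcon.2.symm)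
  · have : ((Finset.univ.erase v : Finset (Fin I.n)) : Set (Fin I.n)) = {v}ᶜ := by
      ext x; simp
    rw [this]
    exact hv

theorem search_correct (hb : b = 2 ∨ b = 3) (hl : 0 < I.ℓ)
    (hθ : 0 < I.n → ∃ θ < I.n, (∀ u < I.n, ∀ w < I.n, ¬I.InS u → ¬I.InS w →
      θ ≤ (I.search b).deg u → θ ≤ (I.search b).deg w → u ≠ w → I.Edge u w) ∧
      (∀ u < I.n, ∀ w < I.n, ¬I.InS u → ¬I.InS w → (I.search b).deg u < θ →
        (I.search b).deg w < θ → ¬I.Edge u w) ∧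
      (b = 3 ∨ ∀ u < I.n, ¬I.InS u → θ ≤ (I.search b).deg u)) :
    (∃ q < (I.search b).stateCount, (I.search b).Reach q ∧ (I.search b).Final q) ↔
      I.HasSmallCVC := by
  have hD := search_valid (I := I) hb
  rcases Nat.eq_zero_or_pos I.n with h0 | hn
  · have h1 : (I.search b).stateCount = 0 := by simp [SearchData.stateCount, search, h0]
    rw [h1]
    refine ⟨fun ⟨q, hq, _⟩ => absurd hq (Nat.not_lt_zero q), fun ⟨X, hX, _⟩ => ?_⟩
    obtain ⟨x⟩ := hX.2.nonempty
    exact absurd x.1.2 (by omega)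
  constructor
  · rintro ⟨q, -, hr, hf⟩
    exact (hasSmallCVC_iff b).2 (SearchData.exists_cover_of_final hD hn hl hr hf)
  · rintro ⟨X, hX, hc⟩
    obtain ⟨θ, h1, h2, h3, h4⟩ := hθ hn
    by_cases hn2 : 2 ≤ I.n
    · obtain ⟨X, hX, hc', v, hv⟩ := exists_proper_cover hn2 hX
      exact SearchData.exists_final hD h1 h2 h3 h4 ((isCover_iff X).2 hX)
        (by rw [Finset.card_map]; exact hc'.trans hc) ⟨v, v.2, fun h => hv <| by
          obtain ⟨x, hx, hxv⟩ := Finset.mem_map.1 h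
          exact Fin.ext hxv ▸ hx⟩
    · -- a single vertex: the core of the state `0` is empty
      have h1 : I.n = 1 := by omega
      have hnA : ∀ u w, ¬I.Edge u w := fun u w ⟨hu, hw, h⟩ =>
        h.ne (Fin.ext (by simp only; omega))
      have hdig : ∀ u, (I.search b).digit 0 u = 0 := fun u => by simp [SearchData.digit]
      have hcore : ∀ u < I.n, ¬(I.search b).Core 0 u := fun u hu h => by
        rcases h with ⟨x, _, _, h⟩ | ⟨_, h⟩
        · exact hnA _ _ h
        · refine h (.inr ?_)
          simp
          omega
      refine ⟨0, ?_, .init ⟨Nat.zero_mod _, fun u _ => by rw [hdig]; omega⟩,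
        fun u hu h => absurd h (hcore u hu), fun u _ w _ h => absurd h (hnA u w), ?_⟩
      · refine Nat.mul_pos ?_ (Finset.prod_pos fun x _ => ?_)
        · change 0 < I.n * I.n * I.n * I.n
          simp [h1]
        · exact (Nat.zero_le _).trans_lt (SearchData.digit_lt hD 0 x)
      · have : ∑ u ∈ Finset.range (I.search b).n, truth ((I.search b).Core 0 u) = 0 :=
          Finset.sum_eq_zero fun u hu => truth_eq_zero.2 (hcore u (Finset.mem_range.1 hu))
        rw [this, Nat.zero_mod]
        exact Nat.zero_le _

theorem search_correct_of_isSplitDeletionSet (hl : 0 < I.ℓ)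
    (hS : I.G.IsSplitDeletionSet (I.S : Set (Fin I.n))) :
    (∃ q < (I.search 3).stateCount, (I.search 3).Reach q ∧ (I.search 3).Final q) ↔
      I.HasSmallCVC := by
  refine search_correct (.inr rfl) hl fun hn => ?_
  obtain ⟨C, hC, hI⟩ := hS
  have hnS : ∀ u (h : u < I.n), ¬I.InS u → (⟨u, h⟩ : Fin I.n) ∈ ((I.S : Set (Fin I.n))ᶜ) :=
    fun u h hu hS => hu ⟨h, hS⟩
  obtain ⟨θ, h1, h2, h3⟩ := SearchData.exists_threshold (D := I.search 3)
    (search_valid (.inr rfl)) hn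
    (P := fun u => ∃ (h : u < I.n) (h' : ¬I.InS u),
      (⟨⟨u, h⟩, hnS u h h'⟩ : ((I.S : Set (Fin I.n))ᶜ : Set _)) ∈ C)
    (fun u hu w hw huS hwS ⟨_, _, hu'⟩ ⟨_, _, hw'⟩ hne => ⟨hu, hw, hC hu' hw' fun h => hne (by
      simpa using h)⟩)
    (fun u hu w hw huS hwS hu' hw' ⟨_, _, hA⟩ => hI
      (x := ⟨⟨u, hu⟩, hnS u hu huS⟩) (fun h => hu' ⟨hu, huS, h⟩)
      (y := ⟨⟨w, hw⟩, hnS w hw hwS⟩) (fun h => hw' ⟨hw, hwS, h⟩)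
      (fun h => hA.ne (congrArg Subtype.val h)) hA)
  exact ⟨θ, h1, h2, h3, .inl rfl⟩

theorem search_correct_of_isCliqueDeletionSet (hl : 0 < I.ℓ)
    (hS : I.G.IsCliqueDeletionSet (I.S : Set (Fin I.n))) :
    (∃ q < (I.search 2).stateCount, (I.search 2).Reach q ∧ (I.search 2).Final q) ↔
      I.HasSmallCVC := by
  refine search_correct (.inl rfl) hl fun hn => ⟨0, hn, fun u hu w hw huS hwS _ _ hne => ?_,
    fun u _ w _ _ _ h => absurd h (Nat.not_lt_zero _), .inr fun _ _ _ => Nat.zero_le _⟩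
  refine ⟨hu, hw, hS (x := ⟨⟨u, hu⟩, fun h => huS ⟨hu, h⟩⟩) trivial
    (y := ⟨⟨w, hw⟩, fun h => hwS ⟨hw, h⟩⟩) trivial fun h => hne ?_⟩
  simpa using h

open Classical in
theorem stateCount_search : (I.search b).stateCount = I.n * I.n * I.n * I.n * b ^ I.S.card := by
  have : ∏ x ∈ Finset.range I.n, (I.search b).radix x = b ^ I.S.card := by
    rw [← Fin.prod_univ_eq_prod_range]
    have : ∀ i : Fin I.n, (I.search b).radix i = if i ∈ I.S then b else 1 := fun i => by
      have : I.InS i ↔ i ∈ I.S := ⟨fun h => h.2, fun h => ⟨i.2, h⟩⟩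
      simp only [SearchData.radix, search, this]
    simp only [this]
    rw [Finset.prod_ite_mem, Finset.univ_inter, Finset.prod_const]
  rw [SearchData.stateCount]
  exact congrArg _ this

end CVCInstance

/-! ### The search on a random access machine -/

theorem truth_lt_two (p : Prop) : truth p < 2 := Nat.lt_succ_of_le (truth_le_one p)

/-- The digits of a sum of distinct powers of two. -/
theorem sum_truth_mul_two_pow_div_mod {n : ℕ} (p : ℕ → Prop) {u : ℕ} (hu : u < n) :
    (∑ x ∈ Finset.range n, truth (p x) * 2 ^ x) / 2 ^ u % 2 = truth (p u) := by
  have := digit_add_sum (n := n) (β := fun _ => 2) (e := fun x => truth (p x)) (X := 0)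
    (fun v _ => by simpa using truth_lt_two (p v)) hu
  simpa using this

theorem sum_truth_mul_two_pow_lt (n : ℕ) (p : ℕ → Prop) :
    ∑ x ∈ Finset.range n, truth (p x) * 2 ^ x < 2 ^ n := by
  have := sum_digits_lt (n := n) (β := fun _ => 2) (e := fun x => truth (p x))
    (fun v _ => truth_lt_two (p v))
  simpa using this

/-- The data of the search as they are found in a state of the machine, with the number of vertices
in register `0` and the encoding of the instance in the memory. -/
def searchAt (b : ℕ) (s : RamState) : SearchData :=
  ⟨s.reg 0, b, s.mem 1, fun u => u < s.reg 0 ∧ s.mem (2 + u) = 1,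
    fun u w => u < s.reg 0 ∧ w < s.reg 0 ∧ s.mem (2 + s.reg 0 + (u * s.reg 0 + w)) = 1⟩

section Evaluable

variable {b d : ℕ} {f q u w : RamState → ℕ}

theorem Evaluable.size (d b : ℕ) : Evaluable d fun s => (searchAt b s).n := reg (Nat.zero_le d)

theorem Evaluable.pow_min (c : ℕ) (hu : Evaluable d u) :
    Evaluable d fun s => c ^ min (u s) (s.reg 0) := by
  have h : Evaluable d fun s => ∏ x ∈ Finset.range (s.reg 0), if x < u s then c else 1 :=
    prod (f := fun s x => if x < u s then c else 1) fun d' hd v hv =>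
      (Checkable.lt hv (hu.mono hd)).ite (const d' c) (const d' 1)
  refine (funext fun s => ?_ : _ = fun s => c ^ min (u s) (s.reg 0)) ▸ h
  rw [Finset.prod_ite, Finset.prod_const, Finset.prod_const_one, mul_one]
  congr 1
  rw [show (Finset.range (s.reg 0)).filter (fun x => x < u s) =
    Finset.range (min (u s) (s.reg 0)) by ext; simp [and_comm], Finset.card_range]

theorem checkable_S (hu : Evaluable d u) : Checkable d fun s => (searchAt b s).S (u s) :=
  (Checkable.lt hu (.reg (Nat.zero_le d))).and
    (Checkable.eq ((Evaluable.const d 2).add hu).mem (.const d 1))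

theorem checkable_A (hu : Evaluable d u) (hw : Evaluable d w) :
    Checkable d fun s => (searchAt b s).A (u s) (w s) :=
  have hn : Evaluable d fun s => s.reg 0 := .reg (Nat.zero_le d)
  (Checkable.lt hu hn).and ((Checkable.lt hw hn).and
    (Checkable.eq (((Evaluable.const d 2).add hn).add ((hu.mul hn).add hw)).mem (.const d 1)))

theorem evaluable_radix (hu : Evaluable d u) : Evaluable d fun s => (searchAt b s).radix (u s) := by
  classical
  exact (checkable_S hu).ite (.const d b) (.const d 1)

theorem evaluable_weight (hu : Evaluable d u) :
    Evaluable d fun s => (searchAt b s).weight (u s) := by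
  have h : Evaluable d fun s => ∏ x ∈ Finset.range (s.reg 0),
      if x < u s then (searchAt b s).radix x else 1 :=
    Evaluable.prod (f := fun s x => if x < u s then (searchAt b s).radix x else 1)
      fun d' hd v hv => (Checkable.lt hv (hu.mono hd)).ite (evaluable_radix hv) (.const d' 1)
  refine (funext fun s => ?_ : _ = fun s => (searchAt b s).weight (u s)) ▸ h
  rw [Finset.prod_ite, Finset.prod_const_one, mul_one]
  refine Finset.prod_subset (fun x hx => ?_) fun x hx hx' => ?_
  · simp only [Finset.mem_filter] at hx
    exact Finset.mem_range.2 hx.2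
  · have : ¬(searchAt b s).S x := fun h => hx' (Finset.mem_filter.2
      ⟨Finset.mem_range.2 h.1, Finset.mem_range.1 hx⟩)
    rw [SearchData.radix, if_neg this]

theorem evaluable_digit (hq : Evaluable d q) (hu : Evaluable d u) :
    Evaluable d fun s => (searchAt b s).digit (q s) (u s) :=
  have hn := Evaluable.size d b
  ((hq.div (((hn.mul hn).mul hn).mul hn)).div (evaluable_weight hu)).mod (evaluable_radix hu)

theorem evaluable_root (hq : Evaluable d q) : Evaluable d fun s => (searchAt b s).root (q s) :=
  (hq.div (.size d b)).mod (.size d b)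

theorem checkable_excluded (hq : Evaluable d q) (hu : Evaluable d u) :
    Checkable d fun s => (searchAt b s).Excluded (q s) (u s) :=
  have hn := Evaluable.size d b
  ((checkable_S hu).and (Checkable.eq (evaluable_digit hq hu) (.const d 0))).or
    (Checkable.eq hu (((hq.div hn).div hn).mod hn))

theorem evaluable_deg (hu : Evaluable d u) : Evaluable d fun s => (searchAt b s).deg (u s) :=
  Evaluable.sum (f := fun s x => truth (¬(searchAt b s).S x ∧ (searchAt b s).A (u s) x))
    fun _ hd _ hv => (checkable_S hv).not.and (checkable_A (hu.mono hd) hv)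

theorem checkable_core (hq : Evaluable d q) (hu : Evaluable d u) :
    Checkable d fun s => (searchAt b s).Core (q s) (u s) :=
  have hn := Evaluable.size d b
  (Checkable.ex (p := fun s x => (searchAt b s).Excluded (q s) x ∧ (searchAt b s).A x (u s))
    fun _ hd _ hv => (checkable_excluded (hq.mono hd) hv).and (checkable_A hv (hu.mono hd))).or
    (((checkable_S hu).or (Checkable.le ((((hq.div hn).div hn).div hn).mod hn)
      (evaluable_deg hu))).and (checkable_excluded hq hu).not)

theorem checkable_seed (hq : Evaluable d q) (hu : Evaluable d u) :
    Checkable d fun s => (searchAt b s).Seed (q s) (u s) :=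
  (checkable_core hq hu).and ((Checkable.eq hu (evaluable_root hq)).or
    (Checkable.eq (evaluable_digit hq hu) (.const d 2)))

/-- The vertices reached after `i` rounds are represented by the binary digits of a number. The
minimum in the exponents is vacuous and makes this a polynomial time operation for all arguments. -/
theorem checkable_reached (hq : Evaluable d q) (hu : Evaluable d u) :
    Checkable d fun s => (searchAt b s).Reached (q s) (searchAt b s).n (u s) := by
  let bit : RamState → ℕ → ℕ → Prop := fun s c u => c / 2 ^ min u (s.reg 0) % 2 = 1
  let start : RamState → ℕ := fun s => ∑ u ∈ Finset.range (s.reg 0),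
    truth ((searchAt b s).Seed (q s) u) * 2 ^ min u (s.reg 0)
  let round : RamState → ℕ → ℕ → ℕ := fun s _ c => ∑ u ∈ Finset.range (s.reg 0),
    truth ((searchAt b s).Core (q s) u ∧
      (bit s c u ∨ ∃ x < s.reg 0, bit s c x ∧ (searchAt b s).A x u)) * 2 ^ min u (s.reg 0)
  have hmin : ∀ (s : RamState) (p : ℕ → Prop),
      ∑ u ∈ Finset.range (s.reg 0), truth (p u) * 2 ^ min u (s.reg 0) =
        ∑ u ∈ Finset.range (s.reg 0), truth (p u) * 2 ^ u := fun s p =>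
    Finset.sum_congr rfl fun u hu => by rw [min_eq_left (Finset.mem_range.1 hu).le]
  have hbit : ∀ {d' : ℕ} {c v : RamState → ℕ}, Evaluable d' c → Evaluable d' v →
      Checkable d' fun s => bit s (c s) (v s) := fun hc hv =>
    Checkable.eq ((hc.div (.pow_min 2 hv)).mod (.const _ 2)) (.const _ 1)
  have hstart : Evaluable d start := Evaluable.sum
    (f := fun s u => truth ((searchAt b s).Seed (q s) u) * 2 ^ min u (s.reg 0))
    fun _ hd _ hv => Evaluable.mul (checkable_seed (hq.mono hd) hv) (.pow_min 2 hv)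
  have hround : Evaluable.Fun₂ d round := fun d' hd i c _ hc => Evaluable.sum
    (f := fun s u => truth ((searchAt b s).Core (q s) u ∧
      (bit s (c s) u ∨ ∃ x < s.reg 0, bit s (c s) x ∧ (searchAt b s).A x u)) * 2 ^ min u (s.reg 0))
    fun d'' hd' v hv => Evaluable.mul ((checkable_core ((hq.mono hd).mono hd') hv).and
      ((hbit (hc.mono hd') hv).or (Checkable.ex
        (p := fun s x => bit s (c s) x ∧ (searchAt b s).A x (v s)) fun d3 hd3 x hx =>
        (hbit ((hc.mono hd').mono hd3) hx).and (checkable_A hx (hv.mono hd3))))) (.pow_min 2 hv)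
  have hval : ∀ s i, ∃ p : ℕ → Prop, Evaluable.iterate (start s) (round s) i =
      ∑ u ∈ Finset.range (s.reg 0), truth (p u) * 2 ^ u := fun s i => by
    cases i with
    | zero => exact ⟨_, hmin s _⟩
    | succ i => exact ⟨_, hmin s _⟩
  have hiter : ∀ s i, ∀ u < s.reg 0, (bit s (Evaluable.iterate (start s) (round s) i) u ↔
      (searchAt b s).Reached (q s) i u) := fun s i => by
    induction i with
    | zero =>
      intro u hu
      show (∑ u ∈ Finset.range (s.reg 0), truth _ * 2 ^ min u (s.reg 0)) / 2 ^ min u (s.reg 0) % 2 = 1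
        ↔ _
      rw [hmin, min_eq_left hu.le, sum_truth_mul_two_pow_div_mod _ hu, truth_eq_one]
      exact (and_iff_right hu).symm
    | succ i ih =>
      intro u hu
      show (∑ u ∈ Finset.range (s.reg 0), truth _ * 2 ^ min u (s.reg 0)) / 2 ^ min u (s.reg 0) % 2 = 1
        ↔ _
      rw [hmin, min_eq_left hu.le, sum_truth_mul_two_pow_div_mod _ hu, truth_eq_one, ih u hu]
      have : (∃ x < s.reg 0, bit s (Evaluable.iterate (start s) (round s) i) x ∧
          (searchAt b s).A x u) ↔ ∃ x < s.reg 0, (searchAt b s).Reached (q s) i x ∧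
          (searchAt b s).A x u :=
        exists_congr fun x => and_congr_right fun hx => by rw [ih x hx]
      rw [this]
      exact (and_iff_right hu).symm
  have h := (Checkable.lt hu (.reg (Nat.zero_le d))).and (hbit (Evaluable.iter hstart hround
    ⟨.X, fun s B hs i _ => by
      obtain ⟨p, hp⟩ := hval s i
      rw [hp]
      exact (sum_truth_mul_two_pow_lt _ p).trans_le (by
        simpa using Nat.pow_le_pow_right two_pos hs.bound)⟩) hu)
  refine (funext fun s => propext ?_ : _ = fun s =>
    (searchAt b s).Reached (q s) (searchAt b s).n (u s)) ▸ h
  constructor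
  · rintro ⟨h1, h2⟩
    exact (hiter s _ _ h1).1 h2
  · intro h
    exact ⟨h.lt, (hiter s _ _ h.lt).2 h⟩

theorem checkable_final (hq : Evaluable d q) :
    Checkable d fun s => (searchAt b s).Final (q s) :=
  (Checkable.all (p := fun s u => (searchAt b s).Core (q s) u →
      (searchAt b s).Reached (q s) (searchAt b s).n u) fun _ hd _ hv =>
    (checkable_core (hq.mono hd) hv).imp (checkable_reached (hq.mono hd) hv)).and
  ((Checkable.all (p := fun s u => ∀ w < s.reg 0, (searchAt b s).A u w →
      (searchAt b s).Core (q s) u ∨ (searchAt b s).Core (q s) w) fun _ hd v hv =>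
    Checkable.all (p := fun s w => (searchAt b s).A (v s) w →
      (searchAt b s).Core (q s) (v s) ∨ (searchAt b s).Core (q s) w) fun _ hd' _ hw =>
    (checkable_A (hv.mono hd') hw).imp ((checkable_core ((hq.mono hd).mono hd') (hv.mono hd')).or
      (checkable_core ((hq.mono hd).mono hd') hw))).and
  (Checkable.le ((Evaluable.sum (f := fun s u => truth ((searchAt b s).Core (q s) u))
    fun _ hd _ hv => checkable_core (hq.mono hd) hv).add (hq.mod (.size d b)))
    (Evaluable.const d 1).mem))

theorem checkable_init (hq : Evaluable d q) : Checkable d fun s => (searchAt b s).Init (q s) :=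
  (Checkable.eq (hq.mod (.size d b)) (.const d 0)).and
    (Checkable.all (p := fun s u => (searchAt b s).digit (q s) u ≠ 2) fun d' hd _ hv =>
      (Checkable.eq (evaluable_digit (hq.mono hd) hv) (.const d' 2)).not)

theorem checkable_step (hq : Evaluable d q) (hw : Evaluable d w) :
    Checkable d fun s => (searchAt b s).Step (q s) (w s) :=
  (checkable_core hq hw).not.and ((Checkable.ex (p := fun s x =>
      (searchAt b s).Reached (q s) (searchAt b s).n x ∧ (searchAt b s).A x (w s))
    fun _ hd _ hv => (checkable_reached (hq.mono hd) hv).and (checkable_A hv (hw.mono hd))).and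
    (Checkable.lt ((hq.mod (.size d b)).add (.const d 1)) (.size d b)))

theorem evaluable_next (hq : Evaluable d q) (hw : Evaluable d w) :
    Evaluable d fun s => (searchAt b s).next (q s) (w s) :=
  have hn := Evaluable.size d b
  (hq.add (.const d 1)).add ((((hn.mul hn).mul hn).mul hn).mul (Evaluable.sum
    (f := fun s u => truth ((searchAt b s).S u ∧ (searchAt b s).digit (q s) u = 1 ∧
      (searchAt b s).A (w s) u) * (b - 2) * (searchAt b s).weight u)
    fun d' hd _ hv => Evaluable.mul (Evaluable.mul ((checkable_S hv).and
      ((Checkable.eq (evaluable_digit (hq.mono hd) hv) (.const d' 1)).and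
        (checkable_A (hw.mono hd) hv))) (.const d' (b - 2))) (evaluable_weight hv)))

theorem evaluable_stateCount (d b : ℕ) : Evaluable d fun s => (searchAt b s).stateCount :=
  have hn := Evaluable.size d b
  (((hn.mul hn).mul hn).mul hn).mul
    (Evaluable.prod (f := fun s u => (searchAt b s).radix u) fun _ _ _ hv => evaluable_radix hv)

end Evaluable

namespace CVCInstance

variable {I : CVCInstance} {b : ℕ}

theorem size_le_inputSize : 2 + I.n + I.n * I.n ≤ inputSize I.encode :=
  I.length_encode ▸ length_le_inputSize _

/-- If register `0` holds the number of vertices and the memory agrees with the encoding in the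
first cells, the search data found in the state are those of the instance. -/
theorem searchAt_eq {s : RamState} (h0 : s.reg 0 = I.n)
    (hm : ∀ a < 2 + I.n + I.n * I.n, s.mem a = I.encode.getD a 0) :
    searchAt b s = I.search b := by
  have h1 : s.mem 1 = I.ℓ := by
    rcases Nat.eq_zero_or_pos I.n with h | h
    · rw [hm 1 (by omega), encode_getD]; simp
    · rw [hm 1 (by omega), encode_getD]; simp
  have hS : (fun u => u < I.n ∧ s.mem (2 + u) = 1) = I.InS := by
    funext u
    refine propext ⟨fun ⟨hu, h⟩ => ?_, fun h => ⟨h.1, ?_⟩⟩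
    · rw [hm _ (by omega), encode_getD, if_neg (by omega), if_neg (by omega), if_pos (by omega),
        truth_eq_one, Nat.add_sub_cancel_left] at h
      exact h
    · have hu := h.1
      rw [hm _ (by omega), encode_getD, if_neg (by omega), if_neg (by omega), if_pos (by omega),
        truth_eq_one, Nat.add_sub_cancel_left]
      exact h
  have hA : (fun u w => u < I.n ∧ w < I.n ∧ s.mem (2 + I.n + (u * I.n + w)) = 1) = I.Edge := by
    have key : ∀ u w, u < I.n → w < I.n → (s.mem (2 + I.n + (u * I.n + w)) = 1 ↔ I.Edge u w) := by
      intro u w hu hw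
      have h2 : u * I.n + w < I.n * I.n := by
        have : (u + 1) * I.n ≤ I.n * I.n := Nat.mul_le_mul_right _ hu
        rw [add_mul, one_mul] at this
        omega
      rw [hm _ (by omega), encode_getD, if_neg (by omega), if_neg (by omega), if_neg (by omega),
        if_pos (by omega), truth_eq_one, show 2 + I.n + (u * I.n + w) - 2 - I.n = w + u * I.n by omega,
        Nat.add_mul_div_right _ _ (by omega), Nat.div_eq_of_lt hw, zero_add,
        Nat.add_mul_mod_self_right, Nat.mod_eq_of_lt hw]
    funext u w
    exact propext ⟨fun ⟨hu, hw, h⟩ => (key u w hu hw).1 h, fun ⟨hu, hw, h⟩ =>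
      ⟨hu, hw, (key u w hu hw).2 ⟨hu, hw, h⟩⟩⟩
  rw [searchAt, search, h0, h1, hS, hA]

/-- The state `q` has been entered in the table after `z` rounds of the search, where round `z`
treats the step of the state `z / n` to the vertex `z % n`. -/
def Marked (I : CVCInstance) (b z q : ℕ) : Prop :=
  ∃ y < z, (I.search b).Reach (y / I.n) ∧ (I.search b).Step (y / I.n) (y % I.n) ∧
    (I.search b).next (y / I.n) (y % I.n) = q

open Classical in
/-- The memory after `z` rounds of the search: the encoding of the instance, and the table. -/
noncomputable def table (I : CVCInstance) (b z : ℕ) : ℕ → ℕ := fun a =>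
  if a < 2 + I.n + I.n * I.n then I.encode.getD a 0
  else truth (I.Marked b z (a - (2 + I.n + I.n * I.n)))

theorem table_input (z : ℕ) {a : ℕ} (ha : a < 2 + I.n + I.n * I.n) :
    I.table b z a = I.encode.getD a 0 := if_pos ha

theorem table_mark (z q : ℕ) :
    I.table b z (2 + I.n + I.n * I.n + q) = truth (I.Marked b z q) := by
  rw [table, if_neg (by omega), Nat.add_sub_cancel_left]

/-- When a state is treated, the table decides whether it is reached, as steps go to larger
states. -/
theorem reach_iff (hn : 0 < I.n) (z : ℕ) : (I.search b).Reach (z / I.n) ↔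
    (I.search b).Init (z / I.n) ∨ I.Marked b z (z / I.n) := by
  constructor
  · intro h
    generalize hq : z / I.n = q at h
    cases h with
    | init h => exact .inl h
    | @step q w hr hw hs =>
      right
      have hq' : q < z / I.n := hq ▸ SearchData.lt_next
      have hw' : w < I.n := hw
      have hd : (w + q * I.n) / I.n = q := by
        rw [Nat.add_mul_div_right _ _ hn, Nat.div_eq_of_lt hw', zero_add]
      have hm : (w + q * I.n) % I.n = w := by
        rw [Nat.add_mul_mod_self_right, Nat.mod_eq_of_lt hw']
      refine ⟨w + q * I.n, ?_, by rw [hd]; exact hr, by rw [hd, hm]; exact hs, by rw [hd, hm]⟩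
      have h1 : (q + 1) * I.n ≤ z / I.n * I.n := Nat.mul_le_mul_right _ hq'
      have h2 := Nat.div_mul_le_self z I.n
      rw [add_mul, one_mul] at h1
      omega
  · rintro (h | ⟨y, -, hr, hs, h⟩)
    · exact .init h
    · rw [← h]
      exact hr.step (Nat.mod_lt _ hn) hs

theorem marked_succ (z q : ℕ) : I.Marked b (z + 1) q ↔ I.Marked b z q ∨
    ((I.search b).Reach (z / I.n) ∧ (I.search b).Step (z / I.n) (z % I.n)) ∧
      (I.search b).next (z / I.n) (z % I.n) = q := by
  constructor
  · rintro ⟨y, hy, h⟩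
    rcases Nat.lt_succ_iff_lt_or_eq.1 hy with hy | rfl
    · exact .inl ⟨y, hy, h⟩
    · exact .inr ⟨⟨h.1, h.2.1⟩, h.2.2⟩
  · rintro (⟨y, hy, h⟩ | h)
    · exact ⟨y, by omega, h⟩
    · exact ⟨z, by omega, h.1.1, h.1.2, h.2⟩

end CVCInstance

/-- The search runs on a random access machine, and decides whether a final state is reached, with
`b ^ |S|` times polynomially many rounds, each of polynomial time. -/
theorem exists_search_program {b : ℕ} (hb : b = 2 ∨ b = 3) :
    ∃ (P : RamProg) (p : Polynomial ℕ), ∀ I : CVCInstance,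
      ∃ (t : ℕ) (s : RamState), RamExec P (RamState.init I.encode) t s ∧
        t ≤ b ^ I.S.card * p.eval (inputSize I.encode) ∧ s.reg 0 =
          truth (∃ q < (I.search b).stateCount, (I.search b).Reach q ∧ (I.search b).Final q) := by
  -- the state and the vertex treated in a round, the table address of a state, and the
  -- condition that a state is reached
  have hsize : Evaluable 3 fun s => s.reg 0 := .reg (by omega)
  have hround : Evaluable 3 fun s => s.reg 1 := .reg (by omega)
  have hq := hround.div hsize
  have hw := hround.mod hsize
  have hL := ((Evaluable.const 3 2).add hsize).add (hsize.mul hsize)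
  have hlive := (checkable_init (b := b) hq).or
    (Checkable.eq ((hL.add hq).mem) (Evaluable.const 3 1))
  have haddr := hL.add (evaluable_next (b := b) hq hw)
  have hval : Evaluable 3 fun s => truth _ := (Checkable.eq haddr.mem (Evaluable.const 3 1)).or
    (hlive.and (checkable_step (b := b) hq hw))
  have hans : Evaluable 3 fun s => truth _ :=
    (Checkable.eq (Evaluable.reg (d := 3) (i := 2) (by omega)) (Evaluable.const 3 1)).or
      (hlive.and (checkable_final (b := b) hq))
  obtain ⟨P, p, hP⟩ := exists_loop haddr hval hans
  obtain ⟨Q, c, hQ⟩ := ((evaluable_stateCount 3 b).mul hsize).exec 3 le_rfl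
  -- a bound on the number of bits
  set B : Polynomial ℕ := Polynomial.C 7 * .X + Polynomial.C 1 with hB
  refine ⟨.seq (.const 1 0) (.seq (.load 0 1) (.seq Q (.seq (.const 5 1) (.seq (.arith .div 3 4 5)
    (.seq P (.seq (.const 5 1) (.arith .div 0 2 5))))))),
    Polynomial.C 20 + Polynomial.C 4 * B + c.comp B + (.X ^ 5 + Polynomial.C 1) * p.comp B,
    fun I => ?_⟩
  set N := inputSize I.encode with hN
  set n := I.n with hn
  set D := I.search b with hD
  have hnN : 2 + n + n * n ≤ N := CVCInstance.size_le_inputSize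
  have hBN : B.eval N = 7 * N + 1 := by simp [hB]
  have h1B : 1 < 2 ^ B.eval N := Nat.one_lt_two_pow (by omega)
  have hNB : N < 2 ^ B.eval N := lt_of_le_of_lt (by omega) (Nat.lt_two_pow_self (n := B.eval N))
  have hM : D.stateCount * n = b ^ I.S.card * n ^ 5 := by
    rw [hD, CVCInstance.stateCount_search]
    ring
  have hMB : D.stateCount * n < 2 ^ B.eval N := by
    have h1 : I.S.card ≤ n := by simpa using Finset.card_le_univ I.S
    have h2 : b ^ I.S.card ≤ (2 ^ n) ^ 2 := by
      calc b ^ I.S.card ≤ 4 ^ I.S.card := Nat.pow_le_pow_left (by omega) _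
        _ ≤ 4 ^ n := Nat.pow_le_pow_right (by omega) h1
        _ = (2 ^ n) ^ 2 := by rw [← pow_mul, mul_comm, pow_mul]; norm_num
    have h3 : n ^ 5 ≤ (2 ^ n) ^ 5 := Nat.pow_le_pow_left Nat.lt_two_pow_self.le _
    rw [hM]
    calc b ^ I.S.card * n ^ 5 ≤ (2 ^ n) ^ 2 * (2 ^ n) ^ 5 := Nat.mul_le_mul h2 h3
      _ = 2 ^ (7 * n) := by ring
      _ < 2 ^ B.eval N := Nat.pow_lt_pow_right one_lt_two (by omega)
  have henc : ∀ a, I.encode.getD a 0 < 2 ^ B.eval N := fun a =>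
    (getD_lt_two_pow _ a).trans_le (Nat.pow_le_pow_right two_pos (by omega))
  have he0 : I.encode.getD 0 0 = n := by rw [I.encode_getD]; simp [hn]
  -- preparation
  set s₀ := RamState.init I.encode with hs₀
  set s₁ := (s₀.setReg 1 0).setReg 0 n with hs₁
  have hs₁m : s₁.mem = fun a => I.encode.getD a 0 := rfl
  have hs₁r : ∀ i, s₁.reg i = if i = 0 then n else 0 := fun i => by
    simp only [hs₁, RamState.setReg_reg]
    split_ifs <;> rfl
  have hs₁B : s₁.Bounded 3 (B.eval N) := by
    refine ⟨?_, fun i _ => ?_, fun a => henc a⟩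
    · rw [hs₁r, if_pos rfl]
      omega
    · rw [hs₁r]
      split_ifs <;> omega
  have hs₁D : searchAt b s₁ = D := CVCInstance.searchAt_eq (by rw [hs₁r, if_pos rfl]) fun a _ => rfl
  obtain ⟨t₂, s₂, e₂, c₂, v₂, g₂⟩ := hQ s₁ _ hs₁B
  rw [hs₁D, hs₁r, if_pos rfl] at v₂
  set s₃ := (s₂.setReg 5 1).setReg 3 (D.stateCount * n) with hs₃
  obtain ⟨t₄, s₄, e₄, c₄, r0, r1, hI⟩ := hP (fun z a m => m = I.table b z ∧
      a = truth (∃ y < z, D.Reach (y / n) ∧ D.Final (y / n))) n (D.stateCount * n) (B.eval N) s₃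
    (by simp [hs₃, g₂.reg 0, hs₁r]) (by simp [hs₃, g₂.reg 1, hs₁r]) (by simp [hs₃])
    (by
      refine ⟨?_, ?_⟩
      · change s₂.mem = _
        rw [g₂.mem, hs₁m]
        funext a
        have hno : ∀ q, ¬I.Marked b 0 q := fun q ⟨y, hy, _⟩ => absurd hy (Nat.not_lt_zero y)
        rw [CVCInstance.table]
        split_ifs with h
        · rfl
        · rw [truth_eq_zero.2 (hno _), List.getD_eq_default]
          rw [CVCInstance.length_encode]
          omega
      · rw [truth_eq_zero.2]
        · simp [hs₃, g₂.reg 2, hs₁r]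
        · rintro ⟨y, hy, _⟩
          exact absurd hy (Nat.not_lt_zero y))
    (by omega) hMB
    (by
      rintro z a m - ⟨rfl, rfl⟩
      refine ⟨(truth_le_one _).trans_lt h1B, fun x => ?_⟩
      rw [CVCInstance.table]
      split_ifs
      · exact henc x
      · exact (truth_le_one _).trans_lt h1B)
    (by
      rintro s h0 hz ⟨hm, ha⟩
      have hnpos : 0 < n := by
        by_contra h
        rw [Nat.eq_zero_of_not_pos h, mul_zero] at hz
        omega
      have hsD : searchAt b s = D := CVCInstance.searchAt_eq h0 fun a ha => by
        rw [hm, CVCInstance.table_input _ ha]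
      simp only [hsD, h0]
      generalize s.reg 1 = z at *
      have hmark : ∀ q, s.mem (2 + n + n * n + q) = 1 ↔ I.Marked b z q := fun q => by
        rw [hm, CVCInstance.table_mark, truth_eq_one]
      have hlive : (D.Init (z / n) ∨ s.mem (2 + n + n * n + z / n) = 1) ↔ D.Reach (z / n) := by
        rw [hmark, CVCInstance.reach_iff hnpos]
      rw [hlive, hmark]
      constructor
      · funext a
        by_cases hax : a = 2 + n + n * n + D.next (z / n) (z % n)
        · rw [hax, Function.update_self, CVCInstance.table_mark]
          congr 1
          rw [CVCInstance.marked_succ]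
          simp [hD, hn]
        · rw [Function.update_of_ne hax, hm, CVCInstance.table, CVCInstance.table]
          split_ifs with h
          · rfl
          · congr 1
            rw [CVCInstance.marked_succ, eq_iff_iff]
            refine (or_iff_left fun h' => hax ?_).symm
            rw [hD, hn, h'.2]
            omega
      · rw [ha, truth_eq_one]
        congr 1
        rw [eq_iff_iff]
        constructor
        · rintro (⟨y, hy, h⟩ | h)
          · exact ⟨y, by omega, h⟩
          · exact ⟨z, by omega, h⟩
        · rintro ⟨y, hy, h⟩
          rcases Nat.lt_succ_iff_lt_or_eq.1 hy with hy | rfl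
          · exact .inl ⟨y, hy, h⟩
          · exact .inr h)
  have hans : s₄.reg 2 = truth (∃ q < D.stateCount, D.Reach q ∧ D.Final q) := by
    rw [hI.2]
    congr 1
    rw [eq_iff_iff]
    constructor
    · rintro ⟨y, hy, h⟩
      have hnpos : 0 < n := by
        by_contra h
        rw [Nat.eq_zero_of_not_pos h, mul_zero] at hy
        omega
      exact ⟨y / n, (Nat.div_lt_iff_lt_mul hnpos).2 hy, h⟩
    · rintro ⟨q, hq, h⟩
      have hnpos : 0 < n := by
        by_contra h
        have : D.stateCount = 0 := by
          rw [hD, SearchData.stateCount]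
          have : D.n * D.n * D.n * D.n = 0 :=
            mul_eq_zero_of_right _ (Nat.eq_zero_of_not_pos h)
          rw [this, zero_mul]
        omega
      refine ⟨q * n, Nat.mul_lt_mul_of_pos_right hq hnpos, ?_⟩
      rw [Nat.mul_div_cancel _ hnpos]
      exact h
  have x1 := RamExec.load 0 1 (s₀.setReg 1 0)
  have hl : (s₀.setReg 1 0).mem ((s₀.setReg 1 0).reg 1) = n := by
    rw [RamState.setReg_mem, RamState.setReg_reg, if_pos rfl]
    exact he0
  rw [hl] at x1
  have x2 := RamExec.arith .div 3 4 5 (s₂.setReg 5 1)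
  have x3 := RamExec.arith .div 0 2 5 (s₄.setReg 5 1)
  simp [RamOp.eval, v₂] at x2 x3
  refine ⟨_, _, .seq (.const _ _ _) (.seq x1 (.seq e₂ (.seq (.const _ _ _) (.seq x2 (.seq e₄
    (.seq (.const _ _ _) x3)))))), ?_, by simpa using hans⟩
  have b1 := bitCost_le (hnN.trans_lt' (by omega : n < 2 + n + n * n) |>.trans hNB)
  have b2 := bitCost_le hMB
  have b3 := bitCost_le (v := s₄.reg 2) (B := 1) (by
    rw [hans]; exact truth_lt_two _)
  have hbk : 1 ≤ b ^ I.S.card := Nat.one_le_pow _ _ (by omega)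
  have h5 : D.stateCount * n + 1 ≤ b ^ I.S.card * (N ^ 5 + 1) := by
    have : n ^ 5 ≤ N ^ 5 := Nat.pow_le_pow_left (by omega) _
    rw [hM, mul_add, mul_one]
    exact Nat.add_le_add (Nat.mul_le_mul_left _ this) hbk
  have h6 : (D.stateCount * n + 1) * p.eval (B.eval N) ≤
      b ^ I.S.card * ((N ^ 5 + 1) * p.eval (B.eval N)) := by
    rw [← mul_assoc]
    exact Nat.mul_le_mul_right _ h5
  have h7 : 20 + 4 * B.eval N + c.eval (B.eval N) ≤
      b ^ I.S.card * (20 + 4 * B.eval N + c.eval (B.eval N)) := Nat.le_mul_of_pos_left _ hbk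
  have h8 : bitCost 1 = 2 := rfl
  have h9 : bitCost 0 = 1 := rfl
  simp only [Polynomial.eval_add, Polynomial.eval_mul, Polynomial.eval_comp, Polynomial.eval_pow,
    Polynomial.eval_X, Polynomial.eval_C]
  rw [mul_add]
  simp only [RamState.setReg_reg, if_true, h8, h9]
  omega

theorem solvable_of_search {Q : CVCInstance → Prop} {b : ℕ} (hb : b = 2 ∨ b = 3)
    (h : ∀ I : CVCInstance, Q I → 0 < I.ℓ → ((∃ q < (I.search b).stateCount,
      (I.search b).Reach q ∧ (I.search b).Final q) ↔ I.HasSmallCVC)) :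
    ∃ (P : RamProg) (p : Polynomial ℕ), ∀ I : CVCInstance, Q I ∧ 0 < I.ℓ →
      ∃ (t : ℕ) (s : RamState), RamExec P (RamState.init I.encode) t s ∧
        (t : ℝ) ≤ (b : ℝ) ^ I.S.card * (p.eval (inputSize I.encode) : ℕ) ∧
        (I.HasSmallCVC → s.reg 0 = 1) ∧ (¬I.HasSmallCVC → s.reg 0 = 0) := by
  obtain ⟨P, p, hP⟩ := exists_search_program hb
  refine ⟨P, p, fun I ⟨hI, hl⟩ => ?_⟩
  obtain ⟨t, s, he, ht, hs⟩ := hP I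
  rw [h I hI hl] at hs
  exact ⟨t, s, he, by exact_mod_cast ht, fun h => by rw [hs, truth_eq_one.2 h],
    fun h => by rw [hs, truth_eq_zero.2 h]⟩

theorem cvcSplitDeletion_solvable : cvcSplitDeletion.SolvableInOStar fun k => (3 : ℝ) ^ k :=
  solvable_of_search (b := 3) (.inr rfl)
    fun _ hI hl => CVCInstance.search_correct_of_isSplitDeletionSet hl hI

theorem cvcCliqueDeletion_solvable : cvcCliqueDeletion.SolvableInOStar fun k => (2 : ℝ) ^ k :=
  solvable_of_search (b := 2) (.inl rfl)
    fun _ hI hl => CVCInstance.search_correct_of_isCliqueDeletionSet hl hI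

/-! ### The reduction from Set Cover -/

namespace SetCoverInstance

variable (I : SetCoverInstance)

/-- The set with number `j` and the element with number `u` exist, and `u` belongs to the set. -/
def Has (j u : ℕ) : Prop := ∃ (hj : j < I.m) (hu : u < I.n), (⟨u, hu⟩ : Fin I.n) ∈ I.F ⟨j, hj⟩

theorem encode_getD_zero : I.encode.getD 0 0 = I.n := by simp [encode]

theorem encode_getD_one : I.encode.getD 1 0 = I.m := by simp [encode]

theorem encode_getD_two : I.encode.getD 2 0 = I.ℓ := by simp [encode]

theorem length_encode : I.encode.length = 3 + I.m * I.n := by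
  simp [encode, List.length_flatten, List.map_ofFn, Function.comp_def]
  omega

theorem encode_getD_has {j u : ℕ} (hj : j < I.m) (hu : u < I.n) :
    I.encode.getD (3 + (j * I.n + u)) 0 = truth (I.Has j u) := by
  have h0 : ∀ (l : List ℕ) (a : ℕ), ([I.n, I.m, I.ℓ] ++ l).getD (3 + a) 0 = l.getD a 0 := by
    intro l a
    rw [add_comm]
    simp [List.getD]
  have hd : (j * I.n + u) / I.n = j := by
    rw [add_comm, Nat.add_mul_div_right _ _ (by omega), Nat.div_eq_of_lt hu, zero_add]
  have hm : (j * I.n + u) % I.n = u := by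
    rw [add_comm, Nat.add_mul_mod_self_right, Nat.mod_eq_of_lt hu]
  rw [encode, h0, List.getD_flatten_ofFn, dif_pos ⟨by omega, by omega⟩]
  simp only [hd, hm]
  by_cases h : (⟨u, hu⟩ : Fin I.n) ∈ I.F ⟨j, hj⟩
  · rw [if_pos h, truth_eq_one.2 ⟨hj, hu, h⟩]
  · rw [if_neg h, truth_eq_zero.2 fun ⟨_, _, h'⟩ => h h']

/-- The edges of the graph of the reduction, directed from the smaller to the larger number: an
element `x < n` is joined to the sets `n + 1 + j` that contain it, the root `n` is joined to
all sets, and each vertex `x ≤ n` is joined to a leaf `x + n + 1 + m` of its own. -/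
def Arc (x y : ℕ) : Prop :=
  (x < I.n ∧ I.n < y ∧ y ≤ I.n + I.m ∧ I.Has (y - (I.n + 1)) x) ∨
    (x = I.n ∧ I.n < y ∧ y ≤ I.n + I.m) ∨ (x ≤ I.n ∧ y = x + I.n + 1 + I.m)

variable {I}

theorem Arc.lt {x y : ℕ} (h : I.Arc x y) : x ≤ I.n ∧ I.n < y := by
  rcases h with h | h | h <;> omega

variable (I)

/-- The instance of Connected Vertex Cover to which an instance of Set Cover is reduced. -/
def reduced : CVCInstance where
  n := 2 * I.n + I.m + 2
  G :=
    { Adj := fun x y => I.Arc x y ∨ I.Arc y x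
      symm := ⟨fun _ _ h => h.symm⟩
      loopless := ⟨fun x h => by
        have := h.elim Arc.lt Arc.lt
        omega⟩ }
  S := Finset.univ.filter fun x => x.1 < I.n
  ℓ := I.n + 1 + I.ℓ

theorem reduced_inS (u : ℕ) : I.reduced.InS u ↔ u < I.n := by
  refine ⟨fun ⟨_, h⟩ => (Finset.mem_filter.1 h).2, fun h => ⟨?_, Finset.mem_filter.2
    ⟨Finset.mem_univ _, h⟩⟩⟩
  change u < 2 * I.n + I.m + 2
  omega

theorem reduced_edge (x y : ℕ) : I.reduced.Edge x y ↔
    x < I.reduced.n ∧ y < I.reduced.n ∧ (I.Arc x y ∨ I.Arc y x) :=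
  ⟨fun ⟨hx, hy, h⟩ => ⟨hx, hy, h⟩, fun ⟨hx, hy, h⟩ => ⟨hx, hy, h⟩⟩

theorem reduced_card_S : I.reduced.S.card = I.n := by
  have : I.reduced.S.map Fin.valEmbedding = Finset.range I.n := by
    ext u
    simp only [Finset.mem_map, Fin.valEmbedding_apply, Finset.mem_range]
    rw [← I.reduced_inS]
    exact ⟨fun ⟨x, hx, h⟩ => h ▸ ⟨x.2, hx⟩, fun ⟨h, hx⟩ => ⟨_, hx, rfl⟩⟩
  rw [← Finset.card_map Fin.valEmbedding, this, Finset.card_range]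

theorem reduced_isSplitDeletionSet :
    I.reduced.G.IsSplitDeletionSet (I.reduced.S : Set (Fin I.reduced.n)) := by
  have hS : ∀ x : ((I.reduced.S : Set (Fin I.reduced.n))ᶜ : Set _), I.n ≤ x.1.1 := fun x => by
    by_contra h
    exact x.2 (Finset.mem_filter.2 ⟨Finset.mem_univ _, not_le.1 h⟩)
  refine ⟨{x | x.1.1 = I.n}, fun x hx y hy hne => ?_, fun x hx y hy hne h => ?_⟩
  · exact absurd (Subtype.ext (Fin.ext (hx.trans hy.symm))) hne
  · have hx' : x.1.1 ≠ I.n := hx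
    have hy' : y.1.1 ≠ I.n := hy
    have := hS x
    have := hS y
    have h' : I.Arc x.1.1 y.1.1 ∨ I.Arc y.1.1 x.1.1 := h
    rcases h' with h | h
    · have := h.lt; omega
    · have := h.lt; omega

/-- The elements, the root and the sets of a cover form a connected vertex cover. -/
theorem reduced_isCover {J : Finset (Fin I.m)} (hcov : ∀ u, ∃ j ∈ J, u ∈ I.F j) {X : Finset ℕ}
    (mem : ∀ u, u ∈ X ↔ u ≤ I.n ∨ ∃ j ∈ J, I.n + 1 + j.1 = u) : (I.reduced.search 2).IsCover X := by
  have hsize : I.reduced.n = 2 * I.n + I.m + 2 := rfl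
  have hset : ∀ j : Fin I.m, ∀ x, I.Arc x (I.n + 1 + j.1) ∨ I.Arc (I.n + 1 + j.1) x → x ≤ I.n →
      (I.reduced.search 2).A x (I.n + 1 + j.1) := fun j x h hx => by
    have := j.2
    exact (I.reduced_edge _ _).2 ⟨by omega, by omega, h⟩
  have hroot : ∀ j ∈ J, Relation.ReflTransGen (fun x y => (I.reduced.search 2).A x y ∧ y ∈ X)
      I.n (I.n + 1 + j.1) := fun j hj => by
    have := j.2
    exact .single ⟨hset j _ (.inl (.inr (.inl ⟨rfl, by omega, by omega⟩))) le_rfl,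
      (mem _).2 (.inr ⟨j, hj, rfl⟩)⟩
  constructor
  · intro u hu
    change u < I.reduced.n
    rcases (mem u).1 hu with hu | ⟨j, -, hj⟩
    · omega
    · have := j.2
      omega
  · intro u w huw
    rw [mem, mem]
    rcases ((I.reduced_edge u w).1 huw).2.2 with h | h
    · exact .inl (.inl h.lt.1)
    · exact .inr (.inl h.lt.1)
  · refine ⟨I.n, (mem _).2 (.inl le_rfl), fun u hu => ?_⟩
    rcases (mem u).1 hu with hu' | ⟨j, hj, hju⟩
    · rcases Nat.lt_or_eq_of_le hu' with hlt | heq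
      · obtain ⟨j, hj, huj⟩ := hcov ⟨u, hlt⟩
        have hjm := j.2
        have hA : I.Arc u (I.n + 1 + j.1) := by
          refine .inl ⟨hlt, by omega, by omega, ?_⟩
          rw [Nat.add_sub_cancel_left]
          exact ⟨j.2, hlt, huj⟩
        exact (hroot j hj).tail ⟨(I.reduced_edge _ _).2 ⟨by omega, by omega, .inr hA⟩, hu⟩
      · rw [heq]
    · rw [← hju]
      exact hroot j hj

theorem reduced_hasSmallCVC_of_hasSmallCover (h : I.HasSmallCover) : I.reduced.HasSmallCVC := by
  obtain ⟨J, hJ, hcov⟩ := h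
  refine (CVCInstance.hasSmallCVC_iff 2).2
    ⟨Finset.range (I.n + 1) ∪ J.image (fun j => I.n + 1 + j.1), I.reduced_isCover
      (J := J) (fun u => ?_) (fun u => ?_), ?_⟩
  · exact Finset.mem_biUnion.1 (by rw [hcov]; exact Finset.mem_univ u)
  · rw [Finset.mem_union, Finset.mem_range, Finset.mem_image, Nat.lt_succ_iff]
  · have h1 := Finset.card_union_le (Finset.range (I.n + 1)) (J.image fun j => I.n + 1 + j.1)
    have h2 : (J.image fun j => I.n + 1 + j.1).card ≤ J.card := Finset.card_image_le
    rw [Finset.card_range] at h1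
    exact h1.trans (Nat.add_le_add_left (h2.trans hJ) _)

theorem hasSmallCover_of_reduced_hasSmallCVC (h : I.reduced.HasSmallCVC) : I.HasSmallCover := by
  classical
  rcases Nat.eq_zero_or_pos I.n with h0 | hpos
  · exact ⟨∅, Nat.zero_le _, Finset.eq_univ_iff_forall.2 fun u => absurd u.2 (by omega)⟩
  obtain ⟨X, hX, hc⟩ := (CVCInstance.hasSmallCVC_iff 2).1 h
  have hsize : I.reduced.n = 2 * I.n + I.m + 2 := rfl
  have hcov : ∀ x y, x < I.reduced.n → y < I.reduced.n → I.Arc x y → x ∈ X ∨ y ∈ X :=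
    fun x y hx hy h => hX.cover x y ((I.reduced_edge x y).2 ⟨hx, hy, .inl h⟩)
  have hedge : ∀ x y, (I.reduced.search 2).A x y → I.Arc x y ∨ I.Arc y x := fun x y h =>
    ((I.reduced_edge x y).1 h).2.2
  obtain ⟨r, hr, hcon⟩ := hX.connected
  have hpath : ∀ {u}, Relation.ReflTransGen (fun x y => (I.reduced.search 2).A x y ∧ y ∈ X) r u →
      u ∈ X := fun {u} h => by
    rcases Relation.ReflTransGen.cases_tail h with rfl | ⟨_, _, h⟩
    · exact hr
    · exact h.2
  -- a set that separates two vertices of the cover is left along an edge within the cover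
  have cut : ∀ (P : ℕ → Prop) (a c : ℕ), a ∈ X → c ∈ X → P a → ¬P c →
      ∃ x y, x ∈ X ∧ y ∈ X ∧ P x ∧ ¬P y ∧ (I.Arc x y ∨ I.Arc y x) := fun P a c ha hc hPa hPc => by
    by_cases hPr : P r
    · obtain ⟨x, y, hx, ⟨hA, hy⟩, h1, h2⟩ := SearchData.exists_leaving (hcon c hc) hPr hPc
      exact ⟨x, y, hpath hx, hy, h1, h2, hedge x y hA⟩
    · obtain ⟨x, y, hx, ⟨hA, hy⟩, h1, h2⟩ := SearchData.exists_leaving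
        (P := fun x => ¬P x) (hcon a ha) hPr (not_not.2 hPa)
      exact ⟨y, x, hy, hpath hx, not_not.1 h2, h1, (hedge x y hA).symm⟩
  have leaf : ∀ i ≤ I.n, ∀ y, (I.Arc (i + I.n + 1 + I.m) y ∨ I.Arc y (i + I.n + 1 + I.m)) →
      y = i := fun i hi y h => by
    rcases h with h | h
    · have := h.lt; omega
    · rcases h with h | h | h <;> omega
  have hin : ∀ i ≤ I.n, i ∈ X := fun i hi => by
    by_contra hiX
    have hleaf : ∀ k ≤ I.n, k ∈ X ∨ k + I.n + 1 + I.m ∈ X := fun k hk =>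
      hcov k _ (by omega) (by omega) (.inr (.inr ⟨hk, rfl⟩))
    obtain ⟨k, hk, hki⟩ : ∃ k ≤ I.n, k ≠ i := by
      rcases Nat.eq_zero_or_pos i with rfl | hi'
      · exact ⟨I.n, le_rfl, by omega⟩
      · exact ⟨0, Nat.zero_le _, by omega⟩
    obtain ⟨c, hcX, hci⟩ : ∃ c ∈ X, c ≠ i + I.n + 1 + I.m :=
      (hleaf k hk).elim (fun h => ⟨_, h, by omega⟩) fun h => ⟨_, h, by omega⟩
    obtain ⟨x, y, -, hy, rfl, -, hA⟩ := cut (fun x => x = i + I.n + 1 + I.m) _ c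
      ((hleaf i hi).resolve_left hiX) hcX rfl hci
    exact hiX (leaf i hi y hA ▸ hy)
  refine ⟨Finset.univ.filter fun j : Fin I.m => I.n + 1 + j.1 ∈ X, ?_, ?_⟩
  · have h1 : Finset.range (I.n + 1) ∪ (Finset.univ.filter fun j : Fin I.m =>
        I.n + 1 + j.1 ∈ X).image (fun j => I.n + 1 + j.1) ⊆ X := by
      refine Finset.union_subset (fun i hi => hin i (Nat.lt_succ_iff.1 (Finset.mem_range.1 hi))) ?_
      intro x hx
      obtain ⟨j, hj, rfl⟩ := Finset.mem_image.1 hx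
      exact (Finset.mem_filter.1 hj).2
    have h2 : Disjoint (Finset.range (I.n + 1)) ((Finset.univ.filter fun j : Fin I.m =>
        I.n + 1 + j.1 ∈ X).image (fun j => I.n + 1 + j.1)) := by
      refine Finset.disjoint_left.2 fun x hx hx' => ?_
      obtain ⟨j, _, rfl⟩ := Finset.mem_image.1 hx'
      have := Finset.mem_range.1 hx
      omega
    have h3 := Finset.card_le_card h1
    rw [Finset.card_union_of_disjoint h2, Finset.card_range, Finset.card_image_of_injective _
      (fun i j h => Fin.ext (by simpa using h))] at h3
    have h4 : X.card ≤ I.n + 1 + I.ℓ := hc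
    omega
  · refine Finset.eq_univ_iff_forall.2 fun u => ?_
    have hu := u.2
    obtain ⟨x, y, -, hy, hx, hny, hA⟩ := cut (fun x => x = u.1 ∨ x = u.1 + I.n + 1 + I.m) u.1 I.n
      (hin _ hu.le) (hin _ le_rfl) (.inl rfl) (by omega)
    rcases hx with rfl | rfl
    · rcases hA with h | h
      · rcases h with ⟨-, h1, h2, hj, _, hmem⟩ | h | h
        · refine Finset.mem_biUnion.2 ⟨⟨_, hj⟩, Finset.mem_filter.2 ⟨Finset.mem_univ _, ?_⟩, hmem⟩
          rwa [show I.n + 1 + (y - (I.n + 1)) = y by omega]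
        · omega
        · exact absurd (.inr h.2) hny
      · have := h.lt; omega
    · exact absurd (.inl (leaf u.1 hu.le y hA)) hny

theorem reduced_hasSmallCVC_iff : I.reduced.HasSmallCVC ↔ I.HasSmallCover :=
  ⟨I.hasSmallCover_of_reduced_hasSmallCVC, I.reduced_hasSmallCVC_of_hasSmallCover⟩

end SetCoverInstance

/-! ### The reduction on a random access machine -/

/-- A program that fills cells of the memory in as many rounds as register `0` says, one cell in
each round. It is specified by the contents `μ z` of the memory after `z` rounds. -/
theorem exists_fill {addr val : RamState → ℕ} (haddr : Evaluable 3 addr) (hval : Evaluable 3 val) :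
    ∃ (P : RamProg) (p : Polynomial ℕ), ∀ (μ : ℕ → ℕ → ℕ) (n B : ℕ) (s : RamState),
      s.reg 0 = n → s.mem = μ 0 → n ≤ B → (∀ z ≤ n, ∀ x, μ z x < 2 ^ B) →
      (∀ (z : ℕ) (s : RamState), z < n → s.reg 0 = n → s.reg 1 = z → s.mem = μ z →
        Function.update (μ z) (addr s) (val s) = μ (z + 1)) →
      ∃ t s', RamExec P s t s' ∧ t ≤ p.eval B ∧ s'.reg 0 = n ∧ s'.mem = μ n := by
  obtain ⟨P, p, hP⟩ := exists_loop haddr hval (Evaluable.const 3 0)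
  refine ⟨.seq (.const 1 0) (.seq (.const 2 0) (.seq (.const 4 1) (.seq (.arith .div 3 0 4) P))),
    Polynomial.C 8 + Polynomial.C 2 * .X + (.X + Polynomial.C 1) * p,
    fun μ n B s h0 hm hn hb hstep => ?_⟩
  have hBB : B < 2 ^ B := Nat.lt_two_pow_self
  have x := RamExec.arith .div 3 0 4 (((s.setReg 1 0).setReg 2 0).setReg 4 1)
  simp [RamOp.eval, h0] at x
  obtain ⟨t, s', he, ht, r0, -, -, hI⟩ := hP (fun z a m => a = 0 ∧ m = μ z) n n B
    ((((s.setReg 1 0).setReg 2 0).setReg 4 1).setReg 3 n) (by simp [h0]) (by simp) (by simp)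
    ⟨by simp, by simpa using hm⟩ hn (by omega)
    (fun z a m hz ⟨ha, hm⟩ => ⟨by omega, fun x => hm ▸ hb z hz x⟩)
    (fun s h0 h1 ⟨_, hm⟩ => ⟨rfl, hm ▸ hstep _ s h1 h0 rfl hm⟩)
  refine ⟨_, s', .seq (.const _ _ _) (.seq (.const _ _ _) (.seq (.const _ _ _) (.seq x he))), ?_,
    r0, hI⟩
  have b1 := bitCost_le (hn.trans_lt hBB)
  have h1 : (n + 1) * p.eval B ≤ (B + 1) * p.eval B := Nat.mul_le_mul_right _ (by omega)
  have h8 : bitCost 1 = 2 := rfl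
  have h9 : bitCost 0 = 1 := rfl
  simp only [Polynomial.eval_add, Polynomial.eval_mul, Polynomial.eval_X, Polynomial.eval_C, h8, h9]
  omega

/-- The number of vertices of the graph of the reduction, computed from the encoding of an instance
of Set Cover in the memory. -/
def reducedSizeAt (s : RamState) : ℕ := 2 * s.mem 0 + s.mem 1 + 2

/-- The length of the encoding of the instance to which the instance in the memory is reduced. -/
def reducedLengthAt (s : RamState) : ℕ :=
  2 + reducedSizeAt s + reducedSizeAt s * reducedSizeAt s

/-- The edges of the reduction, read off from the encoding of an instance of Set Cover. -/
def arcAt (s : RamState) (x y : ℕ) : Prop :=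
  (x < s.mem 0 ∧ s.mem 0 < y ∧ y ≤ s.mem 0 + s.mem 1 ∧
      s.mem (3 + ((y - (s.mem 0 + 1)) * s.mem 0 + x)) = 1) ∨
    (x = s.mem 0 ∧ s.mem 0 < y ∧ y ≤ s.mem 0 + s.mem 1) ∨
    (x ≤ s.mem 0 ∧ y = x + s.mem 0 + 1 + s.mem 1)

/-- Entry `i` of the encoding of the instance to which the instance in the memory is reduced. -/
noncomputable def reducedEntryAt (s : RamState) (i : ℕ) : ℕ :=
  if i = 0 then reducedSizeAt s else if i = 1 then s.mem 0 + 1 + s.mem 2 else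
    if i < 2 + reducedSizeAt s then truth (i - 2 < s.mem 0) else
      if i < reducedLengthAt s then
        truth ((i - 2 - reducedSizeAt s) / reducedSizeAt s < reducedSizeAt s ∧
          (i - 2 - reducedSizeAt s) % reducedSizeAt s < reducedSizeAt s ∧
          (arcAt s ((i - 2 - reducedSizeAt s) / reducedSizeAt s)
              ((i - 2 - reducedSizeAt s) % reducedSizeAt s) ∨
            arcAt s ((i - 2 - reducedSizeAt s) % reducedSizeAt s)
              ((i - 2 - reducedSizeAt s) / reducedSizeAt s)))
      else 0

section Evaluable

variable {d : ℕ} {x y : RamState → ℕ}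

theorem Evaluable.cell (d a : ℕ) : Evaluable d fun s => s.mem a := (Evaluable.const d a).mem

theorem evaluable_reducedSizeAt (d : ℕ) : Evaluable d reducedSizeAt :=
  (((Evaluable.const d 2).mul (.cell d 0)).add (.cell d 1)).add (.const d 2)

theorem evaluable_reducedLengthAt (d : ℕ) : Evaluable d reducedLengthAt :=
  have h := evaluable_reducedSizeAt d
  ((Evaluable.const d 2).add h).add (h.mul h)

theorem checkable_arcAt (hx : Evaluable d x) (hy : Evaluable d y) :
    Checkable d fun s => arcAt s (x s) (y s) := by
  have h0 := Evaluable.cell d 0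
  have h1 := Evaluable.cell d 1
  have c1 := Evaluable.const d 1
  exact ((Checkable.lt hx h0).and ((Checkable.lt h0 hy).and ((Checkable.le hy (h0.add h1)).and
      (Checkable.eq (((Evaluable.const d 3).add (((hy.sub (h0.add c1)).mul h0).add hx)).mem) c1)))).or
    (((Checkable.eq hx h0).and ((Checkable.lt h0 hy).and (Checkable.le hy (h0.add h1)))).or
      ((Checkable.le hx h0).and (Checkable.eq hy (((hx.add h0).add c1).add h1))))

theorem evaluable_reducedEntryAt (hx : Evaluable d x) :
    Evaluable d fun s => reducedEntryAt s (x s) := by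
  have h0 := Evaluable.cell d 0
  have c1 := Evaluable.const d 1
  have c2 := Evaluable.const d 2
  have hn := evaluable_reducedSizeAt d
  have hl := evaluable_reducedLengthAt d
  have hi := (hx.sub c2).sub hn
  have hu := hi.div hn
  have hw := hi.mod hn
  have hS : Evaluable d fun s => truth _ := Checkable.lt (hx.sub c2) h0
  have hE : Evaluable d fun s => truth _ := (Checkable.lt hu hn).and ((Checkable.lt hw hn).and
    ((checkable_arcAt hu hw).or (checkable_arcAt hw hu)))
  exact Checkable.ite (Checkable.eq hx (.const d 0)) hn (Checkable.ite (Checkable.eq hx c1)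
    ((h0.add c1).add (.cell d 2)) (Checkable.ite (Checkable.lt hx (c2.add hn)) hS
      (Checkable.ite (Checkable.lt hx hl) hE (.const d 0))))

end Evaluable

theorem inputSize_le_mul {w : List ℕ} {B : ℕ} (h : ∀ i, w.getD i 0 < 2 ^ B) :
    inputSize w ≤ w.length * (B + 1) := by
  induction w with
  | nil => simp [inputSize]
  | cons a w ih =>
    have h1 := bitCost_le (h 0)
    have h2 := ih fun i => h (i + 1)
    simp only [inputSize, List.map_cons, List.sum_cons, List.length_cons] at h1 h2 ⊢
    rw [add_mul, one_mul]
    simp at h1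
    omega

namespace SetCoverInstance

variable {I : SetCoverInstance}

theorem reducedSizeAt_eq {s : RamState}
    (hm : ∀ a < 3 + I.m * I.n, s.mem a = I.encode.getD a 0) : reducedSizeAt s = I.reduced.n := by
  rw [reducedSizeAt, hm 0 (by omega), hm 1 (by omega), encode_getD_zero, encode_getD_one]
  rfl

theorem reducedLengthAt_eq {s : RamState}
    (hm : ∀ a < 3 + I.m * I.n, s.mem a = I.encode.getD a 0) :
    reducedLengthAt s = I.reduced.encode.length := by
  rw [reducedLengthAt, reducedSizeAt_eq hm, CVCInstance.length_encode]

theorem arcAt_iff {s : RamState} (hm : ∀ a < 3 + I.m * I.n, s.mem a = I.encode.getD a 0)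
    (x y : ℕ) : arcAt s x y ↔ I.Arc x y := by
  rw [arcAt, Arc, hm 0 (by omega), hm 1 (by omega), encode_getD_zero, encode_getD_one]
  refine or_congr_left (and_congr_right fun hx => and_congr_right fun h1 =>
    and_congr_right fun h2 => ?_)
  have hj : y - (I.n + 1) < I.m := by omega
  have h3 : (y - (I.n + 1) + 1) * I.n ≤ I.m * I.n := Nat.mul_le_mul_right _ hj
  rw [add_mul, one_mul] at h3
  rw [hm _ (by omega), I.encode_getD_has hj hx, truth_eq_one]

theorem reducedEntryAt_eq {s : RamState}
    (hm : ∀ a < 3 + I.m * I.n, s.mem a = I.encode.getD a 0) (i : ℕ) :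
    reducedEntryAt s i = I.reduced.encode.getD i 0 := by
  have h2 : s.mem 0 + 1 + s.mem 2 = I.reduced.ℓ := by
    rw [hm 0 (by omega), hm 2 (by omega), encode_getD_zero, encode_getD_two]
    rfl
  have h0 : s.mem 0 = I.n := by rw [hm 0 (by omega), encode_getD_zero]
  rw [reducedEntryAt, h2, h0, reducedLengthAt, reducedSizeAt_eq hm, CVCInstance.encode_getD]
  simp only [arcAt_iff hm, reduced_inS, reduced_edge]

/-- A bound, polynomial in the size of an instance of Set Cover, on the length of the encoding of
the instance to which it is reduced, and on the number of bits of the entries. -/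
noncomputable def reducedBound : Polynomial ℕ :=
  Polynomial.C 2 + (Polynomial.C 3 * .X + Polynomial.C 2) +
    (Polynomial.C 3 * .X + Polynomial.C 2) ^ 2

theorem reducedBound_eval (N : ℕ) :
    reducedBound.eval N = 2 + (3 * N + 2) + (3 * N + 2) * (3 * N + 2) := by
  simp [reducedBound, sq]

theorem reduced_n_le (hn : 0 < I.n) (hm : 0 < I.m) :
    I.reduced.n ≤ 3 * inputSize I.encode + 2 := by
  have h1 := length_le_inputSize I.encode
  rw [length_encode] at h1
  have h2 : I.n ≤ I.m * I.n := Nat.le_mul_of_pos_left _ hm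
  have h3 : I.m ≤ I.m * I.n := Nat.le_mul_of_pos_right _ hn
  change 2 * I.n + I.m + 2 ≤ _
  omega

theorem length_reduced_le (hn : 0 < I.n) (hm : 0 < I.m) :
    I.reduced.encode.length ≤ reducedBound.eval (inputSize I.encode) := by
  have h := reduced_n_le hn hm
  have := Nat.mul_le_mul h h
  rw [CVCInstance.length_encode, reducedBound_eval]
  omega

theorem reduced_getD_lt (hn : 0 < I.n) (hm : 0 < I.m) (i : ℕ) :
    I.reduced.encode.getD i 0 < 2 ^ reducedBound.eval (inputSize I.encode) := by
  have h0 : (1 : ℕ) < 2 ^ reducedBound.eval (inputSize I.encode) :=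
    Nat.one_lt_two_pow (by rw [reducedBound_eval]; omega)
  have ht : ∀ p : Prop, truth p < 2 ^ reducedBound.eval (inputSize I.encode) := fun p =>
    (truth_le_one p).trans_lt h0
  have h := reduced_n_le hn hm
  rw [CVCInstance.encode_getD]
  split_ifs
  · refine lt_of_le_of_lt ?_ (Nat.lt_two_pow_self (n := reducedBound.eval (inputSize I.encode)))
    rw [reducedBound_eval]
    omega
  · change I.n + 1 + I.ℓ < _
    have h1 := getD_lt_two_pow I.encode 0
    have h2 := getD_lt_two_pow I.encode 2
    rw [encode_getD_zero] at h1
    rw [encode_getD_two] at h2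
    have h3 : 2 ^ (inputSize I.encode + 2) ≤ 2 ^ reducedBound.eval (inputSize I.encode) :=
      Nat.pow_le_pow_right two_pos (by rw [reducedBound_eval]; omega)
    rw [pow_add] at h3
    omega
  · exact ht _
  · exact ht _
  · omega

/-- The reduced instance can be computed in place in polynomial time: it is first written behind the
given instance, then copied to the beginning of the memory, and the first copy is erased. -/
theorem exists_reduction_program : ∃ (P : RamProg) (p : Polynomial ℕ), ∀ I : SetCoverInstance,
    0 < I.n → 0 < I.m → ∀ s : RamState, (∀ i ≤ 3, s.reg i = 0) →
      s.mem = (fun a => I.encode.getD a 0) →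
      ∃ t s', RamExec P s t s' ∧ t ≤ p.eval (inputSize I.encode) ∧
        s'.mem = fun a => I.reduced.encode.getD a 0 := by
  have r0 : Evaluable 3 fun s => s.reg 0 := .reg (by omega)
  have r1 : Evaluable 3 fun s => s.reg 1 := .reg (by omega)
  obtain ⟨Q, c, hQ⟩ := (evaluable_reducedLengthAt 3).exec 3 le_rfl
  obtain ⟨P₁, p₁, hP₁⟩ := exists_fill (r0.add r1) (evaluable_reducedEntryAt r1)
  obtain ⟨P₂, p₂, hP₂⟩ := exists_fill r1 (r0.add r1).mem
  obtain ⟨P₃, p₃, hP₃⟩ := exists_fill (r0.add r1) (.const 3 0)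
  refine ⟨.seq Q (.seq (.const 5 1) (.seq (.arith .div 0 4 5) (.seq P₁ (.seq P₂ P₃)))),
    (c + (Polynomial.C 6 + Polynomial.C 2 * Polynomial.X) + p₁ + p₂ + p₃).comp reducedBound,
    fun I hn hm s hr hs => ?_⟩
  set B := reducedBound.eval (inputSize I.encode) with hB
  have hZB : I.reduced.encode.length ≤ B := length_reduced_le hn hm
  have he' : ∀ a, I.reduced.encode.getD a 0 < 2 ^ B := reduced_getD_lt hn hm
  have he : ∀ a, I.encode.getD a 0 < 2 ^ B := fun a => (getD_lt_two_pow _ a).trans_le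
    (Nat.pow_le_pow_right two_pos (by rw [hB, reducedBound_eval]; omega))
  have hLZ : 3 + I.m * I.n ≤ I.reduced.encode.length := by
    rw [CVCInstance.length_encode]
    have h1 : I.reduced.n = 2 * I.n + I.m + 2 := rfl
    have h2 : I.m * I.n ≤ I.reduced.n * I.reduced.n := Nat.mul_le_mul (by omega) (by omega)
    omega
  have hd : ∀ a ≥ I.encode.length, I.encode.getD a 0 = 0 := fun a ha =>
    List.getD_eq_default _ _ ha
  have hd' : ∀ a ≥ I.reduced.encode.length, I.reduced.encode.getD a 0 = 0 := fun a ha =>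
    List.getD_eq_default _ _ ha
  rw [length_encode] at hd
  have hentry : ∀ s : RamState, (∀ a < I.reduced.encode.length, s.mem a = I.encode.getD a 0) →
      ∀ i, reducedEntryAt s i = I.reduced.encode.getD i 0 := fun s h =>
    reducedEntryAt_eq fun a ha => h a (by omega)
  have hlen : reducedLengthAt s = I.reduced.encode.length :=
    reducedLengthAt_eq fun a _ => by rw [hs]
  generalize I.reduced.encode.length = Z at *
  have hB0 : (0 : ℕ) < 2 ^ B := by positivity
  have hBB : B < 2 ^ B := Nat.lt_two_pow_self
  have hsB : s.Bounded 3 B := by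
    refine ⟨?_, fun i hi => ?_, fun a => ?_⟩
    · rw [hr 0 (by omega)]
      omega
    · rwa [hr i hi]
    · rw [hs]
      exact he a
  obtain ⟨t, s₁, e₁, c₁, v₁, g₁⟩ := hQ s B hsB
  rw [hlen] at v₁
  have x := RamExec.arith .div 0 4 5 (s₁.setReg 5 1)
  simp [RamOp.eval, v₁] at x
  obtain ⟨t₂, s₂, e₂, c₂, z₂, m₂⟩ := hP₁ (fun z a => if a < Z then I.encode.getD a 0 else
      if a < Z + z then I.reduced.encode.getD (a - Z) 0 else 0) Z B ((s₁.setReg 5 1).setReg 0 Z)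
    (by simp)
    (by
      rw [RamState.setReg_mem, RamState.setReg_mem, g₁.mem, hs]
      funext a
      split_ifs with h h'
      · rfl
      · omega
      · exact hd a (by omega))
    hZB
    (fun z _ a => by
      split_ifs
      exacts [he a, he' _, hB0])
    (fun z s hz h0 h1 hsm => by
      rw [hentry s (fun a ha => by rw [hsm]; exact if_pos ha), h0, h1]
      funext a
      rw [Function.update_apply]
      by_cases ha : a = Z + z
      · rw [if_pos ha, if_neg (by omega), if_pos (by omega)]
        congr 1
        omega
      · rw [if_neg ha]
        split_ifs <;> first | rfl | omega)
  obtain ⟨t₃, s₃, e₃, c₃, z₃, m₃⟩ := hP₂ (fun z a => if a < z then I.reduced.encode.getD a 0 else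
      if a < Z then I.encode.getD a 0 else
        if a < Z + Z then I.reduced.encode.getD (a - Z) 0 else 0) Z B s₂ z₂
    (by
      rw [m₂]
      funext a
      rw [if_neg (Nat.not_lt_zero a)])
    hZB
    (fun z _ a => by
      split_ifs
      exacts [he' a, he a, he' _, hB0])
    (fun z s hz h0 h1 hsm => by
      rw [hsm, h0, h1]
      beta_reduce
      rw [if_neg (by omega), if_neg (by omega), if_pos (by omega),
        Nat.add_sub_cancel_left]
      funext a
      rw [Function.update_apply]
      by_cases ha : a = z
      · rw [if_pos ha, if_pos (by omega), ha]
      · rw [if_neg ha]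
        split_ifs <;> first | rfl | omega)
  obtain ⟨t₄, s₄, e₄, c₄, z₄, m₄⟩ := hP₃ (fun z a => if a < Z then I.reduced.encode.getD a 0 else
      if a < Z + z then 0 else
        if a < Z + Z then I.reduced.encode.getD (a - Z) 0 else 0) Z B s₃ z₃
    (by
      rw [m₃]
      funext a
      split_ifs <;> first | rfl | omega)
    hZB
    (fun z _ a => by
      split_ifs
      exacts [he' a, hB0, he' _, hB0])
    (fun z s hz h0 h1 hsm => by
      rw [h0, h1]
      funext a
      rw [Function.update_apply]
      by_cases ha : a = Z + z
      · rw [if_pos ha, if_neg (by omega), if_pos (by omega)]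
      · rw [if_neg ha]
        split_ifs <;> first | rfl | omega)
  refine ⟨_, s₄, .seq e₁ (.seq (.const _ _ _) (.seq x (.seq e₂ (.seq e₃ e₄)))), ?_, ?_⟩
  · have b1 := bitCost_le (hZB.trans_lt hBB)
    have h8 : bitCost 1 = 2 := rfl
    simp only [Polynomial.eval_add, Polynomial.eval_mul, Polynomial.eval_comp, Polynomial.eval_X,
      Polynomial.eval_C, h8, ← hB]
    omega
  · rw [m₄]
    funext a
    split_ifs <;> first | rfl | exact (hd' a (by omega)).symm

theorem inputSize_reduced_le (hn : 0 < I.n) (hm : 0 < I.m) : inputSize I.reduced.encode ≤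
    (reducedBound * (reducedBound + Polynomial.C 1)).eval (inputSize I.encode) := by
  refine (inputSize_le_mul (reduced_getD_lt hn hm)).trans ?_
  simp only [Polynomial.eval_mul, Polynomial.eval_add, Polynomial.eval_C]
  exact Nat.mul_le_mul_right _ (length_reduced_le hn hm)

/-- Without elements or without sets, there is a cover if and only if there are no elements. -/
theorem hasSmallCover_iff_of_mul_eq_zero (h : I.n * I.m = 0) : I.HasSmallCover ↔ I.n = 0 := by
  constructor
  · rintro ⟨J, -, hJ⟩
    by_contra hn
    have hm : I.m = 0 := (Nat.mul_eq_zero.1 h).resolve_left hn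
    have : (⟨0, Nat.pos_of_ne_zero hn⟩ : Fin I.n) ∈ J.biUnion I.F := by
      rw [hJ]
      exact Finset.mem_univ _
    obtain ⟨j, -, -⟩ := Finset.mem_biUnion.1 this
    exact absurd j.2 (by omega)
  · intro hn
    exact ⟨∅, Nat.zero_le _, Finset.eq_univ_iff_forall.2 fun u => absurd u.2 (by omega)⟩

end SetCoverInstance

/-! ### Transfer of running times -/

/-- An algorithm for Connected Vertex Cover with a split deletion set yields one for Set Cover, with
the size of the universe in place of the size of the deletion set. -/
theorem setCover_solvable_of_cvcSplitDeletion_solvable {α β : ℝ} (hα : 0 ≤ α) (hαβ : α ≤ β)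
    (hβ : 1 ≤ β) (h : cvcSplitDeletion.SolvableInOStar fun k => α ^ k) :
    setCover.SolvableInOStar fun k => β ^ k := by
  obtain ⟨P, p, hP⟩ := h
  obtain ⟨R, r, hR⟩ := SetCoverInstance.exists_reduction_program
  have h0 := Evaluable.cell 3 0
  obtain ⟨Q, a, hQ⟩ := (h0.mul (Evaluable.cell 3 1)).exec 3 le_rfl
  obtain ⟨Q', a', hQ'⟩ := ((Evaluable.const 3 1).sub h0).exec 3 le_rfl
  obtain ⟨K, hK⟩ := RamExec.exists_reg_eq Q
  obtain ⟨K', hK'⟩ := RamExec.exists_reg_eq R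
  obtain ⟨C, c, hC⟩ := exists_clear (max K K')
  -- the reduction, except for instances without elements or without sets
  refine ⟨.seq Q (.cond 4 (.seq R (.seq C P)) (.seq Q' (.seq (.const 5 1) (.arith .div 0 4 5)))),
    a + (Polynomial.C 2 * .X + Polynomial.C 1) + (r + Polynomial.C c) + (a' + Polynomial.C 8) +
      p.comp (SetCoverInstance.reducedBound * (SetCoverInstance.reducedBound + Polynomial.C 1)),
    fun (I : SetCoverInstance) (hl : 0 < I.ℓ) => ?_⟩
  change ∃ (t : ℕ) (s : RamState), RamExec _ (RamState.init I.encode) t s ∧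
    (t : ℝ) ≤ β ^ I.n * (Polynomial.eval (inputSize I.encode) _ : ℕ) ∧
    (I.HasSmallCover → s.reg 0 = 1) ∧ (¬I.HasSmallCover → s.reg 0 = 0)
  set N := inputSize I.encode with hN
  set s₀ := RamState.init I.encode with hs₀
  have hm0 : s₀.mem 0 = I.n := I.encode_getD_zero
  have hm1 : s₀.mem 1 = I.m := I.encode_getD_one
  have hB : s₀.Bounded 3 N :=
    ⟨Nat.zero_le _, fun _ _ => by simp [hs₀, RamState.init], fun a => getD_lt_two_pow _ a⟩
  obtain ⟨t₁, s₁, e₁, c₁, v₁, g₁⟩ := hQ s₀ N hB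
  rw [hm0, hm1] at v₁
  have hβ1 : (1 : ℝ) ≤ β ^ I.n := one_le_pow₀ hβ
  have cost : bitCost (I.n * I.m) ≤ 2 * N + 1 := by
    have h0 := hB.mem 0
    have h1 := hB.mem 1
    rw [hm0] at h0
    rw [hm1] at h1
    refine bitCost_le ?_
    rw [two_mul, pow_add]
    exact Nat.mul_lt_mul'' h0 h1
  rcases Nat.eq_zero_or_pos (I.n * I.m) with hnm | hnm
  · obtain ⟨t₂, s₂, e₂, c₂, v₂, -⟩ := hQ' s₁ N (hB.of_agree g₁)
    rw [g₁.mem, hm0] at v₂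
    have x := RamExec.arith .div 0 4 5 (s₂.setReg 5 1)
    simp [RamOp.eval, v₂] at x
    refine ⟨_, _, .seq e₁ (.cond_false (v₁.trans hnm) (.seq e₂ (.seq (.const _ _ _) x))), ?_, ?_, ?_⟩
    · refine le_trans ?_ (le_mul_of_one_le_left (Nat.cast_nonneg _) hβ1)
      have b1 := bitCost_le (v := 1 - I.n) (B := 1) (by omega)
      have h8 : bitCost 1 = 2 := rfl
      rw [v₁]
      norm_cast
      simp only [Polynomial.eval_add, Polynomial.eval_mul, Polynomial.eval_comp, Polynomial.eval_X,
        Polynomial.eval_C, h8]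
      omega
    · intro h
      have := (SetCoverInstance.hasSmallCover_iff_of_mul_eq_zero hnm).1 h
      simp [this]
    · intro h
      have := mt (SetCoverInstance.hasSmallCover_iff_of_mul_eq_zero hnm).2 h
      simp
      omega
  · have hn : 0 < I.n := Nat.pos_of_mul_pos_right hnm
    have hm : 0 < I.m := Nat.pos_of_mul_pos_left hnm
    obtain ⟨t₂, s₂, e₂, c₂, m₂⟩ := hR I hn hm s₁ (fun i hi => (g₁.reg i hi).trans rfl) g₁.mem
    obtain ⟨t₃, s₃, e₃, c₃, m₃, r₃⟩ := hC s₂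
    have hs₃ : s₃ = RamState.init I.reduced.encode := by
      have hreg : s₃.reg = fun _ => 0 := funext fun i => by
        rw [r₃]
        split_ifs with h
        · rfl
        · rw [hK' _ _ _ e₂ i (by omega), hK _ _ _ e₁ i (by omega)]
          rfl
      have hmem := m₃.trans m₂
      cases s₃
      cases hreg
      cases hmem
      rfl
    obtain ⟨t₄, s₄, e₄, c₄, hy, hno⟩ := hP I.reduced
      ⟨I.reduced_isSplitDeletionSet, Nat.succ_pos _ |>.trans_le (Nat.le_add_right _ _)⟩
    change RamExec P (RamState.init I.reduced.encode) t₄ s₄ at e₄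
    rw [← hs₃] at e₄
    refine ⟨_, s₄, .seq e₁ (.cond_true (ne_of_eq_of_ne v₁ hnm.ne') (.seq e₂ (.seq e₃ e₄))), ?_,
      fun h => hy (I.reduced_hasSmallCVC_iff.2 h), fun h => hno (mt I.reduced_hasSmallCVC_iff.1 h)⟩
    change (t₄ : ℝ) ≤ α ^ I.reduced.S.card * (p.eval (inputSize I.reduced.encode) : ℕ) at c₄
    rw [I.reduced_card_S] at c₄
    rw [v₁]
    rw [← hN] at c₂
    set X := a.eval N + (2 * N + 1) + (r.eval N + c) + (a'.eval N + 8) with hX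
    set Y := p.eval ((SetCoverInstance.reducedBound *
      (SetCoverInstance.reducedBound + Polynomial.C 1)).eval N) with hY
    have h1 : Polynomial.eval N (a + (Polynomial.C 2 * .X + Polynomial.C 1) +
        (r + Polynomial.C c) + (a' + Polynomial.C 8) + p.comp (SetCoverInstance.reducedBound *
          (SetCoverInstance.reducedBound + Polynomial.C 1))) = X + Y := by
      simp [hX, hY]
    have h2 : (p.eval (inputSize I.reduced.encode) : ℕ) ≤ Y :=
      Polynomial.eval_le_eval_of_le_nat _ (SetCoverInstance.inputSize_reduced_le hn hm)
    have h3 : t₁ + (bitCost (I.n * I.m) + (t₂ + t₃)) ≤ X := by omega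
    have h4 : (t₄ : ℝ) ≤ β ^ I.n * Y := c₄.trans (mul_le_mul (pow_le_pow_left₀ hα hαβ _)
      (by exact_mod_cast h2) (Nat.cast_nonneg _) (zero_le_one.trans hβ1))
    have h5 : (X : ℝ) ≤ β ^ I.n * X := le_mul_of_one_le_left (Nat.cast_nonneg _) hβ1
    have h6 : ((t₁ + (bitCost (I.n * I.m) + (t₂ + t₃)) : ℕ) : ℝ) ≤ X := by exact_mod_cast h3
    rw [h1]
    push_cast at h6 ⊢
    rw [mul_add]
    linarith

/-- No algorithm runs in time `O*(α^k)` with `α ≤ 0`, as every program takes positive time. -/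
theorem not_cvcSplitDeletion_solvable_of_nonpos {α : ℝ} (hα : α ≤ 0) :
    ¬cvcSplitDeletion.SolvableInOStar fun k => α ^ k := by
  rintro ⟨P, p, hP⟩
  let I : CVCInstance := ⟨1, ⊥, Finset.univ, 1⟩
  have hI : I.G.IsSplitDeletionSet (I.S : Set (Fin I.n)) :=
    ⟨∅, fun x hx => absurd hx (Set.notMem_empty x), fun x _ => absurd (Finset.mem_univ x.1) x.2⟩
  obtain ⟨t, s, he, ht, -⟩ := hP I ⟨hI, one_pos⟩
  change (t : ℝ) ≤ α ^ 1 * _ at ht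
  rw [pow_one] at ht
  have h1 : (0 : ℝ) < t := Nat.cast_pos.2 he.time_pos
  exact absurd (h1.trans_le ht) (not_lt.2 (mul_nonpos_of_nonpos_of_nonneg hα (Nat.cast_nonneg _)))

theorem mainTheorem2 :
    cvcSplitDeletion.SolvableInOStar (fun k => (3 : ℝ) ^ k) ∧
    (SetCoverConjecture →
      ∀ ε : ℝ, 0 < ε → ¬ cvcSplitDeletion.SolvableInOStar (fun k => (2 - ε) ^ k)) ∧
    cvcCliqueDeletion.SolvableInOStar (fun k => (2 : ℝ) ^ k) := by
  refine ⟨cvcSplitDeletion_solvable, fun hSC ε hε h => ?_, cvcCliqueDeletion_solvable⟩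
  rcases le_or_gt (2 - ε) 0 with h2 | h2
  · exact not_cvcSplitDeletion_solvable_of_nonpos h2 h
  · -- the base has to be at least `1` to absorb the time of the reduction
    refine hSC (min ε 1) (lt_min hε one_pos)
      (setCover_solvable_of_cvcSplitDeletion_solvable h2.le ?_ ?_ h)
    · linarith [min_le_left ε 1]
    · linarith [min_le_right ε 1]
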